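/- Conventions. For $k\ge 1$ and an element $x$ of $\mathbb Z[q]$ put $[k]_x:=1+x+\cdots+x^{k-1}$. Let $(W,S)$ be a Coxeter system with length function $\ell$, and let $\widehat S$ be a partition of $S$ such that for each block $I\in\widehat S$ the subgroup $W_I=\langle I\rangle$ is finite; let $r_I$ be the longest element of $W_I$, $R=\{r_I : I\in\widehat S\}$ and $\widehat W=\langle R\rangle\subseteq W$. The partition is admissible if for all $w\in\widehat W$ and $I\in\widehat S$ either $\ell(ws)=\ell(w)+1$ for all $s\in I$, or $\ell(ws)=\ell(w)-1$ for all $s\in I$; then $\widehat W$ is called a folding subgroup of $W$. If $\phi$ is an injective homomorphism from a finite Coxeter group (again denoted $\widehat W$) onto the folding subgroup that maps the simple reflections onto $R$, the unfolding polynomial is $U_{\widehat W}^{W}(q)=\sum_{w\in\widehat W}q^{\ell(\phi(w))}\in\mathbb Z[q]$. Coxeter graphs: $A_N$ is the path $s_1 - s_2 - \cdots - s_N$ with all labels $3$; $B_n$ is the path $r_1 - \cdots - r_n$ with all labels $3$ except that the edge $r_{n-1} - r_n$ has label $4$; $D_{n+1}$ has the edges $s_i - s_{i+1}$ for $1\le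 i<n$ and $s_{n-1} - s_{n+1}$, with label $3$; $I_2(n+1)$ has two nodes $r_1,r_2$ with $m(r_1,r_2)=n+1$. **Theorem.** In each of the following cases the given values on the simple reflections define an injective homomorphism $\phi$ of the finite Coxeter group $\widehat W$ onto the folding subgroup of $W$ for the given admissible partition $\widehat S$ of $S$, with the simple reflections mapped onto $R$, and its unfolding polynomial is as stated. 1. $\widehat W=B_n$, $W=A_{2n-1}$ ($n\ge 1$), $\widehat S=\{\{s_i,s_{2n-i}\}\}$, $\phi(r_i)=s_is_{2n-i}$ for $i<n$, $\phi(r_n)=s_n$: $$U_{B_n}^{A_{2n-1}}(q)=\prod_{k=1}^{2n}[k]_{(-1)^kq}.$$ 2. $\widehat W=B_n$, $W=A_{2n}$ ($n\ge 1$), $\widehat S=\{\{s_i,s_{2n+1-i}\}\}$, $\phi(r_i)=s_is_{2n+1-i}$ for $i<n$, $\phi(r_n)=s_ns_{n+1}s_n$: $$U_{B_n}^{A_{2n}}(q)=\prod_{k=1}^{2n+1}[k]_{(-1)^kq}.$$ 3. $\widehat W=B_n$, $W=D_{n+1}$ ($n\ge 2$), $\widehat S=\{\{s_1\},\ldots,\{s_{n-1}\},\{s_n,s_{n+1}\}\}$,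 $\phi(r_i)=s_i$ for $i<n$, $\phi(r_n)=s_ns_{n+1}$: $$U_{B_n}^{D_{n+1}}(q)=[2]_q[3]_{-q}[4]_q\prod_{k=3}^{n}\left([2k+1]_q-q^k\right).$$ 4. $\widehat W=I_2(n+1)$, $W=A_n$ ($n\ge 2$), $\widehat S=\{\{s_i: i\text{ odd}\},\{s_i: i\text{ even}\}\}$, $\phi(r_1)=\prod_{i\text{ odd}}s_i$, $\phi(r_2)=\prod_{i\text{ even}}s_i$: if $n=2m$, then $$U_{I_2(n+1)}^{A_n}(q)=[2]_{q^m}[n+1]_{q^m}.$$ 5. In the situation of 4, if $n=2m-1$, then $$U_{I_2(n+1)}^{A_n}(q)=[2]_{q^{m-1}}[2]_{q^m}[m]_{q^n}.$$ -/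

import Mathlib

open Polynomial

noncomputable section

namespace Folding

section General

variable {B B' W W' : Type*} [Group W] [Group W']
  {M : CoxeterMatrix B} {M' : CoxeterMatrix B'}

/-- The parabolic subgroup `W_I` generated by the simple reflections indexed by `I`. -/
def parabolic (cs : CoxeterSystem M W) (I : Set B) : Subgroup W :=
  Subgroup.closure (cs.simple '' I)

/-- `r` is an element of maximal length in `W_I`. -/
def IsLongestIn (cs : CoxeterSystem M W) (I : Set B) (r : W) : Prop :=
  r ∈ parabolic cs I ∧ ∀ u ∈ parabolic cs I, cs.length u ≤ cs.length r

/-- The set `R` of the longest elements `r_I` of `W_I`, where `I` runs over the blocks of `P`. -/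
def foldingGenerators (cs : CoxeterSystem M W) (P : Set (Set B)) : Set W :=
  {r | ∃ I ∈ P, IsLongestIn cs I r}

/-- The subgroup of `W` generated by `R`. -/
def foldingSubgroup (cs : CoxeterSystem M W) (P : Set (Set B)) : Subgroup W :=
  Subgroup.closure (foldingGenerators cs P)

/-- `P` is an admissible partition of the simple reflections (identified with their indices). -/
structure IsAdmissible (cs : CoxeterSystem M W) (P : Set (Set B)) : Prop where
  isPartition : Setoid.IsPartition P
  finite_parabolic : ∀ I ∈ P, Finite (parabolic cs I)
  length_mul : ∀ w ∈ foldingSubgroup cs P, ∀ I ∈ P,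
    (∀ s ∈ I, cs.length (w * cs.simple s) = cs.length w + 1) ∨
    (∀ s ∈ I, cs.length (w * cs.simple s) + 1 = cs.length w)

/-- `φ` embeds the Coxeter system `cs'` in `W` as the folding subgroup of the admissible
partition `P`, the simple reflections of `cs'` being sent onto the generators `r_I`. -/
structure IsFolding (cs' : CoxeterSystem M' W') (cs : CoxeterSystem M W) (P : Set (Set B))
    (φ : W' →* W) : Prop where
  admissible : IsAdmissible cs P
  injective : Function.Injective φ
  range_eq : φ.range = foldingSubgroup cs P
  image_simple : φ '' Set.range cs'.simple = foldingGenerators cs P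

/-- The unfolding polynomial `∑_{w ∈ W'} q ^ ℓ(φ w)`, meaningful for finite `W'`. -/
def unfoldingPolynomial (cs : CoxeterSystem M W) (φ : W' →* W) : ℤ[X] :=
  ∑ᶠ w : W', (X : ℤ[X]) ^ cs.length (φ w)

end General

/-- The simple reflection `s_k`, numbered `s_1, …, s_N` (and `1` if `k` is out of this range). -/
def gen {N : ℕ} {W : Type*} [Group W] {M : CoxeterMatrix (Fin N)} (cs : CoxeterSystem M W)
    (k : ℕ) : W :=
  if h : 1 ≤ k ∧ k ≤ N then cs.simple ⟨k - 1, by omega⟩ else 1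

/-- The Coxeter matrix of type `D_N`. With the nodes numbered `1, …, N`, the edges are
`k — k+1` for `k + 1 < N`, and `N-2 — N`. (Mathlib's `CoxeterMatrix.D` has the additional edge
`N-1 — N`, so that its graph contains a triangle.) -/
def matrixD (N : ℕ) : CoxeterMatrix (Fin N) where
  M := Matrix.of fun i j : Fin N ↦
    if i = j then 1
    else if ((i : ℕ) + 1 = j ∧ (j : ℕ) + 1 < N) ∨ ((j : ℕ) + 1 = i ∧ (i : ℕ) + 1 < N) ∨
        ((i : ℕ) + 2 = j ∧ (j : ℕ) + 1 = N) ∨ ((j : ℕ) + 2 = i ∧ (i : ℕ) + 1 = N) then 3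
    else 2
  isSymm := by
    ext i j
    simp only [Matrix.transpose_apply, Matrix.of_apply]
    split_ifs <;> first | rfl | omega
  diagonal := by simp
  off_diagonal := by
    intro i j h
    simp only [Matrix.of_apply, if_neg h]
    split_ifs <;> norm_num

/-- The orbits `{b, σ b}` of an involution `σ` of the index set. -/
def orbitPartition {B : Type*} (σ : B → B) : Set (Set B) :=
  Set.range fun b ↦ {b, σ b}

/-- The exchange of the nodes `n` and `n+1` of `D_{n+1}` (indices `n-1` and `n`). -/
def swapD (n : ℕ) : Fin (n + 1) → Fin (n + 1) :=
  Equiv.swap ⟨n - 1, by omega⟩ ⟨n, by omega⟩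

/-- The partition of the nodes `1, …, n` into the odd and the even ones
(the node `k` has index `k - 1`). -/
def parityPartition (n : ℕ) : Set (Set (Fin n)) :=
  {{i : Fin n | Odd ((i : ℕ) + 1)}, {i : Fin n | Even ((i : ℕ) + 1)}}

/-- The `q`-integer `[k]_x = 1 + x + ⋯ + x^{k-1}`. -/
def qInt (k : ℕ) (x : ℤ[X]) : ℤ[X] :=
  ∑ i ∈ Finset.range k, x ^ i

end Folding

end

open Folding

/-! The global statements follow from local ones. Call `φ` an unfolding (`IsUnfolding`) if it sends
each simple reflection `r_i` to an element of a finite `W_{I i}` having every `s ∈ I i` as a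
descent, and if in the image of each braid word the lengths of the images of the letters add up. The
key lemma `IsUnfolding.lt_length_mul_simple` says that if `r_i` is an ascent of `w`, then every `s ∈
I i` is an ascent of `φ w`. To see this, let `r_j` be a right descent of `w` and write `w = v u`
with `u ∈ ⟨r_j, r_i⟩` and `v` shortest in its coset. By induction `φ v` is shortest modulo `W_{I j ∪
I i}`, so only `φ u` matters; and `u r_i` has a reduced word that is a suffix of a braid word, where
lengths add. Consequently lengths add along the image of every reduced word, and admissibility and
injectivity follow.

It remains to construct `φ`, that is, to check the braid relations among the images, and to check
additivity on braid words. Commuting pairs and bonds of label 3 reduce to the same relations in `W`.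
For the bond of label 4, and for the bond of `I_2(n+1)`, both sides of the relation lie in a
parabolic subgroup of type `A_m`, whose elements have length at most `m(m+1)/2`
(`IsChain.exists_word`). Counting inversions in a permutation model shows that both sides attain
this bound (`le_two_mul_length_of_reverse`, `six_le_length_D`). The longest element is unique, so
the two sides agree, and its length is the sum of the lengths of the letters.

For the polynomial, `ℓ(φ w)` is now a weighted count of the letters of a reduced word, so the sum
over a parabolic subgroup factors through shortest coset representatives (`parabolicSum_eq_mul`). In
type `B_n`, with weights `a` for `r_1, …, r_{n-1}` and `b` for `r_n`, passing from the last `m`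
nodes to the last `m + 1` contributes `(1 + q^{ma+b}) [m+1]_{q^a}`; the three cases have `(a, b) =
(2, 1), (2, 3), (1, 2)`. The dihedral case needs two such steps. Identities between `q`-integers
give the stated products.

All facts about a general Coxeter group rest on the strong exchange property, which comes from the
signed conjugation action on `W × ZMod 2`. -/

namespace Folding

/-! ### The strong exchange property -/

section Exchange

variable {B W : Type*} [Group W] {M : CoxeterMatrix B} (cs : CoxeterSystem M W)

open Classical in
/-- The involution `(t, ε) ↦ (s t s, ε + [t = s])` attached to the simple reflection `s`. -/
noncomputable def signedConj (i : B) : Equiv.Perm (W × ZMod 2) :=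
  Function.Involutive.toPerm
    (fun p ↦ (cs.simple i * p.1 * cs.simple i, p.2 + if p.1 = cs.simple i then 1 else 0)) (by
      rintro ⟨t, ε⟩
      have h : cs.simple i * t * cs.simple i = cs.simple i ↔ t = cs.simple i := by
        constructor
        · intro h
          have := congrArg (fun x ↦ cs.simple i * x * cs.simple i) h
          simpa [mul_assoc] using this
        · rintro rfl; simp
      ext
      · simp [mul_assoc]
      · simp only [h, add_assoc, CharTwo.add_self_eq_zero, add_zero])

open Classical in
lemma signedConj_apply (i : B) (t : W) (ε : ZMod 2) : signedConj cs i (t, ε) =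
    (cs.simple i * t * cs.simple i, ε + if t = cs.simple i then 1 else 0) := rfl

open Classical in
-- The letters act from the right end of the word. The sign flips at a letter exactly when the
-- conjugate of `t` reached so far is that simple reflection, which means that `t` is the entry this
-- letter contributes to the right inversion sequence.
lemma prod_map_signedConj_apply (ω : List B) (t : W) (ε : ZMod 2) :
    (ω.map (signedConj cs)).prod (t, ε) =
      (cs.wordProd ω * t * (cs.wordProd ω)⁻¹, ε + (cs.rightInvSeq ω).count t) := by
  induction ω with
  | nil => simp
  | cons i ω ih =>
    have h : cs.wordProd ω * t * (cs.wordProd ω)⁻¹ = cs.simple i ↔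
        (cs.wordProd ω)⁻¹ * cs.simple i * cs.wordProd ω = t := by
      constructor
      · intro h; rw [← h]; group
      · rintro rfl; group
    rw [List.map_cons, List.prod_cons, Equiv.Perm.mul_apply, ih, signedConj_apply]
    simp only [mul_assoc] at h
    simp only [CoxeterSystem.rightInvSeq, List.count_cons, h, cs.wordProd_cons, mul_inv_rev,
      cs.inv_simple, mul_assoc, beq_iff_eq]
    ext
    · rfl
    · push_cast
      simp [add_assoc]

lemma prod_map_alternatingWord {G : Type*} [Monoid G] (f : B → G) (i j : B) (m : ℕ) :
    ((CoxeterSystem.alternatingWord i j (2 * m)).map f).prod = (f i * f j) ^ m := by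
  induction m with
  | zero => simp [CoxeterSystem.alternatingWord]
  | succ m ih =>
    rw [show 2 * (m + 1) = 2 * m + 1 + 1 by ring, CoxeterSystem.alternatingWord_succ,
      CoxeterSystem.alternatingWord_succ]
    simp [ih, pow_succ]

/-- Multiplying by the `k`-th entry, on the right or on the left respectively, deletes the `k`-th
letter; when the product is `1`, both entries equal the product of the shortened word. -/
lemma rightInvSeq_eq_leftInvSeq_of_wordProd_eq_one {ω : List B} (h : cs.wordProd ω = 1) :
    cs.rightInvSeq ω = cs.leftInvSeq ω := by
  apply List.ext_getElem (by simp)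
  intro k h1 h2
  rw [← List.getD_eq_getElem _ 1 h1, ← List.getD_eq_getElem _ 1 h2]
  have e1 := cs.wordProd_mul_getD_rightInvSeq ω k
  have e2 := cs.getD_leftInvSeq_mul_wordProd ω k
  rw [h, one_mul] at e1
  rw [h, mul_one] at e2
  rw [e1, e2]

open Classical in
-- The left inversion sequence of the relator of length `2 m` consists of odd alternating products,
-- and `(s_i s_j) ^ m = 1` makes its second half repeat the first.
lemma even_count_rightInvSeq_alternatingWord (i j : B) (t : W) :
    Even ((cs.rightInvSeq (CoxeterSystem.alternatingWord i j (2 * M i j))).count t) := by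
  set m := M i j with hm
  have h1 : cs.wordProd (CoxeterSystem.alternatingWord i j (2 * m)) = 1 := by
    rw [cs.prod_alternatingWord_eq_mul_pow]
    simp [hm]
  rw [rightInvSeq_eq_leftInvSeq_of_wordProd_eq_one cs h1]
  set l := cs.leftInvSeq (CoxeterSystem.alternatingWord i j (2 * m)) with hl
  have hlen : l.length = 2 * m := by simp [hl]
  have hd : l.drop m = l.take m := by
    apply List.ext_getElem (by simp [hlen]; omega)
    intro k hk1 hk2
    have hk : k < m := by simp [hlen] at hk1; omega
    simp only [List.getElem_drop, List.getElem_take, hl]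
    rw [cs.getElem_leftInvSeq_alternatingWord i j m _ (by omega),
      cs.getElem_leftInvSeq_alternatingWord i j m _ (by omega),
      cs.prod_alternatingWord_eq_mul_pow, cs.prod_alternatingWord_eq_mul_pow]
    have e1 : ¬ Even (2 * (m + k) + 1) := by simp
    have e2 : ¬ Even (2 * k + 1) := by simp
    rw [if_neg e1, if_neg e2, show (2 * (m + k) + 1) / 2 = m + k by omega,
      show (2 * k + 1) / 2 = k by omega, pow_add]
    simp [hm]
  rw [← List.take_append_drop m l, List.count_append, hd]
  exact ⟨_, rfl⟩

lemma isLiftable_signedConj : M.IsLiftable (signedConj cs) := by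
  classical
  intro i j
  rw [← prod_map_alternatingWord]
  ext1 ⟨t, ε⟩
  rw [prod_map_signedConj_apply]
  have h1 : cs.wordProd (CoxeterSystem.alternatingWord i j (2 * M i j)) = 1 := by
    rw [cs.prod_alternatingWord_eq_mul_pow]
    simp
  have h2 : (((cs.rightInvSeq (CoxeterSystem.alternatingWord i j (2 * M i j))).count t : ℕ) :
      ZMod 2) = 0 :=
    (ZMod.natCast_eq_zero_iff_even).2 (even_count_rightInvSeq_alternatingWord cs i j t)
  rw [h1, h2]
  simp

/-- The signed conjugation action of a Coxeter group. -/
noncomputable def signedAction : W →* Equiv.Perm (W × ZMod 2) :=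
  cs.lift ⟨signedConj cs, isLiftable_signedConj cs⟩

/-- The parity of the number of occurrences of `t` in the inversion sequence of a word for `w`. -/
noncomputable def inversionParity (w t : W) : ZMod 2 := (signedAction cs w (t, 0)).2

lemma signedAction_wordProd (ω : List B) :
    signedAction cs (cs.wordProd ω) = (ω.map (signedConj cs)).prod := by
  induction ω with
  | nil => simp
  | cons i ω ih =>
    rw [cs.wordProd_cons, map_mul, ih, List.map_cons, List.prod_cons]
    congr 1
    exact cs.lift_apply_simple (isLiftable_signedConj cs) i

open Classical in
lemma inversionParity_wordProd (ω : List B) (t : W) :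
    inversionParity cs (cs.wordProd ω) t = (cs.rightInvSeq ω).count t := by
  rw [inversionParity, signedAction_wordProd, prod_map_signedConj_apply]
  simp

lemma signedAction_apply (w t : W) (ε : ZMod 2) :
    signedAction cs w (t, ε) = (w * t * w⁻¹, ε + inversionParity cs w t) := by
  classical
  obtain ⟨ω, rfl⟩ := cs.wordProd_surjective w
  rw [inversionParity_wordProd, signedAction_wordProd, prod_map_signedConj_apply]

lemma inversionParity_mul (w v t : W) : inversionParity cs (w * v) t =
    inversionParity cs v t + inversionParity cs w (v * t * v⁻¹) := by
  rw [inversionParity, map_mul, Equiv.Perm.mul_apply, signedAction_apply cs v,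
    signedAction_apply cs w, zero_add]

/-- For `t = w s w⁻¹` the cocycle rule gives three terms. Those of `w` and `w⁻¹` cancel because `w
w⁻¹ = 1` has parity `0`; the term of `s` is `1`. -/
lemma inversionParity_self {t : W} (ht : cs.IsReflection t) : inversionParity cs t t = 1 := by
  classical
  obtain ⟨w, i, rfl⟩ := ht
  have h1 : inversionParity cs (cs.simple i) (cs.simple i) = 1 := by
    rw [← cs.wordProd_singleton, inversionParity_wordProd]
    simp
  have h2 : inversionParity cs (w * w⁻¹) (w * cs.simple i * w⁻¹) = 0 := by
    rw [mul_inv_cancel, ← cs.wordProd_nil, inversionParity_wordProd]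
    simp
  rw [inversionParity_mul] at h2
  rw [inversionParity_mul, inversionParity_mul]
  have e1 : w⁻¹ * (w * cs.simple i * w⁻¹) * w⁻¹⁻¹ = cs.simple i := by group
  rw [e1] at h2 ⊢
  have e2 : cs.simple i * cs.simple i * (cs.simple i)⁻¹ = cs.simple i := by simp
  rw [e2, h1]
  linear_combination h2

lemma length_mul_lt_of_inversionParity_eq_one {w t : W} (h : inversionParity cs w t = 1) :
    cs.length (w * t) < cs.length w := by
  classical
  obtain ⟨ω, hω, rfl⟩ := cs.exists_isReduced w
  rw [inversionParity_wordProd] at h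
  have : t ∈ cs.rightInvSeq ω := by
    by_contra hc
    rw [List.count_eq_zero.2 hc] at h
    simp at h
  exact (cs.isRightInversion_of_mem_rightInvSeq hω this).2

/-- **Strong exchange property.** -/
theorem exists_eraseIdx_of_length_mul_lt {ω : List B} {t : W} (ht : cs.IsReflection t)
    (h : cs.length (cs.wordProd ω * t) < cs.length (cs.wordProd ω)) :
    ∃ k < ω.length, cs.wordProd ω * t = cs.wordProd (ω.eraseIdx k) := by
  classical
  -- If the parity of `w` at `t` were `0`, that of `w t` would be `1`, so `t` would shorten `w t` to
  -- `w`, against the hypothesis.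
  have h1 : inversionParity cs (cs.wordProd ω) t = 1 := by
    by_contra hc
    have h0 : inversionParity cs (cs.wordProd ω) t = 0 := by
      generalize inversionParity cs (cs.wordProd ω) t = x at hc
      revert x; decide
    have h2 : inversionParity cs (cs.wordProd ω * t) t = 1 := by
      rw [inversionParity_mul, inversionParity_self cs ht, mul_inv_cancel_right, h0, add_zero]
    have h3 := length_mul_lt_of_inversionParity_eq_one cs h2
    rw [mul_assoc, ht.mul_self, mul_one] at h3
    omega
  rw [inversionParity_wordProd] at h1
  have hm : t ∈ cs.rightInvSeq ω := by
    by_contra hc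
    rw [List.count_eq_zero.2 hc] at h1
    simp at h1
  obtain ⟨k, hk, rfl⟩ := List.mem_iff_getElem.mp hm
  refine ⟨k, by simpa using hk, ?_⟩
  rw [← List.getD_eq_getElem _ 1 hk, cs.wordProd_mul_getD_rightInvSeq]

end Exchange

/-! ### Parabolic subgroups: coset representatives and longest elements -/

section Parabolic

variable {B W : Type*} [Group W] {M : CoxeterMatrix B} (cs : CoxeterSystem M W)

lemma simple_mem_parabolic {J : Set B} {i : B} (hi : i ∈ J) : cs.simple i ∈ parabolic cs J :=
  Subgroup.subset_closure ⟨i, hi, rfl⟩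

lemma parabolic_mono {I J : Set B} (h : I ⊆ J) : parabolic cs I ≤ parabolic cs J :=
  Subgroup.closure_mono (Set.image_mono h)

lemma wordProd_mem_parabolic {J : Set B} {ω : List B} (h : ∀ i ∈ ω, i ∈ J) :
    cs.wordProd ω ∈ parabolic cs J := by
  apply Subgroup.list_prod_mem
  intro x hx
  obtain ⟨i, hi, rfl⟩ := List.mem_map.1 hx
  exact simple_mem_parabolic cs (h i hi)

lemma exists_word_of_mem_parabolic {J : Set B} {u : W} (hu : u ∈ parabolic cs J) :
    ∃ ω : List B, (∀ i ∈ ω, i ∈ J) ∧ u = cs.wordProd ω := by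
  induction hu using Subgroup.closure_induction with
  | mem x hx =>
    obtain ⟨i, hi, rfl⟩ := hx
    exact ⟨[i], by simpa using hi, by simp⟩
  | one => exact ⟨[], by simp, by simp⟩
  | mul x y _ _ hx hy =>
    obtain ⟨ω, h, rfl⟩ := hx
    obtain ⟨ω', h', rfl⟩ := hy
    refine ⟨ω ++ ω', ?_, (cs.wordProd_append _ _).symm⟩
    intro i hi
    rcases List.mem_append.1 hi with hi | hi
    exacts [h i hi, h' i hi]
  | inv x _ hx =>
    obtain ⟨ω, h, rfl⟩ := hx
    exact ⟨ω.reverse, by simpa using h, by simp⟩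

lemma isReduced_concat {ω : List B} {i : B} (hω : cs.IsReduced ω)
    (h : cs.length (cs.wordProd ω) < cs.length (cs.wordProd ω * cs.simple i)) :
    cs.IsReduced (ω ++ [i]) := by
  have h1 := cs.length_mul_simple (cs.wordProd ω) i
  rw [CoxeterSystem.IsReduced, cs.wordProd_append, cs.wordProd_singleton, List.length_append,
    ← hω.eq, List.length_singleton]
  omega

/-- A letter that lengthens the product is appended. One that shortens it is absorbed by erasing an
earlier letter, by exchange; so no letter outside `J` is ever introduced. -/
lemma exists_isReduced_of_word {J : Set B} {ω : List B} (h : ∀ i ∈ ω, i ∈ J) :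
    ∃ ω' : List B, (∀ i ∈ ω', i ∈ J) ∧ cs.IsReduced ω' ∧ cs.wordProd ω = cs.wordProd ω' := by
  induction ω using List.reverseRecOn with
  | nil => exact ⟨[], by simp, by simp [CoxeterSystem.IsReduced], rfl⟩
  | append_singleton ω i ih =>
    obtain ⟨ω', h1, h2, h3⟩ := ih fun j hj ↦ h j (by simp [hj])
    have hi : i ∈ J := h i (by simp)
    rw [cs.wordProd_append, h3, cs.wordProd_singleton]
    rcases cs.length_mul_simple (cs.wordProd ω') i with h4 | h4
    · refine ⟨ω' ++ [i], ?_, isReduced_concat cs h2 (by omega), ?_⟩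
      · intro j hj
        rcases List.mem_append.1 hj with hj | hj
        · exact h1 j hj
        · rw [List.mem_singleton.1 hj]; exact hi
      · rw [cs.wordProd_append, cs.wordProd_singleton]
    · obtain ⟨k, hk, h5⟩ := exists_eraseIdx_of_length_mul_lt cs (cs.isReflection_simple i)
        (ω := ω') (by omega)
      refine ⟨ω'.eraseIdx k, fun j hj ↦ h1 j (List.mem_of_mem_eraseIdx hj), ?_, h5⟩
      rw [CoxeterSystem.IsReduced, ← h5, List.length_eraseIdx_of_lt hk]
      rw [h2.eq] at h4
      omega

lemma exists_isReduced_of_mem_parabolic {J : Set B} {u : W} (hu : u ∈ parabolic cs J) :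
    ∃ ω : List B, (∀ i ∈ ω, i ∈ J) ∧ cs.IsReduced ω ∧ u = cs.wordProd ω := by
  obtain ⟨ω, h, rfl⟩ := exists_word_of_mem_parabolic cs hu
  exact exists_isReduced_of_word cs h

lemma exists_descent_of_mem_parabolic {J : Set B} {u : W} (hu : u ∈ parabolic cs J) (h1 : u ≠ 1) :
    ∃ i ∈ J, cs.length (u * cs.simple i) < cs.length u := by
  obtain ⟨ω, h, hr, rfl⟩ := exists_isReduced_of_mem_parabolic cs hu
  rcases List.eq_nil_or_concat ω with rfl | ⟨ω', i, rfl⟩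
  · simp at h1
  · rw [List.concat_eq_append] at *
    refine ⟨i, h i (by simp), ?_⟩
    have := cs.length_wordProd_le ω'
    rw [hr.eq, cs.wordProd_append, cs.wordProd_singleton, mul_assoc, cs.simple_mul_simple_self,
      mul_one, List.length_append, List.length_singleton]
    omega

/-- The letters of a reduced word of `u` are appended to `v` one at a time. If one of them lowered
the length, exchange would delete a letter of `v`, giving a shorter element of `v W_J`, or a letter
of `u`, against reducedness. -/
lemma length_mul_of_isMin {J : Set B} {v : W}
    (hv : ∀ x ∈ parabolic cs J, cs.length v ≤ cs.length (v * x)) {u : W}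
    (hu : u ∈ parabolic cs J) : cs.length (v * u) = cs.length v + cs.length u := by
  obtain ⟨ω, h, hr, rfl⟩ := exists_isReduced_of_mem_parabolic cs hu
  clear hu
  obtain ⟨α, hα, rfl⟩ := cs.exists_isReduced v
  induction ω using List.reverseRecOn with
  | nil => simp
  | append_singleton ω i ih =>
    have hr' : cs.IsReduced ω := by simpa using hr.take ω.length
    have h' : ∀ j ∈ ω, j ∈ J := fun j hj ↦ h j (by simp [hj])
    have hi : i ∈ J := h i (by simp)
    replace ih := ih h' hr'
    have hlen := hr.eq
    rw [List.length_append, ← hr'.eq, List.length_singleton] at hlen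
    rw [hlen, cs.wordProd_append, cs.wordProd_singleton, ← mul_assoc]
    rcases cs.length_mul_simple (cs.wordProd α * cs.wordProd ω) i with h4 | h4
    · omega
    · exfalso
      have h5 := exists_eraseIdx_of_length_mul_lt cs (cs.isReflection_simple i) (ω := α ++ ω)
        (by rw [cs.wordProd_append]; omega)
      obtain ⟨k, hk, h5⟩ := h5
      rw [cs.wordProd_append] at h5
      rcases lt_or_ge k α.length with hk' | hk'
      · rw [List.eraseIdx_append_of_lt_length hk', cs.wordProd_append] at h5
        -- Deleting a letter of `v` amounts to multiplying `v` on the right by this reflection of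
        -- `W_J`.
        have hx : cs.wordProd ω * cs.simple i * (cs.wordProd ω)⁻¹ ∈ parabolic cs J :=
          mul_mem (mul_mem (wordProd_mem_parabolic cs h') (simple_mem_parabolic cs hi))
            (inv_mem (wordProd_mem_parabolic cs h'))
        have h6 := hv _ hx
        rw [← mul_assoc, ← mul_assoc, h5, mul_inv_cancel_right, hα.eq] at h6
        have := cs.length_wordProd_le (α.eraseIdx k)
        rw [List.length_eraseIdx_of_lt hk'] at this
        omega
      · rw [List.eraseIdx_append_of_length_le hk', cs.wordProd_append, mul_assoc,
          mul_right_inj] at h5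
        rw [cs.wordProd_append, cs.wordProd_singleton, h5] at hlen
        have := cs.length_wordProd_le (ω.eraseIdx (k - α.length))
        rw [List.length_eraseIdx_of_lt (by simp at hk; omega), ← hr'.eq] at this
        omega

lemma exists_isMin_mul (J : Set B) (w : W) : ∃ v, ∃ u ∈ parabolic cs J, w = v * u ∧
    ∀ x ∈ parabolic cs J, cs.length v ≤ cs.length (v * x) := by
  let S : Set ℕ := {k | ∃ u ∈ parabolic cs J, cs.length (w * u) = k}
  have hS : S.Nonempty := ⟨_, 1, one_mem _, rfl⟩
  obtain ⟨u, hu, hk⟩ := Nat.sInf_mem hS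
  refine ⟨w * u, u⁻¹, inv_mem hu, by simp, fun x hx ↦ ?_⟩
  rw [hk]
  exact Nat.sInf_le ⟨u * x, mul_mem hu hx, by rw [mul_assoc]⟩

/-- An element without right descents in `J` is the shortest one of its coset. -/
theorem length_mul_of_forall_lt {J : Set B} {v : W}
    (hv : ∀ i ∈ J, cs.length v < cs.length (v * cs.simple i)) {u : W}
    (hu : u ∈ parabolic cs J) : cs.length (v * u) = cs.length v + cs.length u := by
  -- A nontrivial `W_J`-part `u₀` would have a descent in `J`, and additivity over the minimal `v₀`
  -- would make it a descent of `v`.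
  obtain ⟨v₀, u₀, hu₀, rfl, hmin⟩ := exists_isMin_mul cs J v
  have h1 : u₀ = 1 := by
    by_contra h1
    obtain ⟨i, hi, h⟩ := exists_descent_of_mem_parabolic cs hu₀ h1
    have h2 := hv i hi
    rw [mul_assoc, length_mul_of_isMin cs hmin (mul_mem hu₀ (simple_mem_parabolic cs hi)),
      length_mul_of_isMin cs hmin hu₀] at h2
    omega
  subst h1
  rw [mul_one] at *
  exact length_mul_of_isMin cs hmin hu

lemma length_mul_of_isMin_left {J : Set B} {v : W}
    (hv : ∀ x ∈ parabolic cs J, cs.length v ≤ cs.length (x * v)) {u : W}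
    (hu : u ∈ parabolic cs J) : cs.length (u * v) = cs.length u + cs.length v := by
  have := length_mul_of_isMin cs (J := J) (v := v⁻¹) (fun x hx ↦ by
    have := hv x⁻¹ (inv_mem hx)
    rw [← cs.length_inv (x⁻¹ * v)] at this
    simpa using this) (inv_mem hu)
  rw [← mul_inv_rev] at this
  simp only [cs.length_inv] at this
  omega

lemma mem_of_simple_mem_parabolic (hinj : Function.Injective cs.simple) {J : Set B} {i : B}
    (h : cs.simple i ∈ parabolic cs J) : i ∈ J := by
  obtain ⟨ω, h1, h2, h3⟩ := exists_isReduced_of_mem_parabolic cs h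
  have h4 := h2.eq
  rw [← h3, cs.length_simple] at h4
  obtain ⟨j, rfl⟩ := List.length_eq_one_iff.1 h4.symm
  rw [cs.wordProd_singleton] at h3
  rw [hinj h3]
  exact h1 j (by simp)

/-- Lengths add up for a product of elements of parabolic subgroups of disjoint types. -/
theorem length_mul_of_disjoint (hinj : Function.Injective cs.simple) {I J : Set B}
    (hd : Disjoint I J) {x y : W} (hx : x ∈ parabolic cs I) (hy : y ∈ parabolic cs J) :
    cs.length (x * y) = cs.length x + cs.length y := by
  apply length_mul_of_forall_lt cs _ hy
  intro i hi
  rcases cs.length_mul_simple x i with h | h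
  · omega
  -- If `s_i` shortens `x`, exchange expresses `x s_i` by letters of `I`, so that `s_i ∈ W_I` and `i
  -- ∈ I`.
  · exfalso
    obtain ⟨ω, h1, h2, rfl⟩ := exists_isReduced_of_mem_parabolic cs hx
    obtain ⟨k, hk, h5⟩ := exists_eraseIdx_of_length_mul_lt cs (cs.isReflection_simple i)
      (ω := ω) (by omega)
    have h6 : cs.simple i ∈ parabolic cs I := by
      rw [← eq_inv_mul_iff_mul_eq] at h5
      rw [h5]
      exact mul_mem (inv_mem hx)
        (wordProd_mem_parabolic cs fun j hj ↦ h1 j (List.mem_of_mem_eraseIdx hj))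
    exact Set.disjoint_left.1 hd (mem_of_simple_mem_parabolic cs hinj h6) hi

/-- Induction on a reduced word `u s`. The reflection `t = u s u⁻¹` shortens `r = (r u) u⁻¹`, so
exchange erases a letter either of `r u`, which makes `r u s` shorter than `r u` as wanted, or of
`u⁻¹`, which would make `u s` too short. -/
lemma length_mul_add_of_isLongestIn {I : Set B} {r : W} (hr : IsLongestIn cs I r) {u : W}
    (hu : u ∈ parabolic cs I) : cs.length (r * u) + cs.length u = cs.length r := by
  obtain ⟨ω, h, hω, rfl⟩ := exists_isReduced_of_mem_parabolic cs hu
  clear hu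
  induction ω using List.reverseRecOn with
  | nil => simp
  | append_singleton ω i ih =>
    have hω' : cs.IsReduced ω := by simpa using hω.take ω.length
    have h' : ∀ j ∈ ω, j ∈ I := fun j hj ↦ h j (by simp [hj])
    have hi : i ∈ I := h i (by simp)
    have hu : cs.wordProd ω ∈ parabolic cs I := wordProd_mem_parabolic cs h'
    replace ih := ih h' hω'
    have hlen := hω.eq
    rw [List.length_append, ← hω'.eq, List.length_singleton] at hlen
    rw [hlen, cs.wordProd_append, cs.wordProd_singleton]
    set u := cs.wordProd ω with hu_def
    set t := u * cs.simple i * u⁻¹ with ht_def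
    have ht : cs.IsReflection t := ⟨u, i, rfl⟩
    have htI : t ∈ parabolic cs I :=
      mul_mem (mul_mem hu (simple_mem_parabolic cs hi)) (inv_mem hu)
    obtain ⟨α, hα, hα'⟩ := cs.exists_isReduced (r * u)
    have hr_eq : r = cs.wordProd (α ++ ω.reverse) := by
      rw [cs.wordProd_append, ← hα', cs.wordProd_reverse]; simp [u]
    -- Maximality gives `≤`; it is strict because a reflection always changes the length.
    have h1 : cs.length (r * t) < cs.length r :=
      lt_of_le_of_ne (hr.2 _ (mul_mem hr.1 htI)) (ht.length_mul_left_ne r)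
    rw [hr_eq] at h1
    obtain ⟨k, hk, h5⟩ := exists_eraseIdx_of_length_mul_lt cs ht h1
    rw [← hr_eq] at h5
    rcases lt_or_ge k α.length with hk' | hk'
    · rw [List.eraseIdx_append_of_lt_length hk', cs.wordProd_append, cs.wordProd_reverse,
        ← hu_def, eq_mul_inv_iff_mul_eq] at h5
      have h6 : r * (u * cs.simple i) = cs.wordProd (α.eraseIdx k) := by
        rw [← h5, ht_def]; group
      have := cs.length_wordProd_le (α.eraseIdx k)
      rw [List.length_eraseIdx_of_lt hk', ← hα.eq, ← hα', ← h6] at this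
      have h7 := cs.length_mul_simple (r * u) i
      have h8 : r * u * cs.simple i = r * (u * cs.simple i) := mul_assoc _ _ _
      rw [h8] at h7
      rw [hα', hα.eq] at this h7
      rw [hα', hα.eq] at ih
      omega
    · exfalso
      rw [List.eraseIdx_append_of_length_le hk', cs.wordProd_append, ← hα', mul_assoc,
        mul_right_inj] at h5
      have h6 : (u * cs.simple i)⁻¹ = cs.wordProd (ω.reverse.eraseIdx (k - α.length)) := by
        rw [← mul_right_inj u, ← h5, ht_def]; simp [mul_assoc]
      have := cs.length_wordProd_le (ω.reverse.eraseIdx (k - α.length))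
      rw [← h6, cs.length_inv, List.length_eraseIdx_of_lt (by simp at hk ⊢; omega),
        List.length_reverse, ← hω'.eq, ← hu_def] at this
      rw [cs.wordProd_append, cs.wordProd_singleton, ← hu_def] at hlen
      omega

lemma IsLongestIn.eq {I : Set B} {r r' : W} (hr : IsLongestIn cs I r) (hr' : IsLongestIn cs I r') :
    r = r' := by
  have h := length_mul_add_of_isLongestIn cs hr (mul_mem (inv_mem hr.1) hr'.1)
  rw [mul_inv_cancel_left] at h
  have h1 := hr'.2 r hr.1
  have h2 : cs.length (r⁻¹ * r') = 0 := by omega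
  rw [cs.length_eq_zero_iff] at h2
  exact (inv_mul_eq_one.1 h2)

lemma exists_isLongestIn (I : Set B) [Finite (parabolic cs I)] : ∃ r, IsLongestIn cs I r := by
  obtain ⟨r, hr⟩ := Finite.exists_max fun u : parabolic cs I ↦ cs.length (u : W)
  exact ⟨r, r.2, fun u hu ↦ hr ⟨u, hu⟩⟩

/-- In a finite parabolic subgroup, an element having all descents is the longest one. -/
theorem isLongestIn_of_forall_lt {I : Set B} [Finite (parabolic cs I)] {r : W}
    (hr : r ∈ parabolic cs I) (h : ∀ i ∈ I, cs.length (r * cs.simple i) < cs.length r) :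
    IsLongestIn cs I r := by
  obtain ⟨r₀, hr₀⟩ := exists_isLongestIn cs I
  have hu : r₀⁻¹ * r ∈ parabolic cs I := mul_mem (inv_mem hr₀.1) hr
  suffices h1 : r₀⁻¹ * r = 1 by rwa [← inv_mul_eq_one.1 h1]
  -- Left multiplication by `r₀` reverses lengths on `W_I`, so a descent of `r₀⁻¹ r` would be an
  -- ascent of `r`.
  by_contra h1
  obtain ⟨i, hi, h2⟩ := exists_descent_of_mem_parabolic cs hu h1
  have h3 := length_mul_add_of_isLongestIn cs hr₀ hu
  have h4 := length_mul_add_of_isLongestIn cs hr₀ (mul_mem hu (simple_mem_parabolic cs hi))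
  rw [mul_inv_cancel_left] at h3
  rw [← mul_assoc, mul_inv_cancel_left] at h4
  have := h i hi
  omega

/-- A reduced word in the letters `i ≠ j` that ends with `j` is alternating. -/
lemma eq_alternatingWord_of_isReduced {i j : B} {ω : List B} (h : ∀ k ∈ ω, k = i ∨ k = j)
    (hr : cs.IsReduced (ω ++ [j])) :
    ω ++ [j] = CoxeterSystem.alternatingWord i j (ω.length + 1) := by
  induction ω using List.reverseRecOn generalizing i j with
  | nil => simp [CoxeterSystem.alternatingWord]
  | append_singleton ω k ih =>
    have hk : k = i := by
      rcases h k (by simp) with h1 | h1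
      · exact h1
      · exfalso
        subst h1
        have h2 := hr.eq
        rw [List.append_assoc, cs.wordProd_append] at h2
        have h3 := cs.length_wordProd_le ω
        simp [cs.wordProd_cons] at h2
        omega
    subst hk
    rw [CoxeterSystem.alternatingWord_succ, List.length_append, List.length_singleton,
      ← ih (fun l hl ↦ (h l (by simp [hl])).symm) (by
        have := hr.take (ω ++ [k]).length
        rwa [List.take_left] at this),
      List.concat_eq_append]

lemma isReduced_alternatingWord_le {i j : B} (hM : M i j ≠ 0) {m : ℕ}
    (h : cs.IsReduced (CoxeterSystem.alternatingWord i j m)) : m ≤ M i j := by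
  by_contra hc
  exact cs.not_isReduced_alternatingWord i j hM (by omega) h

lemma exists_alternatingWord_of_mem_parabolic {i j : B} (hM : M i j ≠ 0) {u : W}
    (hu : u ∈ parabolic cs {i, j}) : ∃ m ≤ M i j,
      u = cs.wordProd (CoxeterSystem.alternatingWord i j m) ∨
      u = cs.wordProd (CoxeterSystem.alternatingWord j i m) := by
  obtain ⟨ω, h, hr, rfl⟩ := exists_isReduced_of_mem_parabolic cs hu
  rcases List.eq_nil_or_concat ω with rfl | ⟨ω', k, rfl⟩
  · exact ⟨0, by omega, Or.inl (by simp [CoxeterSystem.alternatingWord])⟩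
  · rw [List.concat_eq_append] at *
    have h' : ∀ l ∈ ω', l = i ∨ l = j := fun l hl ↦ h l (by simp [hl])
    rcases h k (by simp) with rfl | hk
    · have e := eq_alternatingWord_of_isReduced cs (fun l hl ↦ (h' l hl).symm) hr
      refine ⟨_, ?_, Or.inr (by rw [e])⟩
      rw [e] at hr
      rw [M.symmetric] at hM ⊢
      exact isReduced_alternatingWord_le cs hM hr
    · rw [Set.mem_singleton_iff] at hk
      subst hk
      have e := eq_alternatingWord_of_isReduced cs h' hr
      refine ⟨_, ?_, Or.inl (by rw [e])⟩
      rw [e] at hr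
      exact isReduced_alternatingWord_le cs hM hr

lemma finite_parabolic_pair {i j : B} (hM : M i j ≠ 0) : Finite (parabolic cs {i, j}) := by
  have : Set.Finite ((fun m ↦ cs.wordProd (CoxeterSystem.alternatingWord i j m)) '' Set.Iic (M i j) ∪
      (fun m ↦ cs.wordProd (CoxeterSystem.alternatingWord j i m)) '' Set.Iic (M i j)) :=
    ((Set.finite_Iic _).image _).union ((Set.finite_Iic _).image _)
  refine (this.subset fun u hu ↦ ?_).to_subtype
  obtain ⟨m, hm, rfl | rfl⟩ := exists_alternatingWord_of_mem_parabolic cs hM hu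
  · exact Or.inl ⟨m, hm, rfl⟩
  · exact Or.inr ⟨m, hm, rfl⟩

end Parabolic

/-! ### Unfoldings: from braid words to all reduced words -/

section Unfolding

variable {B B' W W' : Type*} [Group W] [Group W'] {M : CoxeterMatrix B} {M' : CoxeterMatrix B'}
  {cs' : CoxeterSystem M' W'} {cs : CoxeterSystem M W} {I : B' → Set B} {φ : W' →* W}

/-- The total length of the images under `φ` of the letters of a word. -/
noncomputable def unfoldedLength (cs' : CoxeterSystem M' W') (cs : CoxeterSystem M W)
    (φ : W' →* W) (ω : List B') : ℕ :=
  (ω.map fun i ↦ cs.length (φ (cs'.simple i))).sum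

lemma unfoldedLength_nil : unfoldedLength cs' cs φ [] = 0 := rfl

lemma unfoldedLength_append (ω ω' : List B') : unfoldedLength cs' cs φ (ω ++ ω') =
    unfoldedLength cs' cs φ ω + unfoldedLength cs' cs φ ω' := by
  simp [unfoldedLength]

lemma unfoldedLength_singleton (i : B') : unfoldedLength cs' cs φ [i] =
    cs.length (φ (cs'.simple i)) := by
  simp [unfoldedLength]

lemma unfoldedLength_cons (i : B') (ω : List B') : unfoldedLength cs' cs φ (i :: ω) =
    cs.length (φ (cs'.simple i)) + unfoldedLength cs' cs φ ω := by
  simp [unfoldedLength]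

lemma length_map_wordProd_le (ω : List B') :
    cs.length (φ (cs'.wordProd ω)) ≤ unfoldedLength cs' cs φ ω := by
  induction ω with
  | nil => simp
  | cons i ω ih =>
    rw [cs'.wordProd_cons, map_mul, unfoldedLength_cons]
    exact (cs.length_mul_le _ _).trans (by omega)

/-- Additivity of lengths passes to suffixes, since the prefix can never exceed its unfolded length.
-/
lemma unfoldedLength_le_of_append {ω ω' : List B'}
    (h : unfoldedLength cs' cs φ (ω ++ ω') ≤ cs.length (φ (cs'.wordProd (ω ++ ω')))) :
    unfoldedLength cs' cs φ ω' ≤ cs.length (φ (cs'.wordProd ω')) := by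
  rw [unfoldedLength_append, cs'.wordProd_append, map_mul] at h
  have h1 := cs.length_mul_le (φ (cs'.wordProd ω)) (φ (cs'.wordProd ω'))
  have h2 := length_map_wordProd_le (cs' := cs') (cs := cs) (φ := φ) ω
  omega

lemma exists_alternatingWord_eq_append {i j : B'} {k m : ℕ} (h : k ≤ m) :
    ∃ ω, CoxeterSystem.alternatingWord i j m = ω ++ CoxeterSystem.alternatingWord i j k := by
  induction m, h using Nat.le_induction with
  | base => exact ⟨[], by simp⟩
  | succ m _ ih =>
    obtain ⟨ω, hω⟩ := ih
    exact ⟨_ :: ω, by rw [CoxeterSystem.alternatingWord_succ', hω, List.cons_append]⟩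

/-- The homomorphism `φ` sends every simple reflection `r_i` to the longest element of the finite
parabolic subgroup `W_{I i}`, and the lengths of the factors add up in the images of the braid
words. -/
structure IsUnfolding (cs' : CoxeterSystem M' W') (cs : CoxeterSystem M W) (I : B' → Set B)
    (φ : W' →* W) : Prop where
  finite : ∀ i, Finite (parabolic cs (I i))
  mem : ∀ i, φ (cs'.simple i) ∈ parabolic cs (I i)
  descent : ∀ i, ∀ s ∈ I i,
    cs.length (φ (cs'.simple i) * cs.simple s) < cs.length (φ (cs'.simple i))
  ne_zero : ∀ i j, i ≠ j → M' i j ≠ 0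
  braid : ∀ i j, i ≠ j → unfoldedLength cs' cs φ (CoxeterSystem.braidWord M' i j) ≤
    cs.length (φ (cs'.wordProd (CoxeterSystem.braidWord M' i j)))

namespace IsUnfolding

/-- The image of a simple reflection squares to `1`, so its left and right descents agree. -/
lemma length_simple_mul_lt (H : IsUnfolding cs' cs I φ) (i : B') {s : B} (hs : s ∈ I i) :
    cs.length (cs.simple s * φ (cs'.simple i)) < cs.length (φ (cs'.simple i)) := by
  have h := H.descent i s hs
  rw [← cs.length_inv (_ * _), mul_inv_rev, cs.inv_simple, ← map_inv, cs'.inv_simple] at h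
  exact h

/-- The heart of the argument: ascents of `w` unfold to ascents of `φ w`. Induction on the length
reduces the claim to a dihedral parabolic subgroup, where the braid condition decides it. -/
lemma lt_length_mul_simple (H : IsUnfolding cs' cs I φ) (w : W') (i : B')
    (h : cs'.length w < cs'.length (w * cs'.simple i)) {s : B} (hs : s ∈ I i) :
    cs.length (φ w) < cs.length (φ w * cs.simple s) := by
  induction hn : cs'.length w using Nat.strong_induction_on generalizing w i s with
  | _ n ih =>
    subst hn
    by_cases hw : w = 1
    · subst hw; simp
    obtain ⟨j, hj⟩ := cs'.exists_rightDescent_of_ne_one hw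
    rw [CoxeterSystem.IsRightDescent] at hj
    have hij : j ≠ i := by rintro rfl; omega
    -- Since `j` is a descent of `w`, the dihedral part `u` is nontrivial, so `v` is strictly
    -- shorter and the induction hypothesis applies to it with both `j` and `i`.
    obtain ⟨v, u, hu, rfl, hmin⟩ := exists_isMin_mul cs' {j, i} w
    have hiJ : cs'.simple i ∈ parabolic cs' {j, i} := simple_mem_parabolic cs' (by simp)
    have hjJ : cs'.simple j ∈ parabolic cs' {j, i} := simple_mem_parabolic cs' (by simp)
    have hlen := length_mul_of_isMin cs' hmin hu
    have hu1 : u ≠ 1 := by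
      rintro rfl
      have := hmin _ hjJ
      rw [mul_one] at hj
      omega
    have hv : cs'.length v < cs'.length (v * u) := by
      have : cs'.length u ≠ 0 := fun h0 ↦ hu1 (cs'.length_eq_zero_iff.1 h0)
      omega
    have hasc : ∀ k ∈ ({j, i} : Set B'), cs'.length v < cs'.length (v * cs'.simple k) := by
      intro k hk
      have h1 := hmin _ (simple_mem_parabolic cs' hk)
      have h2 := cs'.length_mul_simple v k
      omega
    have hφv : ∀ s ∈ I j ∪ I i, cs.length (φ v) < cs.length (φ v * cs.simple s) := by
      rintro s (hs | hs)
      · exact ih _ hv v j (hasc j (by simp)) hs rfl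
      · exact ih _ hv v i (hasc i (by simp)) hs rfl
    obtain ⟨ω, hω, hr, rfl⟩ := exists_isReduced_of_mem_parabolic cs' hu
    have hφu : φ (cs'.wordProd ω) ∈ parabolic cs (I j ∪ I i) := by
      have : parabolic cs' {j, i} ≤ (parabolic cs (I j ∪ I i)).comap φ := by
        rw [parabolic, Subgroup.closure_le]
        rintro _ ⟨k, rfl | rfl, rfl⟩
        · exact parabolic_mono cs Set.subset_union_left (H.mem _)
        · exact parabolic_mono cs Set.subset_union_right (H.mem _)
      exact this hu
    have hsmem : cs.simple s ∈ parabolic cs (I j ∪ I i) := simple_mem_parabolic cs (Or.inr hs)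
    rw [mul_assoc, length_mul_of_isMin cs' hmin (mul_mem hu hiJ)] at h
    -- Being reduced in two letters and ending in `i`, this word is alternating of length at most
    -- `M' j i`, hence a suffix of the braid word.
    have hred : cs'.IsReduced (ω ++ [i]) := isReduced_concat cs' hr (by omega)
    have halt := eq_alternatingWord_of_isReduced cs' hω hred
    have hle : ω.length + 1 ≤ M' j i :=
      isReduced_alternatingWord_le cs' (H.ne_zero j i hij) (halt ▸ hred)
    obtain ⟨α, hα⟩ := exists_alternatingWord_eq_append (i := j) (j := i) hle
    have hb := H.braid j i hij
    rw [CoxeterSystem.braidWord, hα] at hb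
    replace hb := unfoldedLength_le_of_append hb
    rw [← halt, unfoldedLength_append, unfoldedLength_singleton, cs'.wordProd_append,
      cs'.wordProd_singleton, map_mul] at hb
    have h1 := length_map_wordProd_le (cs' := cs') (cs := cs) (φ := φ) ω
    have h2 := H.length_simple_mul_lt i hs
    -- Inserting `s s = 1` between `φ u` and `φ r_i`: the product has full length while `s φ(r_i)`
    -- is shorter than `φ(r_i)`, so `φ(u) s` must be longer than `φ u`.
    have h3 := cs.length_mul_le (φ (cs'.wordProd ω) * cs.simple s)
      (cs.simple s * φ (cs'.simple i))
    rw [mul_assoc, cs.simple_mul_simple_cancel_left] at h3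
    rw [map_mul, mul_assoc, length_mul_of_forall_lt cs hφv (mul_mem hφu hsmem),
      length_mul_of_forall_lt cs hφv hφu]
    omega

lemma length_map_mul_simple (H : IsUnfolding cs' cs I φ) (w : W') (i : B')
    (h : cs'.length w < cs'.length (w * cs'.simple i)) :
    cs.length (φ (w * cs'.simple i)) = cs.length (φ w) + cs.length (φ (cs'.simple i)) := by
  rw [map_mul]
  exact length_mul_of_forall_lt cs (fun s hs ↦ H.lt_length_mul_simple w i h hs) (H.mem i)

lemma length_map_wordProd (H : IsUnfolding cs' cs I φ) {ω : List B'} (hω : cs'.IsReduced ω) :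
    cs.length (φ (cs'.wordProd ω)) = unfoldedLength cs' cs φ ω := by
  induction ω using List.reverseRecOn with
  | nil => simp [unfoldedLength]
  | append_singleton ω i ih =>
    have hω' : cs'.IsReduced ω := by simpa using hω.take ω.length
    have h1 := hω.eq
    rw [List.length_append, ← hω'.eq, cs'.wordProd_append, cs'.wordProd_singleton,
      List.length_singleton] at h1
    rw [cs'.wordProd_append, cs'.wordProd_singleton, H.length_map_mul_simple _ _ (by omega),
      ih hω', unfoldedLength_append, unfoldedLength_singleton]

lemma length_map_mul (H : IsUnfolding cs' cs I φ) {u v : W'}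
    (h : cs'.length (u * v) = cs'.length u + cs'.length v) :
    cs.length (φ (u * v)) = cs.length (φ u) + cs.length (φ v) := by
  obtain ⟨ω, hω, rfl⟩ := cs'.exists_isReduced u
  obtain ⟨ω', hω', rfl⟩ := cs'.exists_isReduced v
  have hr : cs'.IsReduced (ω ++ ω') := by
    rw [CoxeterSystem.IsReduced, cs'.wordProd_append, h, hω.eq, hω'.eq, List.length_append]
  rw [← cs'.wordProd_append, H.length_map_wordProd hr, H.length_map_wordProd hω,
    H.length_map_wordProd hω', unfoldedLength_append]

/-- A nontrivial `w` ends in some `r_i`, so `ℓ(φ w) ≥ ℓ(φ r_i)`; the latter is positive because `φ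
r_i` has a descent. -/
lemma injective (H : IsUnfolding cs' cs I φ) (hne : ∀ i, (I i).Nonempty) :
    Function.Injective φ := by
  rw [injective_iff_map_eq_one]
  intro w hw
  by_contra h1
  obtain ⟨i, hi⟩ := cs'.exists_rightDescent_of_ne_one h1
  rw [CoxeterSystem.IsRightDescent] at hi
  have h2 := H.length_map_mul_simple (w * cs'.simple i) i (by simpa using hi)
  rw [cs'.simple_mul_simple_cancel_right, hw, cs.length_one] at h2
  obtain ⟨s, hs⟩ := hne i
  have h3 := H.descent i s hs
  omega

lemma isLongestIn (H : IsUnfolding cs' cs I φ) (i : B') :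
    IsLongestIn cs (I i) (φ (cs'.simple i)) :=
  have := H.finite i
  isLongestIn_of_forall_lt cs (H.mem i) (H.descent i)

lemma foldingGenerators_eq (H : IsUnfolding cs' cs I φ) :
    foldingGenerators cs (Set.range I) = φ '' Set.range cs'.simple := by
  ext r
  constructor
  · rintro ⟨_, ⟨i, rfl⟩, hr⟩
    exact ⟨_, ⟨i, rfl⟩, IsLongestIn.eq cs (H.isLongestIn i) hr⟩
  · rintro ⟨_, ⟨i, rfl⟩, rfl⟩
    exact ⟨_, ⟨i, rfl⟩, H.isLongestIn i⟩

lemma range_eq_foldingSubgroup (H : IsUnfolding cs' cs I φ) :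
    φ.range = foldingSubgroup cs (Set.range I) := by
  rw [foldingSubgroup, H.foldingGenerators_eq, ← MonoidHom.map_closure,
    cs'.subgroup_closure_range_simple, MonoidHom.range_eq_map]

theorem isFolding (H : IsUnfolding cs' cs I φ) (hI : Setoid.IsPartition (Set.range I)) :
    IsFolding cs' cs (Set.range I) φ where
  admissible :=
    { isPartition := hI
      finite_parabolic := by
        rintro _ ⟨i, rfl⟩
        exact H.finite i
      length_mul := by
        rintro w hw _ ⟨i, rfl⟩
        rw [← H.range_eq_foldingSubgroup] at hw
        obtain ⟨w, rfl⟩ := hw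
        rcases cs'.length_mul_simple w i with h | h
        · left
          intro s hs
          have h1 := H.lt_length_mul_simple w i (by omega) hs
          have h2 := cs.length_mul_simple (φ w) s
          omega
        -- Here `φ w = φ(w r_i) φ(r_i)` with lengths adding, and `s` shortens the second factor.
        · right
          intro s hs
          have h1 := H.length_map_mul_simple (w * cs'.simple i) i (by simp; omega)
          rw [cs'.simple_mul_simple_cancel_right] at h1
          have h2 := H.descent i s hs
          have h3 := cs.length_mul_le (φ (w * cs'.simple i)) (φ (cs'.simple i) * cs.simple s)
          rw [← mul_assoc, ← map_mul, cs'.simple_mul_simple_cancel_right] at h3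
          have h4 := cs.length_mul_simple (φ w) s
          omega }
  injective := H.injective fun i ↦ Set.nonempty_iff_ne_empty.2 fun h ↦ hI.1 ⟨i, h⟩
  range_eq := H.range_eq_foldingSubgroup
  image_simple := H.foldingGenerators_eq.symm

end IsUnfolding

end Unfolding

/-! ### Upper bound for lengths in type `A_m` -/

section Chain

variable {G : Type*} [Group G]

/-- The elements `x 0, …, x (m - 1)` satisfy the relations of the simple reflections of type
`A_m`. -/
structure IsChain (x : ℕ → G) (m : ℕ) : Prop where
  sq : ∀ i < m, x i * x i = 1
  braid : ∀ i, i + 1 < m → x i * x (i + 1) * x i = x (i + 1) * x i * x (i + 1)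
  comm : ∀ i j, i + 1 < j → j < m → x i * x j = x j * x i

/-- The product `x m * x (m - 1) * ⋯` of `k` factors. -/
def descProd (x : ℕ → G) (m : ℕ) : ℕ → G
  | 0 => 1
  | k + 1 => descProd x m k * x (m - k)

namespace IsChain

variable {x : ℕ → G} {m : ℕ}

lemma mono (h : IsChain x m) {m' : ℕ} (hm : m' ≤ m) : IsChain x m' where
  sq i hi := h.sq i (by omega)
  braid i hi := h.braid i (by omega)
  comm i j hij hj := h.comm i j hij (by omega)

lemma descProd_mul_comm (h : IsChain x (m + 1)) {k j : ℕ} (hj : j + k < m) :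
    descProd x m k * x j = x j * descProd x m k := by
  induction k with
  | zero => simp [descProd]
  | succ k ih =>
    rw [descProd, mul_assoc, ← h.comm j (m - k) (by omega) (by omega), ← mul_assoc,
      ih (by omega), mul_assoc]

/-- The factors after `x j` commute with `x (j + 1)`; the braid relation turns it into `x j`, which
commutes with all factors before `x (j + 1)`. -/
lemma descProd_mul_braid (h : IsChain x (m + 1)) {k j : ℕ} (hk : k ≤ m + 1) (hj : j < m)
    (hjk : m < j + k) : descProd x m k * x (j + 1) = x j * descProd x m k := by
  induction k with
  | zero => omega
  | succ k ih =>
    rcases Nat.lt_or_ge m (j + k) with h1 | h1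
    · rw [descProd, mul_assoc, h.comm (m - k) (j + 1) (by omega) (by omega), ← mul_assoc,
        ih (by omega) h1, mul_assoc]
    · obtain rfl | ⟨k, rfl⟩ : k = 0 ∨ ∃ k', k = k' + 1 := by
        rcases k with _ | k
        · exact Or.inl rfl
        · exact Or.inr ⟨k, rfl⟩
      · omega
      · have e1 : m - k = j + 1 := by omega
        have e2 : m - (k + 1) = j := by omega
        rw [descProd, descProd, e1, e2]
        have := h.braid j (by omega)
        calc descProd x m k * x (j + 1) * x j * x (j + 1)
            = descProd x m k * (x (j + 1) * x j * x (j + 1)) := by simp only [mul_assoc]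
          _ = descProd x m k * x j * x (j + 1) * x j := by rw [← this]; simp only [mul_assoc]
          _ = _ := by rw [h.descProd_mul_comm (by omega)]; simp only [mul_assoc]

/-- The `m + 2` products `descProd x m k` represent the cosets of the subgroup of the first `m`
generators. Right multiplication by `x j` commutes past the product, extends it, cancels its last
factor, or emerges on the left as `x (j - 1)`, according as `j + k` is less than `m`, equal to `m`,
equal to `m + 1`, or larger. -/
lemma exists_mul_descProd (h : IsChain x (m + 1)) {g : G}
    (hg : g ∈ Subgroup.closure (x '' Set.Iio (m + 1))) :
    ∃ u ∈ Subgroup.closure (x '' Set.Iio m), ∃ k ≤ m + 1, g = u * descProd x m k := by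
  have key : ∀ k ≤ m + 1, ∀ j < m + 1, ∃ u ∈ Subgroup.closure (x '' Set.Iio m),
      ∃ k' ≤ m + 1, descProd x m k * x j = u * descProd x m k' := by
    intro k hk j hj
    rcases Nat.lt_trichotomy (j + k) m with h1 | h1 | h1
    · exact ⟨x j, Subgroup.subset_closure ⟨j, by simp; omega, rfl⟩, k, hk,
        h.descProd_mul_comm h1⟩
    · refine ⟨1, one_mem _, k + 1, by omega, ?_⟩
      rw [descProd, show m - k = j by omega, one_mul]
    · rcases Nat.lt_or_ge (m + 1) (j + k) with h2 | h2
      · obtain ⟨j, rfl⟩ : ∃ j', j = j' + 1 := ⟨j - 1, by omega⟩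
        exact ⟨x j, Subgroup.subset_closure ⟨j, by simp; omega, rfl⟩, k, hk,
          h.descProd_mul_braid hk (by omega) (by omega)⟩
      · obtain ⟨k, rfl⟩ : ∃ k', k = k' + 1 := ⟨k - 1, by omega⟩
        refine ⟨1, one_mem _, k, by omega, ?_⟩
        rw [descProd, show m - k = j by omega, one_mul, mul_assoc, h.sq j hj, mul_one]
  induction hg using Subgroup.closure_induction_right with
  | one => exact ⟨1, one_mem _, 0, by omega, by simp [descProd]⟩
  | mul_right g y hg hy ih =>
    obtain ⟨j, hj, rfl⟩ := hy
    obtain ⟨u, hu, k, hk, rfl⟩ := ih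
    obtain ⟨u', hu', k', hk', e⟩ := key k hk j hj
    exact ⟨u * u', mul_mem hu hu', k', hk', by rw [mul_assoc, e, mul_assoc]⟩
  | mul_inv_cancel g y hg hy ih =>
    obtain ⟨j, hj, rfl⟩ := hy
    obtain ⟨u, hu, k, hk, rfl⟩ := ih
    obtain ⟨u', hu', k', hk', e⟩ := key k hk j hj
    rw [← eq_inv_of_mul_eq_one_left (h.sq j hj)]
    exact ⟨u * u', mul_mem hu hu', k', hk', by rw [mul_assoc, e, mul_assoc]⟩

lemma descProd_eq (x : ℕ → G) (m k : ℕ) (hk : k ≤ m + 1) : ∃ l : List ℕ,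
    (∀ i ∈ l, i < m + 1) ∧ l.length = k ∧ descProd x m k = (l.map x).prod := by
  induction k with
  | zero => exact ⟨[], by simp, rfl, by simp [descProd]⟩
  | succ k ih =>
    obtain ⟨l, h1, h2, h3⟩ := ih (by omega)
    refine ⟨l ++ [m - k], ?_, by simp [h2], by simp [descProd, h3]⟩
    intro i hi
    rcases List.mem_append.1 hi with hi | hi
    · exact h1 i hi
    · rw [List.mem_singleton.1 hi]; omega

/-- Every element of the group generated by a chain of type `A_m` is the product of a word of
length at most `m (m + 1) / 2`. -/
theorem exists_word (h : IsChain x m) {g : G} (hg : g ∈ Subgroup.closure (x '' Set.Iio m)) :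
    ∃ l : List ℕ, (∀ i ∈ l, i < m) ∧ 2 * l.length ≤ m * (m + 1) ∧ g = (l.map x).prod := by
  induction m generalizing g with
  | zero =>
    have : g = 1 := by simpa [Set.Iio] using hg
    exact ⟨[], by simp, by simp, by simp [this]⟩
  | succ m ih =>
    obtain ⟨u, hu, k, hk, rfl⟩ := h.exists_mul_descProd hg
    obtain ⟨l, h1, h2, rfl⟩ := ih (h.mono (by omega)) hu
    obtain ⟨l', h1', h2', h3'⟩ := descProd_eq x m k hk
    refine ⟨l ++ l', ?_, ?_, by rw [h3', List.map_append, List.prod_append]⟩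
    · intro i hi
      rcases List.mem_append.1 hi with hi | hi
      · have := h1 i hi; omega
      · exact h1' i hi
    · rw [List.length_append, h2', mul_add]
      nlinarith

end IsChain

variable {B W : Type*} [Group W] {M : CoxeterMatrix B} (cs : CoxeterSystem M W)

lemma length_list_prod_le {l : List ℕ} {x : ℕ → W} (hx : ∀ i ∈ l, cs.length (x i) ≤ 1) :
    cs.length (l.map x).prod ≤ l.length := by
  induction l with
  | nil => simp
  | cons i l ih =>
    rw [List.map_cons, List.prod_cons, List.length_cons]
    have h1 := cs.length_mul_le (x i) (l.map x).prod
    have h2 := hx i (by simp)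
    have h3 := ih fun j hj ↦ hx j (by simp [hj])
    omega

lemma IsChain.two_mul_length_le {x : ℕ → W} {m : ℕ} (h : IsChain x m)
    (hx : ∀ i < m, ∃ b, x i = cs.simple b) {w : W}
    (hw : w ∈ Subgroup.closure (x '' Set.Iio m)) : 2 * cs.length w ≤ m * (m + 1) := by
  obtain ⟨l, h1, h2, rfl⟩ := h.exists_word hw
  refine (Nat.mul_le_mul_left 2 (length_list_prod_le cs fun i hi ↦ ?_)).trans h2
  obtain ⟨b, hb⟩ := hx i (h1 i hi)
  rw [hb, cs.length_simple]

/-- Two elements of the maximal length `m (m + 1) / 2` in a parabolic subgroup of type `A_m`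
coincide. -/
lemma IsChain.eq_of_length {x : ℕ → W} {m : ℕ} (h : IsChain x m)
    (hx : ∀ i < m, ∃ b, x i = cs.simple b) {v w : W}
    (hv : v ∈ Subgroup.closure (x '' Set.Iio m)) (hw : w ∈ Subgroup.closure (x '' Set.Iio m))
    (hlv : m * (m + 1) ≤ 2 * cs.length v) (hlw : m * (m + 1) ≤ 2 * cs.length w) : v = w := by
  have hJ : parabolic cs {b | ∃ i < m, x i = cs.simple b} = Subgroup.closure (x '' Set.Iio m) := by
    rw [parabolic]
    congr 1
    ext y
    constructor
    · rintro ⟨b, ⟨i, hi, e⟩, rfl⟩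
      exact ⟨i, hi, e⟩
    · rintro ⟨i, hi, rfl⟩
      obtain ⟨b, hb⟩ := hx i hi
      exact ⟨b, ⟨i, hi, hb⟩, hb.symm⟩
  apply IsLongestIn.eq cs (I := {b | ∃ i < m, x i = cs.simple b})
  · refine ⟨hJ ▸ hv, fun u hu ↦ ?_⟩
    have := h.two_mul_length_le cs hx (hJ ▸ hu)
    omega
  · refine ⟨hJ ▸ hw, fun u hu ↦ ?_⟩
    have := h.two_mul_length_le cs hx (hJ ▸ hu)
    omega

lemma IsChain.finite_closure {x : ℕ → G} {m : ℕ} (h : IsChain x m) :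
    Finite (Subgroup.closure (x '' Set.Iio m)) := by
  have hf : Set.Finite {l : List (Fin m) | l.length ≤ m * (m + 1)} := List.finite_length_le _ _
  refine ((hf.image fun l ↦ (l.map fun i : Fin m ↦ x i).prod).subset fun u hu ↦ ?_).to_subtype
  obtain ⟨l, h1, h2, rfl⟩ := h.exists_word hu
  refine ⟨l.attach.map fun i ↦ ⟨i.1, h1 i.1 i.2⟩, ?_, ?_⟩
  · simp; omega
  · simp only [List.map_map]
    congr 1
    exact List.attach_map_val (f := x) ..

end Chain

/-! ### Braid relations and liftability -/

section Liftable

variable {B G : Type*} [Group G]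

/-- For involutions the quotient of the two alternating products of length `m` is an `m`-th power,
so a braid relation is equivalent to the relation `(f j * f i) ^ m = 1`. -/
lemma inv_mul_prod_alternatingWord {f : B → G} {i j : B} (hi : f i * f i = 1) (hj : f j * f j = 1)
    (m : ℕ) : ((CoxeterSystem.alternatingWord i j m).map f).prod⁻¹ *
      ((CoxeterSystem.alternatingWord j i m).map f).prod = (f j * f i) ^ m := by
  induction m generalizing i j with
  | zero => simp [CoxeterSystem.alternatingWord]
  | succ m ih =>
    rw [CoxeterSystem.alternatingWord_succ, CoxeterSystem.alternatingWord_succ]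
    simp only [List.concat_eq_append, List.map_append, List.prod_append, List.map_cons,
      List.map_nil, List.prod_cons, List.prod_nil, mul_one, mul_inv_rev]
    rw [← eq_inv_of_mul_eq_one_left hj]
    calc _ = f j * (((CoxeterSystem.alternatingWord j i m).map f).prod⁻¹ *
          ((CoxeterSystem.alternatingWord i j m).map f).prod) * f i := by simp only [mul_assoc]
      _ = f j * (f i * f j) ^ m * f i := by rw [ih hj hi]
      _ = (f j * f i) ^ m * f j * f i := by rw [mul_pow_mul]
      _ = _ := by rw [pow_succ, mul_assoc]

lemma isLiftable_of_braid {M : CoxeterMatrix B} {f : B → G} (hinv : ∀ i, f i * f i = 1)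
    (h : ∀ i j, i ≠ j → ((CoxeterSystem.braidWord M i j).map f).prod =
      ((CoxeterSystem.braidWord M j i).map f).prod) : M.IsLiftable f := by
  intro i j
  by_cases hij : i = j
  · subst hij; simp [hinv]
  · have := inv_mul_prod_alternatingWord (hinv j) (hinv i) (M i j)
    rw [← this, inv_mul_eq_one]
    have h1 := h i j hij
    simp only [CoxeterSystem.braidWord, M.symmetric j i] at h1
    exact h1.symm

/-- Each primed element commutes with each unprimed one, so the relation is the product of the two
given ones. -/
lemma braid_mul_of_commute {a a' b b' : G} (h1 : Commute a a') (h2 : Commute b b')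
    (h3 : Commute a b') (h4 : Commute a' b) (h : a * b * a = b * a * b)
    (h' : a' * b' * a' = b' * a' * b') :
    a * a' * (b * b') * (a * a') = b * b' * (a * a') * (b * b') := by
  have c1 : Commute (a' * b') a := h1.symm.mul_left h3.symm
  have c2 : Commute (b' * a') b := h2.symm.mul_left h4
  calc a * a' * (b * b') * (a * a') = a * (a' * b) * b' * a * a' := by simp only [mul_assoc]
    _ = a * b * ((a' * b') * a) * a' := by rw [h4.eq]; simp only [mul_assoc]
    _ = a * b * a * (a' * b' * a') := by rw [c1.eq]; simp only [mul_assoc]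
    _ = b * a * b * (b' * a' * b') := by rw [h, h']
    _ = b * a * (b * (b' * a')) * b' := by simp only [mul_assoc]
    _ = b * (a * b') * a' * b * b' := by rw [← c2.eq]; simp only [mul_assoc]
    _ = _ := by rw [h3.eq]; simp only [mul_assoc]

end Liftable

/-! ### Lower bound for lengths by counting pairs moved out of a set -/

section Flips

variable {B W : Type*} [Group W] {M : CoxeterMatrix B} (cs : CoxeterSystem M W)

/-- If every simple reflection moves at most `c` elements of a finite set `P` of pairs out of `P`,
then `w` moves at most `c * ℓ(w)` elements out of `P`. -/
lemma card_filter_le_mul_length {X : Type*} [DecidableEq X] (ρ : W →* Equiv.Perm X)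
    (P : Finset (X × X)) (c : ℕ)
    (h : ∀ i, (P.filter fun z ↦ Prod.map (ρ (cs.simple i)) (ρ (cs.simple i)) z ∉ P).card ≤ c)
    (w : W) : (P.filter fun z ↦ Prod.map (ρ w) (ρ w) z ∉ P).card ≤ c * cs.length w := by
  obtain ⟨ω, hω, rfl⟩ := cs.exists_isReduced w
  rw [hω.eq]
  clear hω
  induction ω with
  | nil => simp
  | cons i ω ih =>
    rw [cs.wordProd_cons, List.length_cons, mul_add, mul_one]
    set σ := ρ (cs.wordProd ω) with hσ
    set τ := ρ (cs.simple i) with hτ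
    -- A pair leaving `P` is moved out already by `σ`, or stays in `P` under `σ` and is then moved
    -- out by `τ`; the latter pairs are pulled back along the bijection `σ`.
    have hsub : (P.filter fun z ↦ Prod.map (ρ (cs.simple i * cs.wordProd ω))
          (ρ (cs.simple i * cs.wordProd ω)) z ∉ P) ⊆
        (P.filter fun z ↦ Prod.map σ σ z ∉ P) ∪
        ((P.filter fun z ↦ Prod.map τ τ z ∉ P).image (Prod.map σ.symm σ.symm)) := by
      intro z hz
      rw [Finset.mem_filter] at hz
      rw [Finset.mem_union, Finset.mem_filter, Finset.mem_image]
      by_cases hzP : Prod.map σ σ z ∈ P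
      · right
        refine ⟨Prod.map σ σ z, Finset.mem_filter.2 ⟨hzP, ?_⟩,
          Prod.ext (σ.symm_apply_apply _) (σ.symm_apply_apply _)⟩
        have := hz.2
        rw [map_mul] at this
        exact this
      · exact Or.inl ⟨hz.1, hzP⟩
    calc _ ≤ _ := Finset.card_le_card hsub
      _ ≤ _ := Finset.card_union_le _ _
      _ ≤ _ := add_le_add ih (Finset.card_image_le.trans (h i))

end Flips

/-! ### Numbered generators and small products -/

section Gen

variable {N : ℕ} {W : Type*} [Group W] {M : CoxeterMatrix (Fin N)} (cs : CoxeterSystem M W)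

lemma gen_eq {k : ℕ} (h1 : 1 ≤ k) (h2 : k ≤ N) :
    gen cs k = cs.simple ⟨k - 1, by omega⟩ := dif_pos ⟨h1, h2⟩

lemma simple_eq_gen (i : Fin N) : cs.simple i = gen cs (i + 1) := by
  rw [gen_eq cs (by omega) (by omega)]
  rfl

lemma gen_mul_self (k : ℕ) : gen cs k * gen cs k = 1 := by
  unfold gen
  split_ifs <;> simp

lemma gen_mul_gen_cancel (k : ℕ) (w : W) : gen cs k * (gen cs k * w) = w := by
  rw [← mul_assoc, gen_mul_self, one_mul]

lemma gen_mem_parabolic {k : ℕ} {J : Set (Fin N)} (hJ : ∀ i : Fin N, i + 1 = k → i ∈ J) :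
    gen cs k ∈ parabolic cs J := by
  unfold gen
  split_ifs with h
  · exact simple_mem_parabolic cs (hJ _ (by simp; omega))
  · exact one_mem _

lemma length_gen_le (k : ℕ) : cs.length (gen cs k) ≤ 1 := by
  unfold gen
  split_ifs <;> simp

lemma length_gen {k : ℕ} (h1 : 1 ≤ k) (h2 : k ≤ N) : cs.length (gen cs k) = 1 := by
  rw [gen_eq cs h1 h2, cs.length_simple]

lemma commute_simple {B : Type*} {M : CoxeterMatrix B} (cs : CoxeterSystem M W) {i j : B}
    (h : M i j = 2) : Commute (cs.simple i) (cs.simple j) := by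
  have h1 := cs.simple_mul_simple_pow i j
  rw [h, pow_two, mul_eq_one_iff_eq_inv, mul_inv_rev, cs.inv_simple, cs.inv_simple] at h1
  exact h1

lemma braid_simple {B : Type*} {M : CoxeterMatrix B} (cs : CoxeterSystem M W) {i j : B}
    (h : M i j = 3) : cs.simple i * cs.simple j * cs.simple i =
      cs.simple j * cs.simple i * cs.simple j := by
  have h1 := cs.wordProd_braidWord_eq i j
  rw [CoxeterSystem.braidWord, CoxeterSystem.braidWord, M.symmetric j i, h] at h1
  simpa [CoxeterSystem.alternatingWord, cs.wordProd_cons, mul_assoc] using h1.symm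

/-- Otherwise the length is `1` and `s t s` equals `s` or `t`. In the first case `s t = 1`; in the
second `(s t)² = 1`, which with `(s t)³ = 1` again gives `s = t`. -/
lemma length_braid_three {B : Type*} {M : CoxeterMatrix B} (cs : CoxeterSystem M W)
    (hinj : Function.Injective cs.simple) {i j : B} (h : M i j = 3) :
    cs.length (cs.simple i * cs.simple j * cs.simple i) = 3 := by
  have hij : i ≠ j := by rintro rfl; simp at h
  have hne : cs.simple i ≠ cs.simple j := fun e ↦ hij (hinj e)
  have h2 : cs.length (cs.simple i * cs.simple j) = 2 := by
    rw [length_mul_of_disjoint cs hinj (I := {i}) (J := {j}) (by simpa using hij)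
      (simple_mem_parabolic cs rfl) (simple_mem_parabolic cs rfl)]
    simp
  rcases cs.length_mul_simple (cs.simple i * cs.simple j) i with h3 | h3
  · omega
  · exfalso
    rw [h2] at h3
    obtain ⟨k, hk⟩ := cs.length_eq_one_iff.1 (by omega :
      cs.length (cs.simple i * cs.simple j * cs.simple i) = 1)
    have hki : k ∈ ({i, j} : Set B) := by
      apply mem_of_simple_mem_parabolic cs hinj
      rw [← hk]
      exact mul_mem (mul_mem (simple_mem_parabolic cs (by simp)) (simple_mem_parabolic cs (by simp)))
        (simple_mem_parabolic cs (by simp))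
    rcases hki with rfl | hkj
    · rw [mul_eq_right, mul_eq_one_iff_eq_inv, cs.inv_simple] at hk
      exact hne hk
    · rw [Set.mem_singleton_iff] at hkj
      subst hkj
      have h4 := cs.simple_mul_simple_pow i k
      rw [h, pow_succ, pow_two, ← mul_assoc (cs.simple i * cs.simple k), hk,
        cs.simple_mul_simple_self, one_mul, mul_eq_one_iff_eq_inv, cs.inv_simple] at h4
      exact hne h4

lemma length_gen_mul_gen (hinj : Function.Injective cs.simple) {i j : ℕ} (hi : 1 ≤ i) (hij : i < j)
    (hj : j ≤ N) : cs.length (gen cs i * gen cs j) = 2 := by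
  rw [length_mul_of_disjoint cs hinj (I := {b | (b : ℕ) + 1 = i}) (J := {b | (b : ℕ) + 1 = j}) _
    (gen_mem_parabolic cs fun i hi ↦ hi) (gen_mem_parabolic cs fun i hi ↦ hi),
    length_gen cs hi (by omega), length_gen cs (by omega) hj]
  rw [Set.disjoint_left]
  intro b hb hb'
  simp only [Set.mem_ofPred_eq] at hb hb'
  omega

end Gen

/-! ### Type `A_n` as permutations of `0, …, n` -/

section ModelA

lemma commute_swap {a b c d : ℕ} (h1 : a ≠ c) (h2 : a ≠ d) (h3 : b ≠ c) (h4 : b ≠ d) :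
    Commute (Equiv.swap a b) (Equiv.swap c d) := by
  have h : Equiv.swap c d * Equiv.swap a b * (Equiv.swap c d)⁻¹ = Equiv.swap a b := by
    rw [← Equiv.swap_apply_apply, Equiv.swap_apply_of_ne_of_ne h1 h2,
      Equiv.swap_apply_of_ne_of_ne h3 h4]
  rw [mul_inv_eq_iff_eq_mul] at h
  exact h.symm

lemma braid_swap {a b c : ℕ} (h1 : a ≠ b) (h2 : a ≠ c) (h3 : b ≠ c) :
    Equiv.swap a b * Equiv.swap b c * Equiv.swap a b =
      Equiv.swap b c * Equiv.swap a b * Equiv.swap b c := by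
  rw [Equiv.swap_mul_swap_mul_swap h1 h2, Equiv.swap_comm b c, Equiv.swap_comm a b,
    Equiv.swap_mul_swap_mul_swap h3.symm h2.symm, Equiv.swap_comm]

variable {n : ℕ} {W : Type*} [Group W] (cs : CoxeterSystem (CoxeterMatrix.A n) W)

lemma matrixA_apply (i j : Fin n) : CoxeterMatrix.A n i j =
    if i = j then 1 else if (j : ℕ) + 1 = i ∨ (i : ℕ) + 1 = j then 3 else 2 := rfl

lemma isLiftable_swap : (CoxeterMatrix.A n).IsLiftable
    fun i : Fin n ↦ (Equiv.swap (i : ℕ) (i + 1) : Equiv.Perm ℕ) := by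
  apply isLiftable_of_braid
  · intro i; simp
  · intro i j hij
    have hv : (i : ℕ) ≠ j := fun h ↦ hij (Fin.ext h)
    have hji : j ≠ i := fun h ↦ hij h.symm
    rw [CoxeterSystem.braidWord, CoxeterSystem.braidWord, matrixA_apply, matrixA_apply,
      if_neg hij, if_neg hji]
    by_cases h : (j : ℕ) + 1 = i ∨ (i : ℕ) + 1 = j
    · rw [if_pos h, if_pos h.symm]
      simp only [CoxeterSystem.alternatingWord, List.concat_eq_append, List.nil_append,
        List.cons_append, List.map_cons, List.map_nil, List.prod_cons, List.prod_nil, mul_one,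
        ← mul_assoc]
      rcases h with h | h
      · rw [← h]
        exact braid_swap (by omega) (by omega) (by omega)
      · rw [← h]
        exact (braid_swap (by omega) (by omega) (by omega)).symm
    · rw [if_neg h, if_neg (fun h' ↦ h h'.symm)]
      push Not at h
      simp only [CoxeterSystem.alternatingWord, List.concat_eq_append, List.nil_append,
        List.cons_append, List.map_cons, List.map_nil, List.prod_cons, List.prod_nil, mul_one]
      exact commute_swap hv (by omega) (by omega) (by omega)

/-- The action of a Coxeter group of type `A_n` on `ℕ` that permutes `0, …, n`. -/
noncomputable def permHom : W →* Equiv.Perm ℕ := cs.lift ⟨_, isLiftable_swap⟩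

lemma permHom_simple (i : Fin n) : permHom cs (cs.simple i) = Equiv.swap (i : ℕ) (i + 1) :=
  cs.lift_apply_simple isLiftable_swap i

lemma permHom_gen {k : ℕ} (h1 : 1 ≤ k) (h2 : k ≤ n) :
    permHom cs (gen cs k) = Equiv.swap (k - 1) k := by
  rw [gen_eq cs h1 h2, permHom_simple]
  congr
  simp only
  omega

lemma simple_injective_A : Function.Injective cs.simple := by
  intro i j h
  have h1 := congrArg (fun w ↦ permHom cs w i) h
  simp only [permHom_simple, Equiv.swap_apply_left, Equiv.swap_apply_def] at h1
  split_ifs at h1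
  all_goals first | exact Fin.ext (by assumption) | omega

/-- An element of a Coxeter group of type `A_n` that reverses an interval of length `k` has length
at least `k (k + 1) / 2`. -/
theorem le_two_mul_length_of_reverse {w : W} (p k : ℕ) (hp : p + k ≤ n)
    (h : ∀ a ≤ k, permHom cs w (p + a) = p + k - a) : k * (k + 1) ≤ 2 * cs.length w := by
  set P : Finset (ℕ × ℕ) := (Finset.range (n + 1) ×ˢ Finset.range (n + 1)).filter
    fun z ↦ z.1 < z.2 with hP
  -- Among the increasing pairs, the transposition of `i` and `i + 1` inverts only `(i, i + 1)`.
  have h1 := card_filter_le_mul_length cs (permHom cs) P 1 (by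
    intro i
    apply (Finset.card_le_card (t := {((i : ℕ), (i : ℕ) + 1)}) _).trans_eq (by simp)
    rintro ⟨x, y⟩ hz
    simp only [hP, Finset.mem_filter, Finset.mem_product, Finset.mem_range, Prod.map_apply,
      permHom_simple, Equiv.swap_apply_def] at hz
    rw [Finset.mem_singleton, Prod.mk.injEq]
    have := i.2
    split_ifs at hz <;> omega) w
  -- Every pair `(p + a, p + b)` with `a < b ≤ k` is inverted; for fixed `b` there are `b` of them.
  have h2 : (∑ b ∈ Finset.range (k + 1), b) ≤
      (P.filter fun z ↦ Prod.map (permHom cs w) (permHom cs w) z ∉ P).card := by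
    have e : (∑ b ∈ Finset.range (k + 1), b) =
        ((Finset.range (k + 1)).sigma fun b ↦ Finset.range b).card := by
      simp [Finset.card_sigma]
    rw [e]
    apply Finset.card_le_card_of_injOn fun z ↦ (p + z.2, p + z.1)
    · rintro ⟨b, a⟩ hz
      simp only [Finset.coe_sigma, Set.mem_sigma_iff, Finset.mem_coe, Finset.mem_range] at hz
      simp only [hP, Finset.coe_filter, Set.mem_ofPred_eq, Finset.mem_filter, Finset.mem_product,
        Finset.mem_range, Prod.map_apply, h b (by omega), h a (by omega)]
      omega
    · rintro ⟨b, a⟩ - ⟨b', a'⟩ - hz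
      simp only [Prod.mk.injEq, add_right_inj] at hz
      obtain ⟨rfl, rfl⟩ := hz
      rfl
  have h3 := Finset.sum_range_id_mul_two (k + 1)
  rw [Nat.add_sub_cancel] at h3
  nlinarith

lemma gen_comm_A {i j : ℕ} (h : i + 1 < j) : Commute (gen cs i) (gen cs j) := by
  by_cases hi : 1 ≤ i ∧ i ≤ n
  · by_cases hj : 1 ≤ j ∧ j ≤ n
    · rw [gen_eq cs hi.1 hi.2, gen_eq cs hj.1 hj.2]
      apply commute_simple
      rw [matrixA_apply, if_neg (by rw [Fin.mk.injEq]; omega), if_neg]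
      simp only
      omega
    · simp [gen, hj]
  · simp [gen, hi]

lemma matrixA_eq_three {i : ℕ} (h1 : 1 ≤ i) (h2 : i + 1 ≤ n) :
    CoxeterMatrix.A n ⟨i - 1, by omega⟩ ⟨i + 1 - 1, by omega⟩ = 3 := by
  rw [matrixA_apply, if_neg (by rw [Fin.mk.injEq]; omega), if_pos]
  simp only
  omega

lemma gen_braid_A {i : ℕ} (h1 : 1 ≤ i) (h2 : i + 1 ≤ n) :
    gen cs i * gen cs (i + 1) * gen cs i = gen cs (i + 1) * gen cs i * gen cs (i + 1) := by
  rw [gen_eq cs h1 (by omega), gen_eq cs (by omega) h2]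
  exact braid_simple cs (matrixA_eq_three h1 h2)

lemma isChain_gen_A {p m : ℕ} (hp : 1 ≤ p) (hm : p + m ≤ n + 1) :
    IsChain (fun i ↦ gen cs (p + i)) m where
  sq i _ := gen_mul_self cs _
  braid i hi := gen_braid_A cs (by omega) (by omega)
  comm i j hij hj := (gen_comm_A cs (by omega)).eq

lemma length_braid_gen_A {i : ℕ} (h1 : 1 ≤ i) (h2 : i + 1 ≤ n) :
    cs.length (gen cs i * gen cs (i + 1) * gen cs i) = 3 := by
  rw [gen_eq cs h1 (by omega), gen_eq cs (by omega) h2]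
  exact length_braid_three cs (simple_injective_A cs) (matrixA_eq_three h1 h2)

end ModelA

/-! ### Partitions into orbits of an involution -/

section Orbits

lemma isPartition_orbitPartition {B : Type*} {σ : B → B} (hσ : Function.Involutive σ) :
    Setoid.IsPartition (orbitPartition σ) := by
  constructor
  · rintro ⟨b, hb⟩
    have : b ∈ ({b, σ b} : Set B) := by simp
    simp only at hb
    rw [hb] at this
    exact this
  · intro a
    refine ⟨{a, σ a}, ⟨⟨a, rfl⟩, by simp⟩, ?_⟩
    rintro _ ⟨⟨b, rfl⟩, hab⟩
    rcases hab with rfl | hab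
    · rfl
    · rw [Set.mem_singleton_iff] at hab
      subst hab
      simp only [hσ b]
      exact Set.pair_comm _ _

lemma range_eq_orbitPartition {B B' : Type*} {σ : B → B} (hσ : Function.Involutive σ)
    (e : B' → B) (he : ∀ b, ∃ i, e i = b ∨ e i = σ b) :
    (Set.range fun i ↦ ({e i, σ (e i)} : Set B)) = orbitPartition σ := by
  apply Set.Subset.antisymm
  · rintro _ ⟨i, rfl⟩
    exact ⟨e i, rfl⟩
  · rintro _ ⟨b, rfl⟩
    obtain ⟨i, h | h⟩ := he b
    · exact ⟨i, by simp [h]⟩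
    · refine ⟨i, ?_⟩
      simp only [h, hσ b]
      exact Set.pair_comm _ _

end Orbits

/-! ### A criterion for unfoldings of type `B_n` -/

section TypeB

variable {n : ℕ}

lemma matrixB_apply (i j : Fin n) : CoxeterMatrix.B n i j =
    if i = j then 1
      else (if (i : ℕ) = n - 1 ∧ (j : ℕ) = n - 2 ∨ (j : ℕ) = n - 1 ∧ (i : ℕ) = n - 2 then 4
        else (if (j : ℕ) + 1 = i ∨ (i : ℕ) + 1 = j then 3 else 2)) := rfl

lemma matrixB_eq_four {i j : Fin n} (h : (i : ℕ) + 1 = j) (hj : (j : ℕ) + 1 = n) :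
    CoxeterMatrix.B n i j = 4 := by
  rw [matrixB_apply, if_neg (by rw [Fin.ext_iff]; omega), if_pos (by omega)]

lemma matrixB_eq_three {i j : Fin n} (h : (i : ℕ) + 1 = j) (hj : (j : ℕ) + 1 < n) :
    CoxeterMatrix.B n i j = 3 := by
  rw [matrixB_apply, if_neg (by rw [Fin.ext_iff]; omega), if_neg (by omega), if_pos (by omega)]

lemma matrixB_eq_two {i j : Fin n} (h : (i : ℕ) + 1 < j) : CoxeterMatrix.B n i j = 2 := by
  rw [matrixB_apply, if_neg (by rw [Fin.ext_iff]; omega), if_neg (by omega), if_neg (by omega)]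

/-- A symmetric relation on the nodes of the diagram `B_n` may be checked on the three kinds of
edges. -/
lemma matrixB_cases {p : Fin n → Fin n → Prop} (hsymm : ∀ i j, p i j → p j i)
    (h2 : ∀ i j : Fin n, (i : ℕ) + 1 < j → p i j)
    (h3 : ∀ i j : Fin n, (i : ℕ) + 1 = j → (j : ℕ) + 1 < n → p i j)
    (h4 : ∀ i j : Fin n, (i : ℕ) + 1 = j → (j : ℕ) + 1 = n → p i j) (i j : Fin n) (hij : i ≠ j) :
    p i j := by
  have hv : (i : ℕ) ≠ j := fun h ↦ hij (Fin.ext h)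
  have key : ∀ i j : Fin n, (i : ℕ) < j → p i j := by
    intro i j h
    rcases Nat.lt_or_ge (i + 1) j with h' | h'
    · exact h2 i j h'
    · rcases Nat.lt_or_ge (j + 1) n with h'' | h''
      · exact h3 i j (by omega) h''
      · exact h4 i j (by omega) (by omega)
  rcases Nat.lt_or_gt_of_ne hv with h | h
  · exact key i j h
  · exact hsymm _ _ (key j i h)

variable {B W W' : Type*} [Group W] [Group W'] {M : CoxeterMatrix B}

/-- Elements of a Coxeter group satisfying the relations of type `B_n` define an unfolding if
the relevant lengths add up. -/
theorem exists_isUnfolding_B (r : CoxeterSystem (CoxeterMatrix.B n) W') (cs : CoxeterSystem M W)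
    (hinj : Function.Injective cs.simple) (I : Fin n → Set B) (f : Fin n → W)
    (hdisj : ∀ i j, i ≠ j → Disjoint (I i) (I j))
    (hfin : ∀ i, Finite (parabolic cs (I i)))
    (hmem : ∀ i, f i ∈ parabolic cs (I i)) (hsq : ∀ i, f i * f i = 1)
    (hdesc : ∀ i, ∀ b ∈ I i, cs.length (f i * cs.simple b) < cs.length (f i))
    (hcomm : ∀ i j : Fin n, (i : ℕ) + 1 < j → Commute (f i) (f j))
    (hbraid : ∀ i j : Fin n, (i : ℕ) + 1 = j → (j : ℕ) + 1 < n →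
      f i * f j * f i = f j * f i * f j ∧ cs.length (f i) = cs.length (f j) ∧
      cs.length (f i) + cs.length (f j) + cs.length (f i) ≤ cs.length (f i * f j * f i))
    (hfour : ∀ i j : Fin n, (i : ℕ) + 1 = j → (j : ℕ) + 1 = n →
      f i * f j * f i * f j = f j * f i * f j * f i ∧
      2 * (cs.length (f i) + cs.length (f j)) ≤ cs.length (f i * f j * f i * f j)) :
    ∃ φ : W' →* W, (∀ i, φ (r.simple i) = f i) ∧ IsUnfolding r cs I φ := by
  have hlift : (CoxeterMatrix.B n).IsLiftable f := by
    apply isLiftable_of_braid hsq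
    apply matrixB_cases
    · intro i j h; exact h.symm
    · intro i j h
      rw [CoxeterSystem.braidWord, CoxeterSystem.braidWord, (CoxeterMatrix.B n).symmetric j i,
        matrixB_eq_two h]
      simpa [CoxeterSystem.alternatingWord] using (hcomm i j h).eq
    · intro i j h hj
      rw [CoxeterSystem.braidWord, CoxeterSystem.braidWord, (CoxeterMatrix.B n).symmetric j i,
        matrixB_eq_three h hj]
      simpa [CoxeterSystem.alternatingWord, mul_assoc] using (hbraid i j h hj).1.symm
    · intro i j h hj
      rw [CoxeterSystem.braidWord, CoxeterSystem.braidWord, (CoxeterMatrix.B n).symmetric j i,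
        matrixB_eq_four h hj]
      simpa [CoxeterSystem.alternatingWord, mul_assoc] using (hfour i j h hj).1
  have hφ : ∀ i, r.lift ⟨f, hlift⟩ (r.simple i) = f i := r.lift_apply_simple hlift
  refine ⟨r.lift ⟨f, hlift⟩, hφ, ?_⟩
  generalize r.lift ⟨f, hlift⟩ = φ at hφ
  refine ⟨hfin, fun i ↦ by rw [hφ]; exact hmem i, fun i ↦ by rw [hφ]; exact hdesc i, ?_, ?_⟩
  · apply matrixB_cases
    · intro i j h; rwa [(CoxeterMatrix.B n).symmetric]
    · intro i j h; rw [matrixB_eq_two h]; norm_num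
    · intro i j h hj; rw [matrixB_eq_three h hj]; norm_num
    · intro i j h hj; rw [matrixB_eq_four h hj]; norm_num
  -- The estimate is proved for both orders of `i` and `j` at once, so that the relation is
  -- symmetric as `matrixB_cases` requires. The two braid words have the same product, hence one
  -- length computation serves both.
  · have key : ∀ i j : Fin n, i ≠ j →
        unfoldedLength r cs φ (CoxeterSystem.braidWord (CoxeterMatrix.B n) i j) ≤
          cs.length (φ (r.wordProd (CoxeterSystem.braidWord (CoxeterMatrix.B n) i j))) ∧
        unfoldedLength r cs φ (CoxeterSystem.braidWord (CoxeterMatrix.B n) j i) ≤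
          cs.length (φ (r.wordProd (CoxeterSystem.braidWord (CoxeterMatrix.B n) j i))) := by
      apply matrixB_cases
      · intro i j h; exact h.symm
      · intro i j h
        rw [← r.wordProd_braidWord_eq i j]
        have h1 := length_mul_of_disjoint cs hinj
          (hdisj i j (by rintro rfl; omega)) (hmem i) (hmem j)
        rw [CoxeterSystem.braidWord, CoxeterSystem.braidWord, (CoxeterMatrix.B n).symmetric j i,
          matrixB_eq_two h]
        simp only [CoxeterSystem.alternatingWord, List.concat_eq_append, List.nil_append,
          List.cons_append, unfoldedLength_cons, unfoldedLength_nil, hφ, r.wordProd_cons,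
          r.wordProd_nil, mul_one, map_mul, h1]
        omega
      · intro i j h hj
        rw [← r.wordProd_braidWord_eq i j]
        obtain ⟨h1, h2, h3⟩ := hbraid i j h hj
        rw [CoxeterSystem.braidWord, CoxeterSystem.braidWord, (CoxeterMatrix.B n).symmetric j i,
          matrixB_eq_three h hj]
        simp only [CoxeterSystem.alternatingWord, List.concat_eq_append, List.nil_append,
          List.cons_append, unfoldedLength_cons, unfoldedLength_nil, hφ, r.wordProd_cons,
          r.wordProd_nil, mul_one, map_mul, ← mul_assoc, ← h1]
        omega
      · intro i j h hj
        rw [← r.wordProd_braidWord_eq i j]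
        obtain ⟨h1, h2⟩ := hfour i j h hj
        rw [CoxeterSystem.braidWord, CoxeterSystem.braidWord, (CoxeterMatrix.B n).symmetric j i,
          matrixB_eq_four h hj]
        simp only [CoxeterSystem.alternatingWord, List.concat_eq_append, List.nil_append,
          List.cons_append, unfoldedLength_cons, unfoldedLength_nil, hφ, r.wordProd_cons,
          r.wordProd_nil, mul_one, map_mul, ← mul_assoc]
        omega
    intro i j hij
    exact (key i j hij).1

end TypeB

lemma commute_of_mem_closure {G : Type*} [Group G] {S : Set G} {g z : G}
    (hz : z ∈ Subgroup.closure S) (h : ∀ y ∈ S, Commute g y) : Commute g z := by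
  have : Subgroup.closure S ≤ Subgroup.centralizer {g} := by
    rw [Subgroup.closure_le]
    intro y hy
    rw [SetLike.mem_coe, Subgroup.mem_centralizer_singleton_iff]
    exact (h y hy).eq.symm
  exact (Subgroup.mem_centralizer_singleton_iff.1 (this hz)).symm

/-! ### The foldings of `A_{2n-1}` and `A_{2n}` onto `B_n` -/

section FoldA

variable {n N : ℕ} {W W' : Type*} [Group W] [Group W']

/-- Here `z` reverses the middle interval from `n - 1` to `N + 1 - n`, and `c` exchanges each end of
it with its outer neighbour. Both alternating products of four factors reverse the enlarged
interval, as one sees on its four outer points; for `N = 2 n` the centre `n` is fixed throughout. -/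
lemma reverse_of_alternating (hn : 2 ≤ n) (hN : N + 1 = 2 * n ∨ N = 2 * n) {z c : ℕ → ℕ}
    (hz : ∀ x, z x = if n ≤ x + 1 ∧ x + n ≤ N + 1 then N - x else x)
    (hc : ∀ x, c x = if x + 2 = n then x + 1 else if x + 1 = n then x - 1 else
      if x + n = N + 1 then x + 1 else if x + n = N + 2 then x - 1 else x) {x : ℕ}
    (h1 : n ≤ x + 2) (h2 : x + n ≤ N + 2) : c (z (c (z x))) = N - x ∧ z (c (z (c x))) = N - x := by
  have z0 : z (n - 2) = n - 2 := by rw [hz, if_neg (by omega)]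
  have z1 : z (n - 1) = N + 1 - n := by rw [hz, if_pos (by omega)]; omega
  have z2 : z (N + 1 - n) = n - 1 := by rw [hz, if_pos (by omega)]; omega
  have z3 : z (N + 2 - n) = N + 2 - n := by rw [hz, if_neg (by omega)]
  have c0 : c (n - 2) = n - 1 := by rw [hc, if_pos (by omega)]; omega
  have c1 : c (n - 1) = n - 2 := by rw [hc, if_neg (by omega), if_pos (by omega)]; omega
  have c2 : c (N + 1 - n) = N + 2 - n := by
    rw [hc, if_neg (by omega), if_neg (by omega), if_pos (by omega)]; omega
  have c3 : c (N + 2 - n) = N + 1 - n := by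
    rw [hc, if_neg (by omega), if_neg (by omega), if_neg (by omega), if_pos (by omega)]; omega
  have h : x = n - 2 ∨ x = n - 1 ∨ x = N + 1 - n ∨ x = N + 2 - n ∨ (x = n ∧ N = 2 * n) := by
    omega
  rcases h with rfl | rfl | rfl | rfl | ⟨rfl, h⟩
  · rw [z0, c0, z1, c2]; omega
  · rw [z1, c2, z3, c3, c1, z0, c0, z1]; omega
  · rw [z2, c1, z0, c0, c2, z3, c3, z2]; omega
  · rw [z3, c3, z2, c1]; omega
  · have zx : z x = x := by rw [hz, if_pos (by omega)]; omega
    have cx : c x = x := by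
      rw [hc, if_neg (by omega), if_neg (by omega), if_neg (by omega), if_neg (by omega)]
    rw [zx, cx, zx, cx]; omega

/-- The foldings of `A_N`, with `N = 2 n - 1` or `N = 2 n`, onto `B_n`. The element `z` is the
longest one of the parabolic subgroup generated by `s_n, …, s_{N + 1 - n}`. -/
theorem exists_isUnfolding_B_A (hn : 1 ≤ n) (hN : N + 1 = 2 * n ∨ N = 2 * n)
    (r : CoxeterSystem (CoxeterMatrix.B n) W') (s : CoxeterSystem (CoxeterMatrix.A N) W) (z : W)
    (hz_mem : z ∈ Subgroup.closure (gen s '' Set.Icc n (N + 1 - n))) (hz_sq : z * z = 1)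
    (hz_perm : ∀ x, permHom s z x = if n ≤ x + 1 ∧ x + n ≤ N + 1 then N - x else x)
    (hz_len : 2 * s.length z = (N + 2 - 2 * n) * (N + 3 - 2 * n))
    (hz_desc : ∀ k, n ≤ k → k + n ≤ N + 1 → s.length (z * gen s k) < s.length z) :
    ∃ φ : W' →* W, (∀ i, 1 ≤ i → i < n → φ (gen r i) = gen s i * gen s (N + 1 - i)) ∧
      φ (gen r n) = z ∧
      IsUnfolding r s (fun i : Fin n ↦ {Fin.castLE (by omega) i, (Fin.castLE (by omega) i).rev})
        φ := by
  have hinj := simple_injective_A s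
  set f : Fin n → W := fun i ↦ if (i : ℕ) + 1 < n then gen s (i + 1) * gen s (N - i) else z
    with hf
  have f_lt : ∀ i : Fin n, (i : ℕ) + 1 < n → f i = gen s (i + 1) * gen s (N - i) :=
    fun i hi ↦ if_pos hi
  have f_last : ∀ i : Fin n, (i : ℕ) + 1 = n → f i = z := fun i hi ↦ if_neg (by omega)
  obtain ⟨φ, hφ, hU⟩ := exists_isUnfolding_B r s hinj
    (fun i : Fin n ↦ {Fin.castLE (by omega) i, (Fin.castLE (by omega) i).rev}) f
    (by
      intro i j hij
      have hv : (i : ℕ) ≠ j := fun h ↦ hij (Fin.ext h)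
      rw [Set.disjoint_left]
      intro b hb hb'
      simp only [Set.mem_insert_iff, Set.mem_singleton_iff, Fin.ext_iff, Fin.val_castLE,
        Fin.val_rev] at hb hb'
      omega)
    (by
      intro i
      apply finite_parabolic_pair
      rw [matrixA_apply]
      split_ifs <;> norm_num)
    (by
      intro i
      rcases Nat.lt_or_ge (i + 1) n with hi | hi
      · rw [f_lt i hi]
        apply mul_mem <;> apply gen_mem_parabolic <;> intro b hb <;>
          simp only [Set.mem_insert_iff, Set.mem_singleton_iff, Fin.ext_iff, Fin.val_castLE,
            Fin.val_rev] <;> omega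
      · rw [f_last i (by omega)]
        refine (Subgroup.closure_le _).2 ?_ hz_mem
        rintro _ ⟨k, hk, rfl⟩
        rw [Set.mem_Icc] at hk
        apply gen_mem_parabolic
        intro b hb
        simp only [Set.mem_insert_iff, Set.mem_singleton_iff, Fin.ext_iff, Fin.val_castLE,
            Fin.val_rev]
        omega)
    (by
      intro i
      rcases Nat.lt_or_ge (i + 1) n with hi | hi
      · have hc : Commute (gen s (i + 1)) (gen s (N - i)) := gen_comm_A s (by omega)
        rw [f_lt i hi]
        calc _ = gen s (i + 1) * (gen s (N - i) * gen s (i + 1)) * gen s (N - i) := by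
              simp only [mul_assoc]
          _ = 1 := by
              rw [← hc.eq, ← mul_assoc, gen_mul_self, one_mul, gen_mul_self]
      · rw [f_last i (by omega)]
        exact hz_sq)
    (by
      intro i b hb
      simp only [Set.mem_insert_iff, Set.mem_singleton_iff, Fin.ext_iff, Fin.val_castLE,
            Fin.val_rev] at hb
      rw [simple_eq_gen]
      rcases Nat.lt_or_ge (i + 1) n with hi | hi
      · have hc : Commute (gen s (i + 1)) (gen s (N - i)) := gen_comm_A s (by omega)
        rw [f_lt i hi, length_gen_mul_gen s hinj (by omega) (by omega) (by omega)]
        rcases hb with hb | hb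
        · rw [hb, hc.eq, mul_assoc, gen_mul_self, mul_one]
          exact (length_gen_le s _).trans_lt (by norm_num)
        · rw [show (b : ℕ) + 1 = N - i by omega, mul_assoc, gen_mul_self, mul_one]
          exact (length_gen_le s _).trans_lt (by norm_num)
      · rw [f_last i (by omega)]
        exact hz_desc _ (by omega) (by omega))
    (by
      intro i j hij
      have hj := j.2
      rw [f_lt i (by omega)]
      rcases Nat.lt_or_ge (j + 1) n with hj | hj
      · rw [f_lt j hj]
        exact ((gen_comm_A s (by omega)).mul_right (gen_comm_A s (by omega))).mul_left
          ((gen_comm_A s (by omega)).symm.mul_right (gen_comm_A s (by omega)).symm)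
      · rw [f_last j (by omega)]
        apply commute_of_mem_closure hz_mem
        rintro _ ⟨k, hk, rfl⟩
        rw [Set.mem_Icc] at hk
        exact (gen_comm_A s (by omega)).mul_left (gen_comm_A s (by omega)).symm)
    (by
      intro i j hij hj
      rw [f_lt i (by omega), f_lt j hj, ← hij]
      have e : N - i = N - (i + 1) + 1 := by omega
      have c1 : Commute (gen s (i + 1)) (gen s (N - i)) := gen_comm_A s (by omega)
      have c2 : Commute (gen s (i + 1 + 1)) (gen s (N - (i + 1))) := gen_comm_A s (by omega)
      have c3 : Commute (gen s (i + 1)) (gen s (N - (i + 1))) := gen_comm_A s (by omega)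
      have c4 : Commute (gen s (N - i)) (gen s (i + 1 + 1)) := (gen_comm_A s (by omega)).symm
      have b1 := gen_braid_A s (i := i + 1) (by omega) (by omega)
      have b2 : gen s (N - i) * gen s (N - (i + 1)) * gen s (N - i) =
          gen s (N - (i + 1)) * gen s (N - i) * gen s (N - (i + 1)) := by
        rw [e]
        exact (gen_braid_A s (by omega) (by omega)).symm
      refine ⟨braid_mul_of_commute c1 c2 c3 c4 b1 b2, ?_, ?_⟩
      · rw [length_gen_mul_gen s hinj (by omega) (by omega) (by omega),
          length_gen_mul_gen s hinj (by omega) (by omega) (by omega)]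
      · rw [length_gen_mul_gen s hinj (by omega) (by omega) (by omega),
          length_gen_mul_gen s hinj (by omega) (by omega) (by omega)]
        -- The two mirror-image copies of `A_2` separate into factors with disjoint supports, of
        -- length `3` each.
        have e1 : gen s (i + 1) * gen s (N - i) * (gen s (i + 1 + 1) * gen s (N - (i + 1))) *
            (gen s (i + 1) * gen s (N - i)) =
            (gen s (i + 1) * gen s (i + 1 + 1) * gen s (i + 1)) *
            (gen s (N - i) * gen s (N - (i + 1)) * gen s (N - i)) := by
          have c5 : Commute (gen s (N - i) * gen s (N - (i + 1))) (gen s (i + 1)) :=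
            c1.symm.mul_left c3.symm
          calc _ = gen s (i + 1) * (gen s (N - i) * gen s (i + 1 + 1)) * gen s (N - (i + 1)) *
                gen s (i + 1) * gen s (N - i) := by simp only [mul_assoc]
            _ = gen s (i + 1) * gen s (i + 1 + 1) *
                ((gen s (N - i) * gen s (N - (i + 1))) * gen s (i + 1)) * gen s (N - i) := by
              rw [c4.eq]; simp only [mul_assoc]
            _ = _ := by rw [c5.eq]; simp only [mul_assoc]
        have d1 : gen s (i + 1) * gen s (i + 1 + 1) * gen s (i + 1) ∈
            parabolic s {b : Fin N | (b : ℕ) + 1 < n} := by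
          refine mul_mem (mul_mem ?_ ?_) ?_ <;> apply gen_mem_parabolic <;> intro b hb <;>
            simp only [Set.mem_ofPred_eq] <;> omega
        have d2 : gen s (N - i) * gen s (N - (i + 1)) * gen s (N - i) ∈
            parabolic s {b : Fin N | n ≤ (b : ℕ) + 1} := by
          refine mul_mem (mul_mem ?_ ?_) ?_ <;> apply gen_mem_parabolic <;> intro b hb <;>
            simp only [Set.mem_ofPred_eq] <;> omega
        rw [e1, length_mul_of_disjoint s hinj _ d1 d2, length_braid_gen_A s (by omega) (by omega),
          b2, e, length_braid_gen_A s (by omega) (by omega)]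
        rw [Set.disjoint_left]
        intro b hb hb'
        simp only [Set.mem_ofPred_eq] at hb hb'
        omega)
    (by
      intro i j hij hj
      have hn2 : 2 ≤ n := by omega
      -- The number of nodes from `n - 1` to `N + 2 - n`, namely `3` or `4`. Both sides of the
      -- relation reverse the `m + 1` points these nodes act on, so both are the longest element of
      -- this `A_m`, of length `6 = 2 (2 + 1)` or `10 = 2 (2 + 3)`.
      obtain ⟨m, hm⟩ : ∃ m, m = N + 4 - 2 * n := ⟨_, rfl⟩
      rw [f_lt i (by omega), f_last j hj, show (i : ℕ) + 1 = n - 1 by omega,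
        show N - (i : ℕ) = N + 2 - n by omega, length_gen_mul_gen s hinj (by omega) (by omega) (by omega)]
      set c := gen s (n - 1) * gen s (N + 2 - n) with hc
      have hc_perm : ∀ x, permHom s c x = if x + 2 = n then x + 1 else if x + 1 = n then x - 1 else
          if x + n = N + 1 then x + 1 else if x + n = N + 2 then x - 1 else x := by
        intro x
        rw [hc, map_mul, permHom_gen s (by omega) (by omega), permHom_gen s (by omega) (by omega),
          Equiv.Perm.mul_apply, Equiv.swap_apply_def (N + 2 - n - 1)]
        split_ifs <;> rw [Equiv.swap_apply_def] <;> split_ifs <;> omega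
      have hrev : ∀ x, n ≤ x + 2 → x + n ≤ N + 2 →
          permHom s (c * z * c * z) x = N - x ∧ permHom s (z * c * z * c) x = N - x := by
        intro x h1 h2
        simp only [map_mul, Equiv.Perm.mul_apply]
        exact reverse_of_alternating hn2 hN hz_perm hc_perm h1 h2
      have hl1 : m * (m + 1) ≤ 2 * s.length (c * z * c * z) :=
        le_two_mul_length_of_reverse s (n - 2) m (by omega) fun a ha ↦ by
          rw [(hrev _ (by omega) (by omega)).1]; omega
      have hl2 : m * (m + 1) ≤ 2 * s.length (z * c * z * c) :=
        le_two_mul_length_of_reverse s (n - 2) m (by omega) fun a ha ↦ by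
          rw [(hrev _ (by omega) (by omega)).2]; omega
      have hcm : c ∈ Subgroup.closure ((fun i ↦ gen s (n - 1 + i)) '' Set.Iio m) := by
        refine mul_mem (Subgroup.subset_closure ⟨0, ?_, rfl⟩)
          (Subgroup.subset_closure ⟨m - 1, ?_, ?_⟩)
        · rw [Set.mem_Iio]; omega
        · rw [Set.mem_Iio]; omega
        · simp only; congr 1; omega
      have hzm : z ∈ Subgroup.closure ((fun i ↦ gen s (n - 1 + i)) '' Set.Iio m) := by
        refine (Subgroup.closure_le _).2 ?_ hz_mem
        rintro _ ⟨k, hk, rfl⟩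
        rw [Set.mem_Icc] at hk
        refine Subgroup.subset_closure ⟨k - (n - 1), ?_, ?_⟩
        · rw [Set.mem_Iio]; omega
        · simp only; congr 1; omega
      refine ⟨(isChain_gen_A s (p := n - 1) (m := m) (by omega) (by omega)).eq_of_length s
        (fun i hi ↦ ⟨_, gen_eq s (by omega) (by omega)⟩)
        (mul_mem (mul_mem (mul_mem hcm hzm) hcm) hzm)
        (mul_mem (mul_mem (mul_mem hzm hcm) hzm) hcm) hl1 hl2, ?_⟩
      rcases hN with hN | hN
      · rw [show N + 2 - 2 * n = 1 by omega, show N + 3 - 2 * n = 2 by omega] at hz_len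
        rw [show m = 3 by omega] at hl1
        omega
      · rw [show N + 2 - 2 * n = 2 by omega, show N + 3 - 2 * n = 3 by omega] at hz_len
        rw [show m = 4 by omega] at hl1
        omega)
  refine ⟨φ, ?_, ?_, hU⟩
  · intro i h1 h2
    rw [gen_eq r h1 h2.le, hφ, f_lt _ (by simp only; omega)]
    simp only
    rw [show i - 1 + 1 = i by omega, show N - (i - 1) = N + 1 - i by omega]
  · rw [gen_eq r hn le_rfl, hφ, f_last _ (by simp only; omega)]

/-- The folding of `A_{2n-1}` onto `B_n`. -/
theorem exists_isUnfolding_B_A_odd (hn : 1 ≤ n) (r : CoxeterSystem (CoxeterMatrix.B n) W')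
    (s : CoxeterSystem (CoxeterMatrix.A (2 * n - 1)) W) :
    ∃ φ : W' →* W, (∀ i, 1 ≤ i → i < n → φ (gen r i) = gen s i * gen s (2 * n - i)) ∧
      φ (gen r n) = gen s n ∧
      IsUnfolding r s (fun i : Fin n ↦ {Fin.castLE (by omega) i, (Fin.castLE (by omega) i).rev})
        φ := by
  obtain ⟨φ, h1, h2, h3⟩ := exists_isUnfolding_B_A hn (by omega) r s (gen s n)
    (Subgroup.subset_closure ⟨n, by rw [Set.mem_Icc]; omega, rfl⟩) (gen_mul_self s n)
    (by
      intro x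
      rw [permHom_gen s hn (by omega), Equiv.swap_apply_def]
      split_ifs <;> omega)
    (by
      rw [length_gen s hn (by omega), show 2 * n - 1 + 2 - 2 * n = 1 by omega,
        show 2 * n - 1 + 3 - 2 * n = 2 by omega])
    (by
      intro k hk1 hk2
      rw [show k = n by omega, gen_mul_self, s.length_one, length_gen s hn (by omega)]
      norm_num)
  refine ⟨φ, fun i hi1 hi2 ↦ ?_, h2, h3⟩
  rw [h1 i hi1 hi2, show 2 * n - 1 + 1 - i = 2 * n - i by omega]

/-- The folding of `A_{2n}` onto `B_n`. -/
theorem exists_isUnfolding_B_A_even (hn : 1 ≤ n) (r : CoxeterSystem (CoxeterMatrix.B n) W')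
    (s : CoxeterSystem (CoxeterMatrix.A (2 * n)) W) :
    ∃ φ : W' →* W, (∀ i, 1 ≤ i → i < n → φ (gen r i) = gen s i * gen s (2 * n + 1 - i)) ∧
      φ (gen r n) = gen s n * gen s (n + 1) * gen s n ∧
      IsUnfolding r s (fun i : Fin n ↦ {Fin.castLE (by omega) i, (Fin.castLE (by omega) i).rev})
        φ := by
  have hl := length_braid_gen_A s (i := n) hn (by omega)
  have hb := gen_braid_A s (i := n) hn (by omega)
  apply exists_isUnfolding_B_A hn (by omega) r s (gen s n * gen s (n + 1) * gen s n)
  · have h1 : gen s n ∈ Subgroup.closure (gen s '' Set.Icc n (2 * n + 1 - n)) :=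
      Subgroup.subset_closure ⟨n, by rw [Set.mem_Icc]; omega, rfl⟩
    have h2 : gen s (n + 1) ∈ Subgroup.closure (gen s '' Set.Icc n (2 * n + 1 - n)) :=
      Subgroup.subset_closure ⟨n + 1, by rw [Set.mem_Icc]; omega, rfl⟩
    exact mul_mem (mul_mem h1 h2) h1
  · simp only [mul_assoc, gen_mul_gen_cancel, gen_mul_self]
  · intro x
    rw [map_mul, map_mul, permHom_gen s hn (by omega), permHom_gen s (by omega) (by omega),
      Nat.add_sub_cancel, Equiv.Perm.mul_apply, Equiv.Perm.mul_apply,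
      Equiv.swap_apply_def (n - 1) n x]
    split_ifs <;> rw [Equiv.swap_apply_def n] <;> split_ifs <;> (try omega) <;>
      rw [Equiv.swap_apply_def] <;> split_ifs <;> omega
  · rw [hl, show 2 * n + 2 - 2 * n = 2 by omega, show 2 * n + 3 - 2 * n = 3 by omega]
  · intro k hk1 hk2
    rw [hl]
    have : k = n ∨ k = n + 1 := by omega
    have hle : ∀ a b, s.length (gen s a * gen s b) < 3 := by
      intro a b
      have h1 := s.length_mul_le (gen s a) (gen s b)
      have h2 := length_gen_le s a
      have h3 := length_gen_le s b
      omega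
    rcases this with rfl | rfl
    · rw [mul_assoc _ _ (gen s k), gen_mul_self, mul_one]
      exact hle _ _
    · rw [hb, mul_assoc _ _ (gen s (n + 1)), gen_mul_self, mul_one]
      exact hle _ _

lemma exists_castLE_eq_or_eq_rev {N : ℕ} (hN : n ≤ N) (hN' : N ≤ 2 * n) (b : Fin N) :
    ∃ i : Fin n, Fin.castLE hN i = b ∨ Fin.castLE hN i = b.rev := by
  rcases Nat.lt_or_ge b n with hb | hb
  · exact ⟨⟨b, hb⟩, Or.inl (Fin.ext rfl)⟩
  · refine ⟨⟨N - 1 - b, by omega⟩, Or.inr (Fin.ext ?_)⟩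
    simp only [Fin.val_castLE, Fin.val_rev]
    omega

end FoldA

/-! ### Type `D_{n+1}` as signed permutations -/

section ModelD

variable {n : ℕ}

lemma matrixD_apply (i j : Fin (n + 1)) : matrixD (n + 1) i j =
    if i = j then 1
    else if ((i : ℕ) + 1 = j ∧ (j : ℕ) + 1 < n + 1) ∨ ((j : ℕ) + 1 = i ∧ (i : ℕ) + 1 < n + 1) ∨
        ((i : ℕ) + 2 = j ∧ (j : ℕ) + 1 = n + 1) ∨ ((j : ℕ) + 2 = i ∧ (i : ℕ) + 1 = n + 1) then 3
    else 2 := rfl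

lemma matrixD_eq_three {i j : Fin (n + 1)}
    (h : ((i : ℕ) + 1 = j ∧ (j : ℕ) < n) ∨ ((i : ℕ) + 2 = n ∧ (j : ℕ) = n)) :
    matrixD (n + 1) i j = 3 := by
  rw [matrixD_apply, if_neg (by rw [Fin.ext_iff]; omega), if_pos (by omega)]

lemma matrixD_eq_two {i j : Fin (n + 1)}
    (h : ((i : ℕ) + 1 < j ∧ (j : ℕ) < n) ∨ ((i : ℕ) < n ∧ (i : ℕ) + 2 ≠ n ∧ (j : ℕ) = n)) :
    matrixD (n + 1) i j = 2 := by
  rw [matrixD_apply, if_neg (by rw [Fin.ext_iff]; omega), if_neg (by omega)]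

/-- A symmetric relation on the nodes of the diagram `D_{n+1}` may be checked on the edges and
the non-edges separately. -/
lemma matrixD_cases {p : Fin (n + 1) → Fin (n + 1) → Prop} (hsymm : ∀ i j, p i j → p j i)
    (h2 : ∀ i j : Fin (n + 1), ((i : ℕ) + 1 < j ∧ (j : ℕ) < n) ∨
      ((i : ℕ) < n ∧ (i : ℕ) + 2 ≠ n ∧ (j : ℕ) = n) → p i j)
    (h3 : ∀ i j : Fin (n + 1),
      ((i : ℕ) + 1 = j ∧ (j : ℕ) < n) ∨ ((i : ℕ) + 2 = n ∧ (j : ℕ) = n) → p i j)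
    (i j : Fin (n + 1)) (hij : i ≠ j) : p i j := by
  have hv : (i : ℕ) ≠ j := fun h ↦ hij (Fin.ext h)
  have key : ∀ i j : Fin (n + 1), (i : ℕ) < j → p i j := by
    intro i j h
    by_cases h' : ((i : ℕ) + 1 = j ∧ (j : ℕ) < n) ∨ ((i : ℕ) + 2 = n ∧ (j : ℕ) = n)
    · exact h3 i j h'
    · exact h2 i j (by omega)
  rcases Nat.lt_or_gt_of_ne hv with h | h
  · exact key i j h
  · exact hsymm _ _ (key j i h)

/-- The signed permutation, acting on `0, …, 2 n + 1`, attached to the node `i` of `D_{n+1}`. -/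
def signedSwap (n i : ℕ) : Equiv.Perm ℕ :=
  if i < n then Equiv.swap i (i + 1) * Equiv.swap (2 * n + 1 - i) (2 * n - i)
  else Equiv.swap (n - 1) (n + 1) * Equiv.swap (n + 2) n

lemma signedSwap_of_lt {i : ℕ} (h : i < n) : signedSwap n i =
    Equiv.swap i (i + 1) * Equiv.swap (2 * n + 1 - i) (2 * n - i) := if_pos h

lemma signedSwap_self : signedSwap n n = Equiv.swap (n - 1) (n + 1) * Equiv.swap (n + 2) n :=
  if_neg (by omega)

lemma signedSwap_apply_of_lt {i : ℕ} (h : i < n) (x : ℕ) : signedSwap n i x =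
    if x = i then i + 1 else if x = i + 1 then i else if x = 2 * n - i then 2 * n + 1 - i else
      if x = 2 * n + 1 - i then 2 * n - i else x := by
  rw [signedSwap_of_lt h, Equiv.Perm.mul_apply, Equiv.swap_apply_def (2 * n + 1 - i)]
  split_ifs <;> rw [Equiv.swap_apply_def] <;> split_ifs <;> omega

lemma signedSwap_self_apply (hn : 1 ≤ n) (x : ℕ) : signedSwap n n x =
    if x + 1 = n then n + 1 else if x = n then n + 2 else if x = n + 1 then n - 1 else
      if x = n + 2 then n else x := by
  rw [signedSwap_self, Equiv.Perm.mul_apply, Equiv.swap_apply_def (n + 2)]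
  split_ifs <;> rw [Equiv.swap_apply_def] <;> split_ifs <;> omega

lemma signedSwap_preserves_of_lt {i x y : ℕ} (h : i < n) (hxy : x < y) (hy : y < 2 * n + 2)
    (hb : x + y ≠ 2 * n + 1) (h1 : ¬(x = i ∧ y = i + 1))
    (h2 : ¬(x = 2 * n - i ∧ y = 2 * n + 1 - i)) :
    signedSwap n i x < signedSwap n i y ∧ signedSwap n i y < 2 * n + 2 ∧
      signedSwap n i x + signedSwap n i y ≠ 2 * n + 1 := by
  have hx' := signedSwap_apply_of_lt h x
  have hy' := signedSwap_apply_of_lt h y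
  generalize signedSwap n i x = x' at *
  generalize signedSwap n i y = y' at *
  split_ifs at hx' <;> split_ifs at hy' <;> omega

/-- The sign change is `x ↦ 2 n + 1 - x`. The last node also inverts the mirror pairs `(n, n + 1)`
and `(n - 1, n + 2)`; leaving mirror pairs out of the count makes every generator invert at most two
pairs. -/
lemma signedSwap_self_preserves {x y : ℕ} (hn : 1 ≤ n) (hxy : x < y) (hy : y < 2 * n + 2)
    (hb : x + y ≠ 2 * n + 1) (h1 : ¬(x = n - 1 ∧ y = n + 1)) (h2 : ¬(x = n ∧ y = n + 2)) :
    signedSwap n n x < signedSwap n n y ∧ signedSwap n n y < 2 * n + 2 ∧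
      signedSwap n n x + signedSwap n n y ≠ 2 * n + 1 := by
  have hx' := signedSwap_self_apply hn x
  have hy' := signedSwap_self_apply hn y
  generalize signedSwap n n x = x' at *
  generalize signedSwap n n y = y' at *
  split_ifs at hx' <;> split_ifs at hy' <;> omega

/-- Conjugation by the first permutation exchanges the two disjoint transpositions of which the
second is the product. -/
lemma commute_signedSwap_penultimate (hn : 1 ≤ n) :
    Commute (signedSwap n (n - 1)) (signedSwap n n) := by
  set g := signedSwap n (n - 1) with hg
  have h : g * signedSwap n n * g⁻¹ = signedSwap n n := by
    have e : g * signedSwap n n * g⁻¹ = (g * Equiv.swap (n - 1) (n + 1) * g⁻¹) *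
        (g * Equiv.swap (n + 2) n * g⁻¹) := by
      rw [signedSwap_self]; group
    rw [e, ← Equiv.swap_apply_apply, ← Equiv.swap_apply_apply]
    have h1 : g (n - 1) = n := by rw [signedSwap_apply_of_lt (by omega)]; split_ifs <;> omega
    have h2 : g (n + 1) = n + 2 := by rw [signedSwap_apply_of_lt (by omega)]; split_ifs <;> omega
    have h3 : g (n + 2) = n + 1 := by rw [signedSwap_apply_of_lt (by omega)]; split_ifs <;> omega
    have h4 : g n = n - 1 := by rw [signedSwap_apply_of_lt (by omega)]; split_ifs <;> omega
    rw [h1, h2, h3, h4, signedSwap_self, Equiv.swap_comm n, Equiv.swap_comm (n + 1)]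
    exact (commute_swap (by omega) (by omega) (by omega) (by omega)).eq
  rw [mul_inv_eq_iff_eq_mul] at h
  exact h

lemma isLiftable_signedSwap (hn : 2 ≤ n) : (matrixD (n + 1)).IsLiftable
    fun i : Fin (n + 1) ↦ signedSwap n i := by
  apply isLiftable_of_braid
  · intro i
    ext x
    rw [Equiv.Perm.mul_apply, Equiv.Perm.one_apply]
    rcases Nat.lt_or_ge i n with hi | hi
    · rw [signedSwap_apply_of_lt hi x]
      split_ifs <;> rw [signedSwap_apply_of_lt hi] <;> split_ifs <;> omega
    · rw [show (i : ℕ) = n by omega, signedSwap_self_apply (by omega) x]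
      split_ifs <;> rw [signedSwap_self_apply (by omega)] <;> split_ifs <;> omega
  · apply matrixD_cases
    · intro i j h; exact h.symm
    · intro i j h
      rw [CoxeterSystem.braidWord, CoxeterSystem.braidWord, (matrixD (n + 1)).symmetric j i,
        matrixD_eq_two h]
      simp only [CoxeterSystem.alternatingWord, List.concat_eq_append, List.nil_append,
        List.cons_append, List.map_cons, List.map_nil, List.prod_cons, List.prod_nil, mul_one]
      suffices h : Commute (signedSwap n i) (signedSwap n j) from h.eq
      rcases h with h | h
      · rw [signedSwap_of_lt (by omega), signedSwap_of_lt h.2]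
        exact ((commute_swap (by omega) (by omega) (by omega) (by omega)).mul_right
          (commute_swap (by omega) (by omega) (by omega) (by omega))).mul_left
          ((commute_swap (by omega) (by omega) (by omega) (by omega)).mul_right
          (commute_swap (by omega) (by omega) (by omega) (by omega)))
      · rw [h.2.2]
        by_cases hi : (i : ℕ) = n - 1
        · rw [hi]
          exact commute_signedSwap_penultimate (by omega)
        · rw [signedSwap_of_lt (by omega), signedSwap_self]
          exact ((commute_swap (by omega) (by omega) (by omega) (by omega)).mul_right
            (commute_swap (by omega) (by omega) (by omega) (by omega))).mul_left
            ((commute_swap (by omega) (by omega) (by omega) (by omega)).mul_right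
            (commute_swap (by omega) (by omega) (by omega) (by omega)))
    · intro i j h
      rw [CoxeterSystem.braidWord, CoxeterSystem.braidWord, (matrixD (n + 1)).symmetric j i,
        matrixD_eq_three h]
      simp only [CoxeterSystem.alternatingWord, List.concat_eq_append, List.nil_append,
        List.cons_append, List.map_cons, List.map_nil, List.prod_cons, List.prod_nil, mul_one,
        ← mul_assoc]
      symm
      rcases h with h | h
      · rw [signedSwap_of_lt (by omega), signedSwap_of_lt h.2, ← h.1,
          show 2 * n + 1 - (i + 1) = 2 * n - i by omega]
        exact braid_mul_of_commute (commute_swap (by omega) (by omega) (by omega) (by omega))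
          (commute_swap (by omega) (by omega) (by omega) (by omega))
          (commute_swap (by omega) (by omega) (by omega) (by omega))
          (commute_swap (by omega) (by omega) (by omega) (by omega))
          (braid_swap (by omega) (by omega) (by omega))
          (braid_swap (by omega) (by omega) (by omega))
      · rw [signedSwap_of_lt (by omega), h.2, signedSwap_self,
          show (i : ℕ) + 1 = n - 1 by omega, show 2 * n - (i : ℕ) = n + 2 by omega]
        exact braid_mul_of_commute (commute_swap (by omega) (by omega) (by omega) (by omega))
          (commute_swap (by omega) (by omega) (by omega) (by omega))
          (commute_swap (by omega) (by omega) (by omega) (by omega))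
          (commute_swap (by omega) (by omega) (by omega) (by omega))
          (braid_swap (by omega) (by omega) (by omega))
          (braid_swap (by omega) (by omega) (by omega))

variable {W : Type*} [Group W]

/-- The action of a Coxeter group of type `D_{n+1}` by signed permutations. -/
noncomputable def signedPermHom (hn : 2 ≤ n) (cs : CoxeterSystem (matrixD (n + 1)) W) :
    W →* Equiv.Perm ℕ := cs.lift ⟨_, isLiftable_signedSwap hn⟩

lemma signedPermHom_simple (hn : 2 ≤ n) (cs : CoxeterSystem (matrixD (n + 1)) W)
    (i : Fin (n + 1)) : signedPermHom hn cs (cs.simple i) = signedSwap n i :=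
  cs.lift_apply_simple (isLiftable_signedSwap hn) i

lemma simple_injective_D (hn : 2 ≤ n) (cs : CoxeterSystem (matrixD (n + 1)) W) :
    Function.Injective cs.simple := by
  intro i j h
  by_contra hij
  revert h
  refine matrixD_cases (p := fun i j ↦ cs.simple i ≠ cs.simple j) (fun i j h ↦ h.symm)
    ?_ ?_ i j hij
  all_goals
    intro i j hij h
    have h1 := congrArg (fun w ↦ signedPermHom hn cs w i) h
    simp only [signedPermHom_simple] at h1
    have hi : (i : ℕ) < n := by omega
    rw [signedSwap_apply_of_lt hi, if_pos rfl] at h1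
    rcases Nat.lt_or_ge j n with hj | hj
    · rw [signedSwap_apply_of_lt hj] at h1
      split_ifs at h1 <;> omega
    · rw [show (j : ℕ) = n by omega, signedSwap_self_apply (by omega)] at h1
      split_ifs at h1 <;> omega

/-- An element of a Coxeter group of type `D_{n+1}` that changes the signs of two of the last three
coordinates has length at least `6`. -/
lemma six_le_length_D (hn : 2 ≤ n) (cs : CoxeterSystem (matrixD (n + 1)) W) {w : W}
    (h0 : signedPermHom hn cs w (n - 2) = n + 3) (h1 : signedPermHom hn cs w (n - 1) = n + 2)
    (h2 : signedPermHom hn cs w n = n) (h3 : signedPermHom hn cs w (n + 1) = n + 1)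
    (h4 : signedPermHom hn cs w (n + 2) = n - 1) (h5 : signedPermHom hn cs w (n + 3) = n - 2) :
    6 ≤ cs.length w := by
  set P : Finset (ℕ × ℕ) := (Finset.range (2 * n + 2) ×ˢ Finset.range (2 * n + 2)).filter
    fun z ↦ z.1 < z.2 ∧ z.1 + z.2 ≠ 2 * n + 1 with hP
  have hcard := card_filter_le_mul_length cs (signedPermHom hn cs) P 2 (by
    intro i
    rw [signedPermHom_simple]
    rcases Nat.lt_or_ge i n with hi | hi
    · apply (Finset.card_le_card
        (t := {((i : ℕ), (i : ℕ) + 1), (2 * n - (i : ℕ), 2 * n + 1 - (i : ℕ))}) _).trans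
        Finset.card_le_two
      rintro ⟨x, y⟩ hz
      simp only [hP, Finset.mem_filter, Finset.mem_product, Finset.mem_range, Prod.map_apply] at hz
      rw [Finset.mem_insert, Finset.mem_singleton, Prod.mk.injEq, Prod.mk.injEq]
      by_contra hc
      have := signedSwap_preserves_of_lt hi (x := x) (y := y) (by omega) (by omega) (by omega)
        (by omega) (by omega)
      omega
    · apply (Finset.card_le_card (t := {(n - 1, n + 1), (n, n + 2)}) _).trans
        Finset.card_le_two
      rintro ⟨x, y⟩ hz
      simp only [hP, Finset.mem_filter, Finset.mem_product, Finset.mem_range, Prod.map_apply,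
        show (i : ℕ) = n by omega] at hz
      rw [Finset.mem_insert, Finset.mem_singleton, Prod.mk.injEq, Prod.mk.injEq]
      by_contra hc
      have := signedSwap_self_preserves (n := n) (by omega) (x := x) (y := y) (by omega) (by omega)
        (by omega) (by omega) (by omega)
      omega) w
  -- The points `n - 2, …, n + 3` are the last three coordinates and their negatives, and `w` acts
  -- on them by the pattern `5, 4, 2, 3, 1, 0`.
  have hw : ∀ a : Fin 6, signedPermHom hn cs w (n - 2 + a) =
      n - 2 + (![5, 4, 2, 3, 1, 0] : Fin 6 → ℕ) a := by
    intro a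
    fin_cases a
    · simp [h0]; omega
    · simp [show n - 2 + 1 = n - 1 by omega, h1]; omega
    · simp [show n - 2 + 2 = n by omega, h2]
    · simp [show n - 2 + 3 = n + 1 by omega, h3]
    · simp [show n - 2 + 4 = n + 2 by omega, h4]; omega
    · simp [show n - 2 + 5 = n + 3 by omega, h5]
  set T : Finset (Fin 6 × Fin 6) := Finset.univ.filter
    fun z ↦ z.1 < z.2 ∧ (z.1 : ℕ) + z.2 ≠ 5 with hT
  -- Of the `15` pairs of these six points, `3` are mirror pairs. The other `12` are all inverted,
  -- at most `2` per letter, whence length at least `6`.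
  have hTcard : T.card = 12 := by decide
  have hTrev : ∀ a b : Fin 6, a < b → (a : ℕ) + b ≠ 5 →
      (![5, 4, 2, 3, 1, 0] : Fin 6 → ℕ) b < (![5, 4, 2, 3, 1, 0] : Fin 6 → ℕ) a := by decide
  have hle : T.card ≤ (P.filter fun z ↦
      Prod.map (signedPermHom hn cs w) (signedPermHom hn cs w) z ∉ P).card := by
    apply Finset.card_le_card_of_injOn fun z ↦ (n - 2 + (z.1 : ℕ), n - 2 + (z.2 : ℕ))
    · rintro ⟨a, b⟩ hz
      simp only [hT, Finset.coe_filter, Set.mem_ofPred_eq, Finset.mem_univ, true_and] at hz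
      have := hTrev a b hz.1 hz.2
      have hab : (a : ℕ) < b := hz.1
      simp only [hP, Finset.coe_filter, Set.mem_ofPred_eq, Finset.mem_filter, Finset.mem_product,
        Finset.mem_range, Prod.map_apply, hw]
      omega
    · rintro ⟨a, b⟩ - ⟨a', b'⟩ - hz
      simp only [Prod.mk.injEq, add_right_inj] at hz
      exact Prod.ext (Fin.ext hz.1) (Fin.ext hz.2)
  omega

end ModelD

/-! ### The folding of `D_{n+1}` onto `B_n` -/

section FoldD

variable {n : ℕ} {W W' : Type*} [Group W] [Group W']

lemma val_swapD (b : Fin (n + 1)) : (swapD n b : ℕ) =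
    if (b : ℕ) = n - 1 then n else if (b : ℕ) = n then n - 1 else b := by
  rw [swapD, Equiv.swap_apply_def]
  simp only [Fin.ext_iff]
  split_ifs <;> rfl

lemma involutive_swapD : Function.Involutive (swapD n) := fun b ↦ Equiv.swap_apply_self _ _ b

lemma exists_castLE_eq_or_eq_swapD (hn : 1 ≤ n) (b : Fin (n + 1)) :
    ∃ i : Fin n, Fin.castLE (by omega) i = b ∨ Fin.castLE (by omega) i = swapD n b := by
  rcases Nat.lt_or_ge b n with hb | hb
  · exact ⟨⟨b, hb⟩, Or.inl (Fin.ext rfl)⟩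
  · refine ⟨⟨n - 1, by omega⟩, Or.inr (Fin.ext ?_)⟩
    rw [val_swapD, if_neg (by omega), if_pos (by omega)]
    rfl

lemma gen_comm_D (s : CoxeterSystem (matrixD (n + 1)) W) {i j : ℕ} (h1 : 1 ≤ i) (h2 : i < j)
    (h3 : j ≤ n + 1) (h4 : (i + 1 < j ∧ j ≤ n) ∨ (i + 1 ≠ n ∧ j = n + 1)) :
    Commute (gen s i) (gen s j) := by
  rw [gen_eq s h1 (by omega), gen_eq s (by omega) h3]
  apply commute_simple
  apply matrixD_eq_two
  simp only
  omega

lemma matrixD_eq_three_of_edge {i j : ℕ} (h1 : 1 ≤ i) (h2 : i < j)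
    (h3 : j ≤ n + 1) (h4 : (i + 1 = j ∧ j ≤ n) ∨ (i + 1 = n ∧ j = n + 1)) :
    matrixD (n + 1) ⟨i - 1, by omega⟩ ⟨j - 1, by omega⟩ = 3 := by
  apply matrixD_eq_three
  simp only
  omega

lemma gen_braid_D (s : CoxeterSystem (matrixD (n + 1)) W) {i j : ℕ} (h1 : 1 ≤ i) (h2 : i < j)
    (h3 : j ≤ n + 1) (h4 : (i + 1 = j ∧ j ≤ n) ∨ (i + 1 = n ∧ j = n + 1)) :
    gen s i * gen s j * gen s i = gen s j * gen s i * gen s j := by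
  rw [gen_eq s h1 (by omega), gen_eq s (by omega) h3]
  exact braid_simple s (matrixD_eq_three_of_edge h1 h2 h3 h4)

lemma length_braid_gen_D (hn : 2 ≤ n) (s : CoxeterSystem (matrixD (n + 1)) W) {i j : ℕ}
    (h1 : 1 ≤ i) (h2 : i < j) (h3 : j ≤ n + 1)
    (h4 : (i + 1 = j ∧ j ≤ n) ∨ (i + 1 = n ∧ j = n + 1)) :
    s.length (gen s i * gen s j * gen s i) = 3 := by
  rw [gen_eq s h1 (by omega), gen_eq s (by omega) h3]
  exact length_braid_three s (simple_injective_D hn s) (matrixD_eq_three_of_edge h1 h2 h3 h4)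

lemma signedPermHom_gen_pred (hn : 2 ≤ n) (s : CoxeterSystem (matrixD (n + 1)) W) :
    signedPermHom hn s (gen s (n - 1)) (n - 2) = n - 1 ∧
    signedPermHom hn s (gen s (n - 1)) (n - 1) = n - 2 ∧
    signedPermHom hn s (gen s (n - 1)) n = n ∧
    signedPermHom hn s (gen s (n - 1)) (n + 1) = n + 1 ∧
    signedPermHom hn s (gen s (n - 1)) (n + 2) = n + 3 ∧
    signedPermHom hn s (gen s (n - 1)) (n + 3) = n + 2 := by
  have h : ∀ x, signedPermHom hn s (gen s (n - 1)) x = signedSwap n (n - 2) x := by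
    intro x
    rw [gen_eq s (by omega) (by omega), signedPermHom_simple]
    rfl
  simp only [h, signedSwap_apply_of_lt (show n - 2 < n by omega)]
  refine ⟨?_, ?_, ?_, ?_, ?_, ?_⟩ <;> split_ifs <;> omega

lemma signedPermHom_gen_mul_gen (hn : 2 ≤ n) (s : CoxeterSystem (matrixD (n + 1)) W) :
    signedPermHom hn s (gen s n * gen s (n + 1)) (n - 2) = n - 2 ∧
    signedPermHom hn s (gen s n * gen s (n + 1)) (n - 1) = n + 2 ∧
    signedPermHom hn s (gen s n * gen s (n + 1)) n = n + 1 ∧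
    signedPermHom hn s (gen s n * gen s (n + 1)) (n + 1) = n ∧
    signedPermHom hn s (gen s n * gen s (n + 1)) (n + 2) = n - 1 ∧
    signedPermHom hn s (gen s n * gen s (n + 1)) (n + 3) = n + 3 := by
  have h : ∀ {x y z : ℕ}, signedSwap n n x = y → signedSwap n (n - 1) y = z →
      signedPermHom hn s (gen s n * gen s (n + 1)) x = z := by
    intro x y z hy hz
    rw [gen_eq s (by omega) (by omega), gen_eq s (by omega) (by omega), map_mul,
      signedPermHom_simple, signedPermHom_simple, Equiv.Perm.mul_apply, ← hz, ← hy]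
    rfl
  refine ⟨h (y := n - 2) ?_ ?_, h (y := n + 1) ?_ ?_, h (y := n + 2) ?_ ?_, h (y := n - 1) ?_ ?_,
    h (y := n) ?_ ?_, h (y := n + 3) ?_ ?_⟩
  all_goals
    first
    | rw [signedSwap_self_apply (by omega)]
    | rw [signedSwap_apply_of_lt (show n - 1 < n by omega)]
    split_ifs <;> omega

/-- The nodes `n`, `n - 1`, `n + 1`, in this order, form a chain of type `A_3`, whose maximal length
is `6`. Both products change the signs of the same two coordinates, so both reach it and coincide.
-/
lemma alternating_D (hn : 2 ≤ n) (s : CoxeterSystem (matrixD (n + 1)) W) :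
    gen s (n - 1) * (gen s n * gen s (n + 1)) * gen s (n - 1) * (gen s n * gen s (n + 1)) =
      gen s n * gen s (n + 1) * gen s (n - 1) * (gen s n * gen s (n + 1)) * gen s (n - 1) ∧
    6 ≤ s.length
      (gen s (n - 1) * (gen s n * gen s (n + 1)) * gen s (n - 1) * (gen s n * gen s (n + 1))) := by
  set a := gen s (n - 1) with ha
  set z := gen s n * gen s (n + 1) with hz
  obtain ⟨a0, a1, a2, a3, a4, a5⟩ := signedPermHom_gen_pred hn s
  obtain ⟨z0, z1, z2, z3, z4, z5⟩ := signedPermHom_gen_mul_gen hn s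
  rw [← ha] at a0 a1 a2 a3 a4 a5
  rw [← hz] at z0 z1 z2 z3 z4 z5
  have hl1 : 6 ≤ s.length (a * z * a * z) := by
    apply six_le_length_D hn s <;>
      simp only [map_mul, Equiv.Perm.mul_apply, a0, a1, a2, a3, a4, a5, z0, z1, z2, z3, z4, z5]
  have hl2 : 6 ≤ s.length (z * a * z * a) := by
    apply six_le_length_D hn s <;>
      simp only [map_mul, Equiv.Perm.mul_apply, a0, a1, a2, a3, a4, a5, z0, z1, z2, z3, z4, z5]
  have b1 := gen_braid_D s (i := n - 1) (j := n) (by omega) (by omega) (by omega) (by omega)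
  have b2 := gen_braid_D s (i := n - 1) (j := n + 1) (by omega) (by omega) (by omega) (by omega)
  let x : ℕ → W := fun k ↦ if k = 0 then gen s n else if k = 1 then a else gen s (n + 1)
  have hchain : IsChain x 3 := by
    refine ⟨?_, ?_, ?_⟩
    · intro k hk
      interval_cases k <;> exact gen_mul_self s _
    · intro k hk
      have hk : k < 2 := by omega
      interval_cases k
      · exact b1.symm
      · exact b2
    · intro k l hkl hl
      obtain rfl : k = 0 := by omega
      obtain rfl : l = 2 := by omega
      exact (gen_comm_D s (by omega) (by omega) (by omega) (by omega)).eq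
  have hx : ∀ k < 3, x k ∈ Subgroup.closure (x '' Set.Iio 3) :=
    fun k hk ↦ Subgroup.subset_closure ⟨k, hk, rfl⟩
  have ham : a ∈ Subgroup.closure (x '' Set.Iio 3) := hx 1 (by norm_num)
  have hzm : z ∈ Subgroup.closure (x '' Set.Iio 3) :=
    mul_mem (hx 0 (by norm_num)) (hx 2 (by norm_num))
  refine ⟨hchain.eq_of_length s ?_ (mul_mem (mul_mem (mul_mem ham hzm) ham) hzm)
    (mul_mem (mul_mem (mul_mem hzm ham) hzm) ham) (by omega) (by omega), hl1⟩
  intro k hk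
  interval_cases k <;> exact ⟨_, gen_eq s (by omega) (by omega)⟩

/-- The folding of `D_{n+1}` onto `B_n`. -/
theorem exists_isUnfolding_B_D (hn : 2 ≤ n) (r : CoxeterSystem (CoxeterMatrix.B n) W')
    (s : CoxeterSystem (matrixD (n + 1)) W) :
    ∃ φ : W' →* W, (∀ i, 1 ≤ i → i < n → φ (gen r i) = gen s i) ∧
      φ (gen r n) = gen s n * gen s (n + 1) ∧
      IsUnfolding r s
        (fun i : Fin n ↦ {Fin.castLE (by omega) i, swapD n (Fin.castLE (by omega) i)}) φ := by
  have hinj := simple_injective_D hn s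
  set f : Fin n → W := fun i ↦ if (i : ℕ) + 1 < n then gen s (i + 1) else gen s n * gen s (n + 1)
    with hf
  have f_lt : ∀ i : Fin n, (i : ℕ) + 1 < n → f i = gen s (i + 1) := fun i hi ↦ if_pos hi
  have f_last : ∀ i : Fin n, (i : ℕ) + 1 = n → f i = gen s n * gen s (n + 1) :=
    fun i hi ↦ if_neg (by omega)
  have hc : Commute (gen s n) (gen s (n + 1)) :=
    gen_comm_D s (by omega) (by omega) (by omega) (by omega)
  have hlen2 : s.length (gen s n * gen s (n + 1)) = 2 :=
    length_gen_mul_gen s hinj (by omega) (by omega) (by omega)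
  obtain ⟨φ, hφ, hU⟩ := exists_isUnfolding_B r s hinj
    (fun i : Fin n ↦ {Fin.castLE (by omega) i, swapD n (Fin.castLE (by omega) i)}) f
    (by
      intro i j hij
      have hv : (i : ℕ) ≠ j := fun h ↦ hij (Fin.ext h)
      rw [Set.disjoint_left]
      intro b hb hb'
      simp only [Set.mem_insert_iff, Set.mem_singleton_iff, Fin.ext_iff, Fin.val_castLE,
        val_swapD] at hb hb'
      split_ifs at hb <;> split_ifs at hb' <;> omega)
    (by
      intro i
      apply finite_parabolic_pair
      rw [matrixD_apply]
      split_ifs <;> norm_num)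
    (by
      intro i
      rcases Nat.lt_or_ge (i + 1) n with hi | hi
      · rw [f_lt i hi]
        apply gen_mem_parabolic
        intro b hb
        left
        exact Fin.ext (by simp; omega)
      · rw [f_last i (by omega)]
        apply mul_mem <;> apply gen_mem_parabolic <;> intro b hb <;>
          simp only [Set.mem_insert_iff, Set.mem_singleton_iff, Fin.ext_iff, Fin.val_castLE,
            val_swapD] <;> split_ifs <;> omega)
    (by
      intro i
      rcases Nat.lt_or_ge (i + 1) n with hi | hi
      · rw [f_lt i hi, gen_mul_self]
      · rw [f_last i (by omega)]
        nth_rewrite 2 [hc.eq]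
        simp only [mul_assoc, gen_mul_gen_cancel, gen_mul_self])
    (by
      intro i b hb
      simp only [Set.mem_insert_iff, Set.mem_singleton_iff, Fin.ext_iff, Fin.val_castLE,
        val_swapD] at hb
      rw [simple_eq_gen]
      rcases Nat.lt_or_ge (i + 1) n with hi | hi
      · rw [if_neg (by omega), if_neg (by omega)] at hb
        rw [f_lt i hi, show (b : ℕ) = i by omega, gen_mul_self, s.length_one,
          length_gen s (by omega) (by omega)]
        norm_num
      · rw [if_pos (by omega)] at hb
        rw [f_last i (by omega), hlen2]
        rcases hb with hb | hb
        · rw [show (b : ℕ) + 1 = n by omega, hc.eq, mul_assoc, gen_mul_self, mul_one]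
          exact (length_gen_le s _).trans_lt (by norm_num)
        · rw [show (b : ℕ) + 1 = n + 1 by omega, mul_assoc, gen_mul_self, mul_one]
          exact (length_gen_le s _).trans_lt (by norm_num))
    (by
      intro i j hij
      have hj := j.2
      rw [f_lt i (by omega)]
      rcases Nat.lt_or_ge (j + 1) n with hj | hj
      · rw [f_lt j hj]
        exact gen_comm_D s (by omega) (by omega) (by omega) (by omega)
      · rw [f_last j (by omega)]
        exact (gen_comm_D s (by omega) (by omega) (by omega) (by omega)).mul_right
          (gen_comm_D s (by omega) (by omega) (by omega) (by omega)))
    (by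
      intro i j hij hj
      rw [f_lt i (by omega), f_lt j hj, length_gen s (by omega) (by omega),
        length_gen s (by omega) (by omega),
        length_braid_gen_D hn s (by omega) (by omega) (by omega) (by omega)]
      exact ⟨gen_braid_D s (by omega) (by omega) (by omega) (by omega), rfl, le_rfl⟩)
    (by
      intro i j hij hj
      rw [f_lt i (by omega), f_last j hj, hlen2, length_gen s (by omega) (by omega),
        show (i : ℕ) + 1 = n - 1 by omega]
      exact alternating_D hn s)
  refine ⟨φ, ?_, ?_, hU⟩
  · intro i h1 h2
    rw [gen_eq r h1 h2.le, hφ, f_lt _ (by simp only; omega)]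
    simp only
    rw [show i - 1 + 1 = i by omega]
  · rw [gen_eq r (by omega) le_rfl, hφ, f_last _ (by simp only; omega)]

end FoldD

/-! ### Factoring the length sum over cosets -/

section CosetSum

variable {B B' W W' : Type*} [Group W] [Group W'] {M : CoxeterMatrix B} {M' : CoxeterMatrix B'}
  {cs' : CoxeterSystem M' W'} {cs : CoxeterSystem M W} {I : B' → Set B} {φ : W' →* W}

/-- The contribution of a parabolic subgroup to the unfolding polynomial. -/
noncomputable def parabolicSum (cs' : CoxeterSystem M' W') (cs : CoxeterSystem M W)
    (φ : W' →* W) (K : Set B') : ℤ[X] :=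
  ∑ᶠ w : parabolic cs' K, (X : ℤ[X]) ^ cs.length (φ w)

lemma parabolic_empty : parabolic cs' (∅ : Set B') = ⊥ := by simp [parabolic]

lemma parabolic_univ : parabolic cs' (Set.univ : Set B') = ⊤ := by
  rw [parabolic, Set.image_univ, cs'.subgroup_closure_range_simple]

lemma finite_parabolic_empty : Finite (parabolic cs' (∅ : Set B')) := by
  rw [parabolic_empty]
  infer_instance

lemma parabolicSum_empty : parabolicSum cs' cs φ ∅ = 1 := by
  have : Unique (parabolic cs' (∅ : Set B')) := by
    rw [parabolic_empty]
    infer_instance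
  rw [parabolicSum, finsum_unique, ← Unique.uniq this 1]
  simp

lemma parabolicSum_univ : parabolicSum cs' cs φ Set.univ = unfoldingPolynomial cs φ := by
  rw [parabolicSum, unfoldingPolynomial]
  have h : parabolic cs' (Set.univ : Set B') = ⊤ := parabolic_univ
  exact finsum_eq_of_bijective (fun w : parabolic cs' (Set.univ : Set B') ↦ (w : W'))
    ⟨Subtype.val_injective, fun w ↦ ⟨⟨w, h ▸ Subgroup.mem_top w⟩, rfl⟩⟩ fun _ ↦ rfl

/-- If the `L + 1` words `v k` of lengths `k ≤ L` are shortest representatives of the cosets of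
`W_J` in `W_K`, then the sum over `W_K` is a product. -/
theorem parabolicSum_eq_mul (H : IsUnfolding cs' cs I φ) {J K : Set B'} (hJK : J ⊆ K) (L : ℕ)
    (v : ℕ → List B') (hvK : ∀ k ≤ L, ∀ i ∈ v k, i ∈ K) (hlen : ∀ k ≤ L, (v k).length = k)
    (hspan : ∀ k ≤ L, ∀ i ∈ K, ∃ u ∈ parabolic cs' J, ∃ k' ≤ L,
      cs'.wordProd (v k) * cs'.simple i = u * cs'.wordProd (v k'))
    (hmin : ∀ k ≤ L, ∀ u ∈ parabolic cs' J, k ≤ cs'.length (u * cs'.wordProd (v k)))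
    [Finite (parabolic cs' J)] :
    Finite (parabolic cs' K) ∧ parabolicSum cs' cs φ K = parabolicSum cs' cs φ J *
      ∑ k ∈ Finset.range (L + 1), (X : ℤ[X]) ^ unfoldedLength cs' cs φ (v k) := by
  have hv0 : v 0 = [] := List.length_eq_zero_iff.1 (hlen 0 (by omega))
  have hred : ∀ k ≤ L, cs'.IsReduced (v k) := by
    intro k hk
    have h1 := hmin k hk 1 (one_mem _)
    have h2 := cs'.length_wordProd_le (v k)
    rw [one_mul] at h1
    rw [hlen k hk] at h2
    rw [CoxeterSystem.IsReduced, hlen k hk]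
    omega
  have hsurj : ∀ w ∈ parabolic cs' K, ∃ u ∈ parabolic cs' J, ∃ k ≤ L,
      w = u * cs'.wordProd (v k) := by
    intro w hw
    obtain ⟨ω, hω, rfl⟩ := exists_word_of_mem_parabolic cs' hw
    clear hw
    induction ω using List.reverseRecOn with
    | nil => exact ⟨1, one_mem _, 0, by omega, by simp [hv0]⟩
    | append_singleton ω i ih =>
      obtain ⟨u, hu, k, hk, e⟩ := ih fun j hj ↦ hω j (by simp [hj])
      obtain ⟨u', hu', k', hk', e'⟩ := hspan k hk i (hω i (by simp))
      refine ⟨u * u', mul_mem hu hu', k', hk', ?_⟩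
      rw [cs'.wordProd_append, cs'.wordProd_singleton, e, mul_assoc, e', mul_assoc]
  let F : parabolic cs' J × Fin (L + 1) → parabolic cs' K := fun z ↦
    ⟨z.1 * cs'.wordProd (v z.2), mul_mem (parabolic_mono cs' hJK z.1.2)
      (wordProd_mem_parabolic cs' (hvK _ (by omega)))⟩
  -- The shortest element of the coset of `v k` has length `k`, so different `k` give different
  -- cosets.
  have hle : ∀ k ≤ L, ∀ k' ≤ L, ∀ u ∈ parabolic cs' J, ∀ u' ∈ parabolic cs' J,
      u * cs'.wordProd (v k) = u' * cs'.wordProd (v k') → k' ≤ k := by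
    intro k hk k' hk' u hu u' hu' e
    have h1 := hmin k' hk' (u⁻¹ * u') (mul_mem (inv_mem hu) hu')
    rw [mul_assoc, ← e, inv_mul_cancel_left, (hred k hk).eq, hlen k hk] at h1
    exact h1
  have hF : Function.Bijective F := by
    constructor
    · rintro ⟨u, k⟩ ⟨u', k'⟩ e
      have e' : (u : W') * cs'.wordProd (v k) = u' * cs'.wordProd (v k') := congrArg Subtype.val e
      have hk : k = k' := Fin.ext (le_antisymm
        (hle _ (by omega) _ (by omega) _ u'.2 _ u.2 e'.symm)
        (hle _ (by omega) _ (by omega) _ u.2 _ u'.2 e'))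
      subst hk
      rw [mul_left_inj] at e'
      rw [Subtype.ext e']
    · rintro ⟨w, hw⟩
      obtain ⟨u, hu, k, hk, rfl⟩ := hsurj w hw
      exact ⟨⟨⟨u, hu⟩, ⟨k, by omega⟩⟩, rfl⟩
  refine ⟨Finite.of_surjective F hF.2, ?_⟩
  have := Fintype.ofFinite (parabolic cs' J)
  rw [parabolicSum, ← finsum_eq_of_bijective F hF (fun _ ↦ rfl), finsum_eq_sum_of_fintype,
    Fintype.sum_prod_type, parabolicSum, finsum_eq_sum_of_fintype, Finset.sum_mul_sum]
  apply Finset.sum_congr rfl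
  intro u _
  rw [Finset.sum_range]
  apply Finset.sum_congr rfl
  intro k _
  have h1 := length_mul_of_isMin_left cs' (J := J) (v := cs'.wordProd (v k)) (fun x hx ↦ by
    rw [(hred k (by omega)).eq, hlen k (by omega)]
    exact hmin k (by omega) x hx) u.2
  have h2 := H.length_map_mul h1
  simp only [F]
  rw [h2, H.length_map_wordProd (hred k (by omega)), pow_add]

/-- In an action on `ℕ` where the simple reflections move points by at most one step to the right,
an element moving `p` to `p + k` on the right has length at least `k`. -/
lemma le_length_of_perm (ψ : W' →* Equiv.Perm ℕ) (hψ : ∀ i x, ψ (cs'.simple i) x ≤ x + 1)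
    (w : W') (x : ℕ) : ψ w x ≤ x + cs'.length w := by
  obtain ⟨ω, hω, rfl⟩ := cs'.exists_isReduced w
  rw [hω.eq]
  clear hω
  induction ω with
  | nil => simp
  | cons i ω ih =>
    rw [cs'.wordProd_cons, map_mul, Equiv.Perm.mul_apply, List.length_cons]
    exact (hψ i _).trans (by omega)

/-- This certifies that representatives are shortest: `u` fixes `p`, so `(u v)⁻¹` still carries `p`
to `p + k`, one step per letter at most. -/
lemma le_length_mul_of_perm (ψ : W' →* Equiv.Perm ℕ) (hψ : ∀ i x, ψ (cs'.simple i) x ≤ x + 1)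
    {J : Set B'} {p k : ℕ} (hJ : ∀ i ∈ J, ψ (cs'.simple i) p = p) {v : W'}
    (hv : ψ v⁻¹ p = p + k) {u : W'} (hu : u ∈ parabolic cs' J) : k ≤ cs'.length (u * v) := by
  have h1 := le_length_of_perm ψ hψ (u * v)⁻¹ p
  have h2 : ψ u⁻¹ p = p := by
    obtain ⟨ω, hω, e⟩ := exists_word_of_mem_parabolic cs' (inv_mem hu)
    rw [e]
    clear e
    induction ω with
    | nil => simp
    | cons i ω ih =>
      rw [cs'.wordProd_cons, map_mul, Equiv.Perm.mul_apply, ih fun j hj ↦ hω j (by simp [hj]),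
        hJ i (hω i (by simp))]
  rw [cs'.length_inv, mul_inv_rev, map_mul, Equiv.Perm.mul_apply, h2, hv] at h1
  omega

end CosetSum

/-! ### The unfolding polynomial in type `B_n` -/

section SumB

/-- The relations of the simple reflections of type `B_n`. -/
structure IsChainB {G : Type*} [Group G] (y : ℕ → G) (n : ℕ) : Prop where
  sq : ∀ i, y i * y i = 1
  comm : ∀ i j, i + 1 < j → Commute (y i) (y j)
  braid : ∀ i, i + 2 < n → y i * y (i + 1) * y i = y (i + 1) * y i * y (i + 1)
  four : ∀ i, i + 2 = n →
    y i * y (i + 1) * y i * y (i + 1) = y (i + 1) * y i * y (i + 1) * y i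

/-- The index of the simple reflection of `B_n` that moves the point `x` to `x + 1`. -/
def stepIndex (n x : ℕ) : ℕ := if x < n then x else 2 * n - 2 - x

/-- The product of the simple reflections that move the point `q` to `q + k`. -/
def pathProd {G : Type*} [Group G] (y : ℕ → G) (n q : ℕ) : ℕ → G
  | 0 => 1
  | k + 1 => pathProd y n q k * y (stepIndex n (q + k))

namespace IsChainB

variable {G : Type*} [Group G] {y : ℕ → G} {n q : ℕ}

lemma pathProd_comm_of_lt (h : IsChainB y n) {k j : ℕ} (hk : q + k ≤ n) (hj : q + k < j) :
    pathProd y n q k * y j = y j * pathProd y n q k := by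
  induction k with
  | zero => simp [pathProd]
  | succ k ih =>
    rw [pathProd, stepIndex, if_pos (by omega), mul_assoc, (h.comm (q + k) j (by omega)).eq,
      ← mul_assoc, ih (by omega) (by omega), mul_assoc]

lemma pathProd_braid_ascending (h : IsChainB y n) {k j : ℕ} (hk : q + k ≤ n) (hqj : q ≤ j)
    (hj : j + 1 < q + k) (hjn : j + 2 < n) :
    pathProd y n q k * y j = y (j + 1) * pathProd y n q k := by
  induction k with
  | zero => omega
  | succ k ih =>
    rcases Nat.lt_or_ge (j + 1) (q + k) with h1 | h1
    · rw [pathProd, stepIndex, if_pos (by omega), mul_assoc, ← (h.comm j (q + k) (by omega)).eq,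
        ← mul_assoc, ih (by omega) h1, mul_assoc]
    · obtain ⟨k, rfl⟩ : ∃ k', k = k' + 1 := ⟨k - 1, by omega⟩
      have e : q + k = j := by omega
      have e' : q + (k + 1) = j + 1 := by omega
      rw [pathProd, pathProd, stepIndex, stepIndex, e, e', if_pos (by omega), if_pos (by omega)]
      calc pathProd y n q k * y j * y (j + 1) * y j
          = pathProd y n q k * (y j * y (j + 1) * y j) := by simp only [mul_assoc]
        _ = pathProd y n q k * y (j + 1) * y j * y (j + 1) := by
          rw [h.braid j hjn]; simp only [mul_assoc]
        _ = _ := by rw [h.pathProd_comm_of_lt (by omega) (by omega)]; simp only [mul_assoc]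

/-- The descending part of the path has not yet come near `j`, so `y j` commutes with it and only
the ascending part acts, raising the index by one. -/
lemma pathProd_braid_descending (h : IsChainB y n) {k j : ℕ} (hk : n ≤ q + k) (hqj : q ≤ j)
    (hj : j + 1 + (q + k) < 2 * n - 1) :
    pathProd y n q k * y j = y (j + 1) * pathProd y n q k := by
  induction k with
  | zero => omega
  | succ k ih =>
    rcases Nat.lt_or_ge (q + k) n with h1 | h1
    · exact h.pathProd_braid_ascending (by omega) hqj (by omega) (by omega)
    · rw [pathProd, stepIndex, if_neg (by omega), mul_assoc,
        ← (h.comm j (2 * n - 2 - (q + k)) (by omega)).eq, ← mul_assoc, ih h1 (by omega), mul_assoc]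

/-- Once the descent has passed below `j`, the index changes twice: the descending part turns `y j`
into `y (j - 1)` and the ascending part turns it back. At the turning point, `j = n - 1`, the
relation of length four takes the place of these two braid moves. -/
lemma pathProd_comm_descending (h : IsChainB y n) {k j : ℕ} (hk : n < q + k)
    (hk' : q + (q + k) < 2 * n) (hj : 2 * n - 1 < j + (q + k)) (hjn : j < n) :
    pathProd y n q k * y j = y j * pathProd y n q k := by
  induction k with
  | zero => omega
  | succ k ih =>
    rcases Nat.lt_or_ge (2 * n - 1) (j + (q + k)) with h1 | h1
    · rw [pathProd, stepIndex, if_neg (by omega), mul_assoc,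
        (h.comm (2 * n - 2 - (q + k)) j (by omega)).eq, ← mul_assoc,
        ih (by omega) (by omega) h1, mul_assoc]
    · obtain ⟨k, rfl⟩ : ∃ k', k = k' + 1 := ⟨k - 1, by omega⟩
      obtain ⟨d, rfl⟩ : ∃ d, j = d + 1 := ⟨j - 1, by omega⟩
      have e : stepIndex n (q + (k + 1)) = d := by rw [stepIndex, if_neg (by omega)]; omega
      rcases Nat.lt_or_ge (q + k) n with h2 | h2
      · obtain ⟨k, rfl⟩ : ∃ k', k = k' + 1 := ⟨k - 1, by omega⟩
        have e1 : stepIndex n (q + (k + 1)) = d + 1 := by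
          rw [stepIndex, if_pos (by omega)]; omega
        have e2 : stepIndex n (q + k) = d := by rw [stepIndex, if_pos (by omega)]; omega
        rw [pathProd, pathProd, pathProd, e, e1, e2]
        calc pathProd y n q k * y d * y (d + 1) * y d * y (d + 1)
            = pathProd y n q k * (y d * y (d + 1) * y d * y (d + 1)) := by simp only [mul_assoc]
          _ = pathProd y n q k * y (d + 1) * y d * y (d + 1) * y d := by
            rw [h.four d (by omega)]; simp only [mul_assoc]
          _ = _ := by rw [h.pathProd_comm_of_lt (by omega) (by omega)]; simp only [mul_assoc]
      · have e1 : stepIndex n (q + k) = d + 1 := by rw [stepIndex, if_neg (by omega)]; omega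
        rw [pathProd, pathProd, e, e1]
        calc pathProd y n q k * y (d + 1) * y d * y (d + 1)
            = pathProd y n q k * (y (d + 1) * y d * y (d + 1)) := by simp only [mul_assoc]
          _ = pathProd y n q k * y d * y (d + 1) * y d := by
            rw [← h.braid d (by omega)]; simp only [mul_assoc]
          _ = _ := by
            rw [h.pathProd_braid_descending h2 (by omega) (by omega)]; simp only [mul_assoc]

/-- A letter continues the path, cancels its last step, or passes to the left end as a generator
with index above `q`, that is, into the smaller parabolic subgroup. -/
lemma exists_pathProd_mul (h : IsChainB y n) (hq : q < n) {k j : ℕ} (hk : k + 2 * q < 2 * n)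
    (hqj : q ≤ j) (hj : j < n) : ∃ u : G, (u = 1 ∨ ∃ i, q < i ∧ i < n ∧ u = y i) ∧
      ∃ k', k' + 2 * q < 2 * n ∧ pathProd y n q k * y j = u * pathProd y n q k' := by
  by_cases h1 : j = stepIndex n (q + k) ∧ k + 1 + 2 * q < 2 * n
  · exact ⟨1, Or.inl rfl, k + 1, h1.2, by rw [pathProd, ← h1.1, one_mul]⟩
  by_cases h2 : ∃ k', k = k' + 1 ∧ j = stepIndex n (q + k')
  · obtain ⟨k, rfl, h2⟩ := h2
    exact ⟨1, Or.inl rfl, k, by omega, by rw [pathProd, ← h2, one_mul, mul_assoc, h.sq, mul_one]⟩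
  rcases Nat.lt_or_ge n (q + k) with h3 | h3
  · have h4 : j ≠ 2 * n - 1 - (q + k) := by
      rintro rfl
      exact h2 ⟨k - 1, by omega, by rw [stepIndex, if_neg (by omega)]; omega⟩
    rw [stepIndex, if_neg (by omega)] at h1
    rcases Nat.lt_or_ge (2 * n - 1) (j + (q + k)) with h5 | h5
    · exact ⟨y j, Or.inr ⟨j, by omega, hj, rfl⟩, k, hk,
        h.pathProd_comm_descending h3 (by omega) h5 hj⟩
    · exact ⟨y (j + 1), Or.inr ⟨j + 1, by omega, by omega, rfl⟩, k, hk,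
        h.pathProd_braid_descending h3.le hqj (by omega)⟩
  · have h4 : j + 1 ≠ q + k := by
      intro e
      exact h2 ⟨k - 1, by omega, by rw [stepIndex, if_pos (by omega)]; omega⟩
    rcases Nat.lt_or_ge (q + k) j with h5 | h5
    · exact ⟨y j, Or.inr ⟨j, by omega, hj, rfl⟩, k, hk, h.pathProd_comm_of_lt h3 h5⟩
    · have h6 : j + 1 < q + k ∧ j + 2 < n := by
        unfold stepIndex at h1
        split_ifs at h1 <;> omega
      exact ⟨y (j + 1), Or.inr ⟨j + 1, by omega, by omega, rfl⟩, k, hk,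
        h.pathProd_braid_ascending h3 hqj h6.1 h6.2⟩

end IsChainB

variable {B W W' : Type*} [Group W] [Group W'] {M : CoxeterMatrix B} {n : ℕ}

lemma isChainB_gen (r : CoxeterSystem (CoxeterMatrix.B n) W') :
    IsChainB (fun i ↦ gen r (i + 1)) n where
  sq i := gen_mul_self r _
  comm i j hij := by
    by_cases hj : j + 1 ≤ n
    · rw [gen_eq r (by omega) (by omega), gen_eq r (by omega) (by omega)]
      exact commute_simple r (matrixB_eq_two (by simp only; omega))
    · simp [gen, hj]
  braid i hi := by
    rw [gen_eq r (by omega) (by omega), gen_eq r (by omega) (by omega)]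
    exact braid_simple r (matrixB_eq_three (by simp only; omega) (by simp only; omega))
  four i hi := by
    rw [gen_eq r (by omega) (by omega), gen_eq r (by omega) (by omega)]
    have h1 := r.wordProd_braidWord_eq ⟨i + 1 - 1, by omega⟩ ⟨i + 1 + 1 - 1, by omega⟩
    rw [CoxeterSystem.braidWord, CoxeterSystem.braidWord, (CoxeterMatrix.B n).symmetric
      ⟨i + 1 + 1 - 1, by omega⟩, matrixB_eq_four (by simp only; omega) (by simp only; omega)] at h1
    simpa [CoxeterSystem.alternatingWord, r.wordProd_cons, mul_assoc] using h1

/-- A Coxeter group of type `B_n` acts on `0, …, 2 n - 1` by signed permutations. -/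
lemma exists_perm_B (hn : 1 ≤ n) (r : CoxeterSystem (CoxeterMatrix.B n) W') :
    ∃ ψ : W' →* Equiv.Perm ℕ, ∀ (i : Fin n) (x : ℕ), ψ (r.simple i) x =
      if x = i then (i : ℕ) + 1 else if x = i + 1 then (i : ℕ) else
      if x = 2 * n - 2 - i then 2 * n - 1 - i else
      if x = 2 * n - 1 - i then 2 * n - 2 - i else x := by
  -- The action is pulled back from the permutation model of `A_{2n-1}` along the folding already
  -- constructed.
  set s := (CoxeterMatrix.A (2 * n - 1)).toCoxeterSystem
  obtain ⟨φ, h1, h2, -⟩ := exists_isUnfolding_B_A_odd hn r s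
  refine ⟨(permHom s).comp φ, fun i x ↦ ?_⟩
  rw [MonoidHom.comp_apply, simple_eq_gen]
  rcases Nat.lt_or_ge (i + 1) n with hi | hi
  · rw [h1 _ (by omega) hi, map_mul, permHom_gen s (by omega) (by omega),
      permHom_gen s (by omega) (by omega), Equiv.Perm.mul_apply,
      Equiv.swap_apply_def (2 * n - (i + 1) - 1)]
    split_ifs <;> rw [Equiv.swap_apply_def] <;> split_ifs <;> omega
  · rw [show (i : ℕ) + 1 = n by omega, h2, permHom_gen s (by omega) (by omega),
      Equiv.swap_apply_def]
    split_ifs <;> omega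

lemma stepIndex_lt (hn : 1 ≤ n) (x : ℕ) : stepIndex n x < n := by
  unfold stepIndex
  split_ifs <;> omega

/-- The word of the simple reflections of `B_n` that move the point `q` to `q + k`. -/
def pathWord (hn : 1 ≤ n) (q k : ℕ) : List (Fin n) :=
  (List.range k).map fun t ↦ ⟨stepIndex n (q + t), stepIndex_lt hn _⟩

lemma pathWord_succ (hn : 1 ≤ n) (q k : ℕ) : pathWord hn q (k + 1) =
    pathWord hn q k ++ [⟨stepIndex n (q + k), stepIndex_lt hn _⟩] := by
  simp [pathWord, List.range_succ]

lemma length_pathWord (hn : 1 ≤ n) (q k : ℕ) : (pathWord hn q k).length = k := by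
  simp [pathWord]

lemma wordProd_pathWord (hn : 1 ≤ n) (r : CoxeterSystem (CoxeterMatrix.B n) W') (q k : ℕ) :
    r.wordProd (pathWord hn q k) = pathProd (fun i ↦ gen r (i + 1)) n q k := by
  induction k with
  | zero => simp [pathWord, pathProd]
  | succ k ih =>
    rw [pathWord_succ, r.wordProd_append, ih, r.wordProd_singleton, pathProd, simple_eq_gen]

/-- The full path has `m` steps of weight `a` going up, one of weight `b` at the last node, and `m`
of weight `a` coming down. The partial weights are `k a` and `m a + b + k a` for `0 ≤ k ≤ m`. -/
lemma sum_pow_pathWord (hn : 1 ≤ n) (r : CoxeterSystem (CoxeterMatrix.B n) W')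
    (cs : CoxeterSystem M W) (φ : W' →* W) {a b : ℕ}
    (ha : ∀ i : Fin n, (i : ℕ) + 1 < n → cs.length (φ (r.simple i)) = a)
    (hb : ∀ i : Fin n, (i : ℕ) + 1 = n → cs.length (φ (r.simple i)) = b) {q m : ℕ}
    (hq : q + m + 1 = n) :
    ∑ k ∈ Finset.range (2 * m + 1 + 1), (X : ℤ[X]) ^ unfoldedLength r cs φ (pathWord hn q k) =
      (1 + X ^ (m * a + b)) * qInt (m + 1) (X ^ a) := by
  have h1 : ∀ k ≤ m, unfoldedLength r cs φ (pathWord hn q k) = k * a := by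
    intro k hk
    induction k with
    | zero => simp [pathWord, unfoldedLength_nil]
    | succ k ih =>
      rw [pathWord_succ, unfoldedLength_append, unfoldedLength_singleton, ih (by omega),
        ha _ (by simp only [stepIndex]; rw [if_pos (by omega)]; omega)]
      ring
  have h2 : ∀ k ≤ m, unfoldedLength r cs φ (pathWord hn q (m + 1 + k)) =
      m * a + b + k * a := by
    intro k hk
    induction k with
    | zero =>
      rw [add_zero, pathWord_succ, unfoldedLength_append, unfoldedLength_singleton, h1 m le_rfl,
        hb _ (by simp only [stepIndex]; rw [if_pos (by omega)]; omega)]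
      ring
    | succ k ih =>
      rw [← add_assoc, pathWord_succ, unfoldedLength_append, unfoldedLength_singleton,
        ih (by omega), ha _ (by simp only [stepIndex]; rw [if_neg (by omega)]; omega)]
      ring
  rw [show 2 * m + 1 + 1 = (m + 1) + (m + 1) by ring, Finset.sum_range_add, qInt, add_mul,
    one_mul, Finset.mul_sum]
  congr 1
  · apply Finset.sum_congr rfl
    intro k hk
    rw [Finset.mem_range] at hk
    rw [h1 k (by omega), ← pow_mul, mul_comm]
  · apply Finset.sum_congr rfl
    intro k hk
    rw [Finset.mem_range] at hk
    rw [h2 k (by omega), pow_add, ← pow_mul, mul_comm k]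

/-- The unfolding polynomial of a folding of type `B_n` in which the first `n - 1` simple
reflections unfold to elements of length `a` and the last one to an element of length `b`. -/
theorem unfoldingPolynomial_B (hn : 1 ≤ n) {r : CoxeterSystem (CoxeterMatrix.B n) W'}
    {cs : CoxeterSystem M W} {I : Fin n → Set B} {φ : W' →* W} (H : IsUnfolding r cs I φ) {a b : ℕ}
    (ha : ∀ i : Fin n, (i : ℕ) + 1 < n → cs.length (φ (r.simple i)) = a)
    (hb : ∀ i : Fin n, (i : ℕ) + 1 = n → cs.length (φ (r.simple i)) = b) :
    Finite W' ∧ unfoldingPolynomial cs φ =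
      ∏ m ∈ Finset.range n, (1 + (X : ℤ[X]) ^ (m * a + b)) * qInt (m + 1) (X ^ a) := by
  obtain ⟨ψ, hψ⟩ := exists_perm_B hn r
  have hψ_le : ∀ i x, ψ (r.simple i) x ≤ x + 1 := by
    intro i x
    rw [hψ]
    split_ifs <;> omega
  -- Nodes are added one at a time, starting from the end with the bond of label 4. The new node has
  -- index `q = n - m - 1`, and the coset representatives are the paths starting at the point `q`,
  -- which the later nodes fix.
  have key : ∀ m ≤ n, Finite (parabolic r {i : Fin n | n ≤ i + m}) ∧
      parabolicSum r cs φ {i : Fin n | n ≤ i + m} =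
        ∏ m ∈ Finset.range m, (1 + (X : ℤ[X]) ^ (m * a + b)) * qInt (m + 1) (X ^ a) := by
    intro m hm
    induction m with
    | zero =>
      have : {i : Fin n | n ≤ i + 0} = ∅ := by
        ext i
        simp
      rw [this]
      exact ⟨finite_parabolic_empty, by simpa using parabolicSum_empty⟩
    | succ m ih =>
      obtain ⟨hfin, hsum⟩ := ih (by omega)
      obtain ⟨q, hq⟩ : ∃ q, q + m + 1 = n := ⟨n - m - 1, by omega⟩
      rw [Finset.prod_range_succ, ← hsum, ← sum_pow_pathWord hn r cs φ ha hb hq]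
      apply parabolicSum_eq_mul H
      · intro i hi
        simp only [Set.mem_ofPred_eq] at hi ⊢
        omega
      · intro k hk i hi
        simp only [pathWord, List.mem_map, List.mem_range] at hi
        obtain ⟨t, ht, rfl⟩ := hi
        simp only [Set.mem_ofPred_eq, stepIndex]
        split_ifs <;> omega
      · intro k _
        exact length_pathWord hn q k
      · intro k hk i hi
        simp only [Set.mem_ofPred_eq] at hi
        obtain ⟨u, hu, k', hk', e⟩ := (isChainB_gen r).exists_pathProd_mul (q := q) (by omega)
          (k := k) (j := i) (by omega) (by omega) i.2
        refine ⟨u, ?_, k', by omega, ?_⟩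
        · rcases hu with rfl | ⟨j, hj1, hj2, rfl⟩
          · exact one_mem _
          · apply gen_mem_parabolic
            intro j' hj'
            simp only [Set.mem_ofPred_eq]
            omega
        · rw [wordProd_pathWord, wordProd_pathWord, simple_eq_gen, e]
      · intro k hk u hu
        apply le_length_mul_of_perm ψ hψ_le (p := q) _ _ hu
        · intro i hi
          simp only [Set.mem_ofPred_eq] at hi
          rw [hψ]
          split_ifs <;> omega
        · clear hu
          induction k with
          | zero => simp [pathWord]
          | succ k ihk =>
            rw [pathWord_succ, r.wordProd_append, r.wordProd_singleton, mul_inv_rev, r.inv_simple,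
              map_mul, Equiv.Perm.mul_apply, ihk (by omega), hψ]
            simp only [stepIndex]
            split_ifs <;> omega
  obtain ⟨h1, h2⟩ := key n le_rfl
  have hu : {i : Fin n | n ≤ i + n} = Set.univ := by
    ext i
    simp
  rw [hu] at h1 h2
  rw [parabolic_univ] at h1
  exact ⟨Finite.of_injective (fun w : W' ↦ (⟨w, Subgroup.mem_top w⟩ : (⊤ : Subgroup W')))
    fun _ _ h ↦ congrArg Subtype.val h, by rw [← parabolicSum_univ (cs' := r), h2]⟩

end SumB

/-! ### Parity products and the billiard trajectory -/

section Dihedral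

variable {n : ℕ} {W : Type*} [Group W]

lemma prod_mul_self_of_commute {G : Type*} [Group G] {x : ℕ → G} (hx : ∀ i, x i * x i = 1)
    {l : List ℕ} (h : ∀ i ∈ l, ∀ j ∈ l, Commute (x i) (x j)) :
    (l.map x).prod * (l.map x).prod = 1 := by
  induction l with
  | nil => simp
  | cons a l ih =>
    have hc : Commute (x a) (l.map x).prod := Commute.list_prod_right _ _ fun y hy ↦ by
      obtain ⟨j, hj, rfl⟩ := List.mem_map.1 hy
      exact h a (by simp) j (by simp [hj])
    rw [List.map_cons, List.prod_cons, mul_assoc, ← mul_assoc _ (x a), ← hc.eq, mul_assoc,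
      ih fun i hi j hj ↦ h i (by simp [hi]) j (by simp [hj]), mul_one, hx]

lemma exists_prod_mul_eq_of_commute {G : Type*} [Group G] {x : ℕ → G} (hx : ∀ i, x i * x i = 1)
    {l : List ℕ} (h : ∀ i ∈ l, ∀ j ∈ l, Commute (x i) (x j)) {k : ℕ} (hk : k ∈ l) :
    ∃ l' : List ℕ, l'.length + 1 = l.length ∧ (l.map x).prod * x k = (l'.map x).prod := by
  induction l with
  | nil => simp at hk
  | cons a l ih =>
    rcases List.mem_cons.1 hk with rfl | hk
    · have hc : Commute (x k) (l.map x).prod := Commute.list_prod_right _ _ fun y hy ↦ by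
        obtain ⟨j, hj, rfl⟩ := List.mem_map.1 hy
        exact h k (by simp) j (by simp [hj])
      refine ⟨l, by simp, ?_⟩
      rw [List.map_cons, List.prod_cons, hc.eq, mul_assoc, hx, mul_one]
    · obtain ⟨l', h1, h2⟩ := ih (fun i hi j hj ↦ h i (by simp [hi]) j (by simp [hj])) hk
      refine ⟨a :: l', by simp [h1], ?_⟩
      rw [List.map_cons, List.prod_cons, mul_assoc, h2, List.map_cons, List.prod_cons]

/-- The nodes `1, …, n` of `A_n` of the parity opposite to `c`. -/
def parityNodes (n c : ℕ) : List ℕ := (List.range' 1 n).filter fun i ↦ i % 2 ≠ c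

lemma parityNodes_succ (k c : ℕ) : parityNodes (k + 1) c =
    parityNodes k c ++ if (k + 1) % 2 ≠ c then [k + 1] else [] := by
  rw [parityNodes, List.range'_1_concat, List.filter_append, parityNodes, add_comm 1 k]
  congr 1
  by_cases h : (k + 1) % 2 = c <;> simp [h]

lemma mem_parityNodes {n c i : ℕ} : i ∈ parityNodes n c ↔ (1 ≤ i ∧ i ≤ n) ∧ i % 2 ≠ c := by
  simp only [parityNodes, List.mem_filter, List.mem_range'_1, decide_eq_true_eq]
  omega

lemma length_parityNodes (n : ℕ) :
    (parityNodes n 0).length = (n + 1) / 2 ∧ (parityNodes n 1).length = n / 2 := by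
  induction n with
  | zero => simp [parityNodes]
  | succ n ih =>
    rw [parityNodes_succ, parityNodes_succ, List.length_append, List.length_append, ih.1, ih.2]
    split_ifs <;> simp <;> omega

/-- The permutation of `0, …, n` that exchanges `a` and `a + 1` for all `a` of the parity of `c`. -/
def paritySwap (n c x : ℕ) : ℕ :=
  if x ≤ n then if x % 2 = c then if x + 1 ≤ n then x + 1 else x else x - 1 else x

/-- Node `i` exchanges `i - 1` and `i`, so the nodes of parity opposite to `c` move the points of
parity `c` to the right. -/
lemma permHom_prod_parityNodes (s : CoxeterSystem (CoxeterMatrix.A n) W) {c : ℕ} (hc : c < 2)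
    (k : ℕ) (hk : k ≤ n) (x : ℕ) :
    permHom s ((parityNodes k c).map (gen s)).prod x = paritySwap k c x := by
  induction k generalizing x with
  | zero =>
    simp only [parityNodes, List.range'_zero, List.filter_nil, List.map_nil, List.prod_nil,
      map_one, Equiv.Perm.one_apply, paritySwap]
    split_ifs <;> omega
  | succ k ih =>
    rw [parityNodes_succ]
    split_ifs with h
    · rw [List.map_append, List.prod_append, map_mul, Equiv.Perm.mul_apply, List.map_singleton,
        List.prod_singleton, permHom_gen s (by omega) hk, ih (by omega), Nat.add_sub_cancel,
        Equiv.swap_apply_def]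
      unfold paritySwap
      split_ifs <;> omega
    · rw [List.append_nil, ih (by omega)]
      unfold paritySwap
      split_ifs <;> omega

/-- The billiard trajectory on `0, …, n` with virtual time `y`. -/
def fold (n y : ℕ) : ℕ :=
  if y ≤ n then y else if y ≤ 2 * n + 1 then 2 * n + 1 - y else y - (2 * n + 2)

/-- Under the two involutions in turn, a point moves steadily in one direction, rests for one unit
of time at a wall, and comes back. The parity of the virtual time tells which involution is due. -/
lemma paritySwap_fold {y : ℕ} (hy : y ≤ 3 * n + 1) :
    paritySwap n (y % 2) (fold n y) = fold n (y + 1) := by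
  unfold fold paritySwap
  split_ifs <;> omega

end Dihedral

/-! ### The folding of `A_n` onto `I_2(n+1)` and its polynomial -/

section FoldDihedral

variable {n : ℕ} {W W' : Type*} [Group W] [Group W']

/-- The product of the simple reflections of `A_n` at the nodes of one parity. -/
noncomputable def parityProd (s : CoxeterSystem (CoxeterMatrix.A n) W) (c : Fin 2) : W :=
  ((parityNodes n c).map (gen s)).prod

lemma permHom_parityProd (s : CoxeterSystem (CoxeterMatrix.A n) W) (c : Fin 2) (x : ℕ) :
    permHom s (parityProd s c) x = paritySwap n c x :=
  permHom_prod_parityNodes s c.2 n le_rfl x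

lemma commute_parityNodes (s : CoxeterSystem (CoxeterMatrix.A n) W) (c : Fin 2) :
    ∀ i ∈ parityNodes n c, ∀ j ∈ parityNodes n c, Commute (gen s i) (gen s j) := by
  intro i hi j hj
  rw [mem_parityNodes] at hi hj
  rcases Nat.lt_trichotomy i j with h | rfl | h
  · exact gen_comm_A s (by omega)
  · exact Commute.refl _
  · exact (gen_comm_A s (by omega)).symm

lemma length_parityProd_le (s : CoxeterSystem (CoxeterMatrix.A n) W) (c : Fin 2) :
    s.length (parityProd s c) ≤ (parityNodes n c).length :=
  length_list_prod_le s fun _ _ ↦ length_gen_le s _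

lemma sum_map_alternatingWord {B : Type*} (g : B → ℕ) (i j : B) (m : ℕ) :
    ((CoxeterSystem.alternatingWord i j m).map g).sum = m / 2 * (g i + g j) + m % 2 * g j := by
  induction m generalizing i j with
  | zero => simp [CoxeterSystem.alternatingWord]
  | succ m ih =>
    rw [CoxeterSystem.alternatingWord_succ, List.concat_eq_append, List.map_append,
      List.sum_append, ih]
    rcases Nat.even_or_odd' m with ⟨k, rfl | rfl⟩
    · rw [show (2 * k + 1) / 2 = k by omega, show (2 * k + 1) % 2 = 1 by omega,
        show 2 * k / 2 = k by omega, show 2 * k % 2 = 0 by omega]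
      simp only [List.map_cons, List.map_nil, List.sum_cons, List.sum_nil]
      ring
    · rw [show (2 * k + 1 + 1) / 2 = k + 1 by omega, show (2 * k + 1 + 1) % 2 = 0 by omega,
        show (2 * k + 1) / 2 = k by omega, show (2 * k + 1) % 2 = 1 by omega]
      simp only [List.map_cons, List.map_nil, List.sum_cons, List.sum_nil]
      ring

lemma permHom_alternating (s : CoxeterSystem (CoxeterMatrix.A n) W) {i j : Fin 2} (hij : i ≠ j)
    {y : ℕ} (hy : y % 2 = j) (hy' : y ≤ 2 * n + 1) (k : ℕ) (hk : k ≤ n + 1) :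
    permHom s ((CoxeterSystem.alternatingWord i j k).map (parityProd s)).prod (fold n y) =
      fold n (y + k) := by
  induction k with
  | zero => simp [CoxeterSystem.alternatingWord]
  | succ k ih =>
    have hv : (i : ℕ) ≠ j := fun h ↦ hij (Fin.ext h)
    have hl : (((if Even k then j else i : Fin 2) : Fin 2) : ℕ) = (y + k) % 2 := by
      split_ifs with h
      · rw [Nat.even_iff] at h; omega
      · rw [Nat.even_iff] at h; omega
    rw [CoxeterSystem.alternatingWord_succ', List.map_cons, List.prod_cons, map_mul,
      Equiv.Perm.mul_apply, ih (by omega), permHom_parityProd, hl, paritySwap_fold (by omega),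
      add_assoc]

/-- After `n + 1` units of time every point `a` has reached `n - a`: the points of the parity of `j`
set out to the right at virtual time `a`, the others to the left at time `2 n + 1 - a`. -/
lemma two_mul_length_alternating (s : CoxeterSystem (CoxeterMatrix.A n) W) {i j : Fin 2}
    (hij : i ≠ j) : n * (n + 1) ≤
      2 * s.length ((CoxeterSystem.alternatingWord i j (n + 1)).map (parityProd s)).prod := by
  apply le_two_mul_length_of_reverse s 0 n (by omega)
  intro a ha
  rw [zero_add, zero_add]
  have hj := j.2
  by_cases h : a % 2 = j
  · have h1 := permHom_alternating s hij h (by omega) (n + 1) le_rfl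
    have e1 : fold n a = a := by rw [fold, if_pos ha]
    have e2 : fold n (a + (n + 1)) = n - a := by
      rw [fold, if_neg (by omega), if_pos (by omega)]; omega
    rwa [e1, e2] at h1
  · have h1 := permHom_alternating s (y := 2 * n + 1 - a) hij (by omega) (by omega) (n + 1) le_rfl
    have e1 : fold n (2 * n + 1 - a) = a := by
      rw [fold, if_neg (by omega), if_pos (by omega)]; omega
    have e2 : fold n (2 * n + 1 - a + (n + 1)) = n - a := by
      rw [fold, if_neg (by omega), if_neg (by omega)]; omega
    rwa [e1, e2] at h1

lemma gen_mem_closure_chain (s : CoxeterSystem (CoxeterMatrix.A n) W) (k : ℕ) :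
    gen s k ∈ Subgroup.closure ((fun i ↦ gen s (1 + i)) '' Set.Iio n) := by
  by_cases h : 1 ≤ k ∧ k ≤ n
  · refine Subgroup.subset_closure ⟨k - 1, ?_, ?_⟩
    · rw [Set.mem_Iio]; omega
    · simp only; congr 1; omega
  · rw [gen, dif_neg h]
    exact one_mem _

lemma mem_closure_chain (s : CoxeterSystem (CoxeterMatrix.A n) W) (w : W) :
    w ∈ Subgroup.closure ((fun i ↦ gen s (1 + i)) '' Set.Iio n) := by
  have h : (⊤ : Subgroup W) ≤ Subgroup.closure ((fun i ↦ gen s (1 + i)) '' Set.Iio n) := by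
    rw [← s.subgroup_closure_range_simple, Subgroup.closure_le]
    rintro _ ⟨i, rfl⟩
    rw [simple_eq_gen]
    exact gen_mem_closure_chain s _
  exact h (Subgroup.mem_top w)

lemma finite_of_coxeterSystem_A (s : CoxeterSystem (CoxeterMatrix.A n) W) : Finite W := by
  have := (isChain_gen_A s (p := 1) (m := n) le_rfl (by omega)).finite_closure
  exact Finite.of_injective (fun w : W ↦ (⟨w, mem_closure_chain s w⟩ :
    Subgroup.closure ((fun i ↦ gen s (1 + i)) '' Set.Iio n))) fun _ _ h ↦ congrArg Subtype.val h

/-- Both products reverse `0, …, n`, so both are the longest element of the whole group. -/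
lemma alternating_parityProd_eq (s : CoxeterSystem (CoxeterMatrix.A n) W) {i j : Fin 2}
    (hij : i ≠ j) : ((CoxeterSystem.alternatingWord i j (n + 1)).map (parityProd s)).prod =
      ((CoxeterSystem.alternatingWord j i (n + 1)).map (parityProd s)).prod :=
  (isChain_gen_A s (p := 1) (m := n) le_rfl (by omega)).eq_of_length s
    (fun i hi ↦ ⟨_, gen_eq s (by omega) (by omega)⟩) (mem_closure_chain s _)
    (mem_closure_chain s _) (two_mul_length_alternating s hij)
    (two_mul_length_alternating s hij.symm)

lemma length_alternating_parityProd_le (s : CoxeterSystem (CoxeterMatrix.A n) W) (i j : Fin 2)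
    (m : ℕ) : s.length ((CoxeterSystem.alternatingWord i j m).map (parityProd s)).prod ≤
      m / 2 * (s.length (parityProd s i) + s.length (parityProd s j)) +
        m % 2 * s.length (parityProd s j) := by
  rw [← sum_map_alternatingWord (fun c ↦ s.length (parityProd s c))]
  generalize CoxeterSystem.alternatingWord i j m = l
  induction l with
  | nil => simp
  | cons a l ih =>
    simp only [List.map_cons, List.prod_cons, List.sum_cons]
    exact (s.length_mul_le _ _).trans (by omega)

/-- The numbers of nodes are upper bounds. The alternating products of `n + 1` factors reach length
`n (n + 1) / 2`, which is possible only if both bounds are attained. -/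
lemma length_parityProd (hn : 2 ≤ n) (s : CoxeterSystem (CoxeterMatrix.A n) W) :
    s.length (parityProd s 0) = (n + 1) / 2 ∧ s.length (parityProd s 1) = n / 2 := by
  have h0 := length_parityProd_le s 0
  have h1 := length_parityProd_le s 1
  rw [show ((0 : Fin 2) : ℕ) = 0 from rfl, (length_parityNodes n).1] at h0
  rw [show ((1 : Fin 2) : ℕ) = 1 from rfl, (length_parityNodes n).2] at h1
  have h2 := two_mul_length_alternating s (i := 0) (j := 1) (by decide)
  have h3 := length_alternating_parityProd_le s 0 1 (n + 1)
  have h4 := two_mul_length_alternating s (i := 1) (j := 0) (by decide)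
  have h5 := length_alternating_parityProd_le s 1 0 (n + 1)
  generalize s.length (parityProd s 0) = x at *
  generalize s.length (parityProd s 1) = y at *
  rcases Nat.even_or_odd' n with ⟨m, rfl | rfl⟩
  · rw [show (2 * m + 1) / 2 = m by omega] at *
    rw [show (2 * m + 1) % 2 = 1 by omega] at *
    rw [show 2 * m / 2 = m by omega] at *
    constructor
    · nlinarith
    · nlinarith
  · rw [show (2 * m + 1 + 1) / 2 = m + 1 by omega] at *
    rw [show (2 * m + 1 + 1) % 2 = 0 by omega] at *
    rw [show (2 * m + 1) / 2 = m by omega] at *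
    have : 2 * m + 1 ≤ x + y := by nlinarith
    omega

lemma matrixI_apply (m : ℕ) (i j : Fin 2) : CoxeterMatrix.I m i j = if i = j then 1 else m + 2 :=
  rfl

lemma matrixI_of_ne (hn : 2 ≤ n) {i j : Fin 2} (h : i ≠ j) :
    CoxeterMatrix.I (n - 1) i j = n + 1 := by
  rw [matrixI_apply, if_neg h]
  omega

/-- The folding of `A_n` onto `I_2(n + 1)`. -/
theorem exists_isUnfolding_I_A (hn : 2 ≤ n) (r : CoxeterSystem (CoxeterMatrix.I (n - 1)) W')
    (s : CoxeterSystem (CoxeterMatrix.A n) W) :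
    ∃ φ : W' →* W, (∀ c, φ (r.simple c) = parityProd s c) ∧
      IsUnfolding r s (fun c : Fin 2 ↦ {b : Fin n | (b : ℕ) % 2 = c}) φ := by
  have hlift : (CoxeterMatrix.I (n - 1)).IsLiftable (parityProd s) := by
    apply isLiftable_of_braid
    · intro c
      exact prod_mul_self_of_commute (gen_mul_self s) (commute_parityNodes s c)
    · intro i j hij
      rw [CoxeterSystem.braidWord, CoxeterSystem.braidWord, matrixI_of_ne hn hij,
        matrixI_of_ne hn hij.symm]
      exact alternating_parityProd_eq s hij
  have hφ : ∀ c, r.lift ⟨_, hlift⟩ (r.simple c) = parityProd s c := r.lift_apply_simple hlift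
  refine ⟨r.lift ⟨_, hlift⟩, hφ, ?_⟩
  generalize r.lift ⟨_, hlift⟩ = φ at hφ
  have hlen : ∀ c, s.length (parityProd s c) = (parityNodes n c).length := by
    intro c
    fin_cases c
    · exact (length_parityProd hn s).1.trans (length_parityNodes n).1.symm
    · exact (length_parityProd hn s).2.trans (length_parityNodes n).2.symm
  refine ⟨?_, ?_, ?_, ?_, ?_⟩
  · intro c
    have := finite_of_coxeterSystem_A s
    infer_instance
  · intro c
    rw [hφ]
    apply Subgroup.list_prod_mem
    intro x hx
    obtain ⟨i, hi, rfl⟩ := List.mem_map.1 hx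
    rw [mem_parityNodes] at hi
    apply gen_mem_parabolic
    intro b hb
    simp only [Set.mem_ofPred_eq]
    omega
  · intro c b hb
    simp only [Set.mem_ofPred_eq] at hb
    rw [hφ, simple_eq_gen, hlen]
    obtain ⟨l, h1, h2⟩ := exists_prod_mul_eq_of_commute (gen_mul_self s)
      (commute_parityNodes s c) (k := b + 1) (by rw [mem_parityNodes]; omega)
    rw [parityProd, h2]
    have := length_list_prod_le s (l := l) (x := gen s) fun _ _ ↦ length_gen_le s _
    omega
  · intro i j hij
    rw [matrixI_of_ne hn hij]
    omega
  · intro i j hij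
    have h1 := two_mul_length_alternating s hij
    have h2 : φ (r.wordProd (CoxeterSystem.alternatingWord i j (n + 1))) =
        ((CoxeterSystem.alternatingWord i j (n + 1)).map (parityProd s)).prod := by
      rw [CoxeterSystem.wordProd, map_list_prod, List.map_map]
      congr 2
      funext c
      exact hφ c
    rw [CoxeterSystem.braidWord, matrixI_of_ne hn hij, h2, unfoldedLength]
    simp only [hφ]
    rw [sum_map_alternatingWord (fun c ↦ s.length (parityProd s c))]
    -- Two consecutive letters weigh `n` together. For odd `n` the braid word is `(n + 1) / 2` such
    -- pairs; for even `n` one letter, of weight `n / 2`, is left over.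
    have hsum : ∀ i j : Fin 2, i ≠ j → 2 * ((n + 1) / 2 * (s.length (parityProd s i) +
        s.length (parityProd s j)) + (n + 1) % 2 * s.length (parityProd s j)) = n * (n + 1) := by
      intro i j hij
      obtain ⟨hl0, hl1⟩ := length_parityProd hn s
      have h3 : i = 0 ∧ j = 1 ∨ i = 1 ∧ j = 0 := by omega
      have h4 : s.length (parityProd s i) + s.length (parityProd s j) = n := by
        rcases h3 with ⟨rfl, rfl⟩ | ⟨rfl, rfl⟩ <;> rw [hl0, hl1] <;> omega
      rw [h4]
      rcases Nat.even_or_odd' n with ⟨m, rfl | rfl⟩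
      · have h5 : s.length (parityProd s j) = m := by
          rcases h3 with ⟨rfl, rfl⟩ | ⟨rfl, rfl⟩
          · rw [hl1]; omega
          · rw [hl0]; omega
        rw [h5, show (2 * m + 1) / 2 = m by omega, show (2 * m + 1) % 2 = 1 by omega]
        ring
      · rw [show (2 * m + 1 + 1) / 2 = m + 1 by omega, show (2 * m + 1 + 1) % 2 = 0 by omega]
        ring
    have := hsum i j hij
    omega

lemma range_parity (n : ℕ) : (Set.range fun c : Fin 2 ↦ {b : Fin n | (b : ℕ) % 2 = c}) =
    parityPartition n := by
  have h0 : {b : Fin n | (b : ℕ) % 2 = ((0 : Fin 2) : ℕ)} = {i : Fin n | Odd ((i : ℕ) + 1)} := by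
    ext b
    simp only [Set.mem_ofPred_eq, Nat.odd_iff, Fin.val_zero]
    omega
  have h1 : {b : Fin n | (b : ℕ) % 2 = ((1 : Fin 2) : ℕ)} = {i : Fin n | Even ((i : ℕ) + 1)} := by
    ext b
    simp only [Set.mem_ofPred_eq, Nat.even_iff, Fin.val_one]
    omega
  rw [parityPartition, ← h0, ← h1]
  ext S
  constructor
  · rintro ⟨c, rfl⟩
    fin_cases c
    · exact Or.inl rfl
    · exact Or.inr rfl
  · rintro (rfl | rfl)
    · exact ⟨0, rfl⟩
    · exact ⟨1, rfl⟩

lemma isPartition_parityPartition (hn : 2 ≤ n) : Setoid.IsPartition (parityPartition n) := by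
  rw [← range_parity]
  constructor
  · rintro ⟨c, hc⟩
    have : (⟨c, by omega⟩ : Fin n) ∈ {b : Fin n | (b : ℕ) % 2 = c} := by
      simp only [Set.mem_ofPred_eq]
      omega
    simp only at hc
    rw [hc] at this
    exact this
  · intro b
    refine ⟨_, ⟨⟨⟨b % 2, by omega⟩, rfl⟩, rfl⟩, ?_⟩
    rintro _ ⟨⟨c, rfl⟩, hb⟩
    simp only [Set.mem_ofPred_eq] at hb
    ext x
    simp [hb]

lemma sum_range_two_mul {R : Type*} [AddCommMonoid R] (g : ℕ → R) (m : ℕ) :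
    ∑ k ∈ Finset.range (2 * m), g k = ∑ j ∈ Finset.range m, (g (2 * j) + g (2 * j + 1)) := by
  induction m with
  | zero => simp
  | succ m ih =>
    rw [show 2 * (m + 1) = 2 * m + 1 + 1 by ring, Finset.sum_range_succ, Finset.sum_range_succ, ih,
      Finset.sum_range_succ, add_assoc]

/-- The unfolding polynomial of the folding of `A_n` onto `I_2(n + 1)`. -/
theorem unfoldingPolynomial_I (hn : 2 ≤ n) {r : CoxeterSystem (CoxeterMatrix.I (n - 1)) W'}
    {s : CoxeterSystem (CoxeterMatrix.A n) W} {I : Fin 2 → Set (Fin n)} {φ : W' →* W}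
    (H : IsUnfolding r s I φ) (hφ : ∀ c, φ (r.simple c) = parityProd s c) :
    Finite W' ∧ unfoldingPolynomial s φ = (1 + X ^ (n / 2)) *
      ∑ k ∈ Finset.range (n + 1), (X : ℤ[X]) ^ (k / 2 * n + k % 2 * ((n + 1) / 2)) := by
  obtain ⟨hl0, hl1⟩ := length_parityProd hn s
  have hmat : CoxeterMatrix.I (n - 1) 1 0 = n + 1 := matrixI_of_ne hn (by decide)
  have step1 : Finite (parabolic r {(1 : Fin 2)}) ∧ parabolicSum r s φ {(1 : Fin 2)} =
      1 + X ^ (n / 2) := by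
    have := finite_parabolic_empty (cs' := r)
    have h := parabolicSum_eq_mul H (J := ∅) (K := {(1 : Fin 2)}) (Set.empty_subset _) 1
      (fun k ↦ List.replicate k 1)
      (fun k _ i hi ↦ (List.mem_replicate.1 hi).2) (fun k _ ↦ List.length_replicate)
      (by
        rintro k hk i rfl
        interval_cases k
        · exact ⟨1, one_mem _, 1, le_rfl, by simp⟩
        · exact ⟨1, one_mem _, 0, by omega, by simp⟩)
      (by
        intro k hk u hu
        rw [parabolic_empty, Subgroup.mem_bot] at hu
        subst hu
        interval_cases k <;> simp)
    refine ⟨h.1, ?_⟩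
    rw [h.2, parabolicSum_empty]
    simp [Finset.sum_range_succ, unfoldedLength, hφ, hl1]
  obtain ⟨hfin, hsum⟩ := step1
  -- `E k` is the inverse of the `k`-th coset representative, the alternating word of length `k ≤ n`
  -- that begins with the letter `0`.
  set E : ℕ → W' := fun k ↦ r.wordProd (CoxeterSystem.alternatingWord 1 0 k) with hE
  have hE_succ : ∀ k, E (k + 1) = r.simple (if Even k then 0 else 1) * E k := by
    intro k
    simp only [hE]
    rw [CoxeterSystem.alternatingWord_succ', r.wordProd_cons]
  -- By the braid relation the representatives stop at `k = n`: the next one lies in the coset of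
  -- the last.
  have hE_last : E (n + 1) = E n * r.simple 1 := by
    have h1 := r.wordProd_braidWord_eq 1 0
    rw [CoxeterSystem.braidWord, CoxeterSystem.braidWord, (CoxeterMatrix.I (n - 1)).symmetric 0 1,
      hmat, CoxeterSystem.alternatingWord_succ 0 1, r.wordProd_concat] at h1
    exact h1
  have hv : ∀ k, r.wordProd (CoxeterSystem.alternatingWord 1 0 k).reverse = (E k)⁻¹ :=
    fun k ↦ r.wordProd_reverse _
  obtain ⟨h1, h2⟩ := parabolicSum_eq_mul H (J := {(1 : Fin 2)}) (K := Set.univ)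
    (Set.subset_univ _) n (fun k ↦ (CoxeterSystem.alternatingWord 1 0 k).reverse)
    (fun _ _ _ _ ↦ Set.mem_univ _) (fun k _ ↦ by simp)
    (by
      intro k hk i _
      simp only [hv]
      have h1 : r.simple 1 ∈ parabolic r {(1 : Fin 2)} := simple_mem_parabolic r rfl
      by_cases hi : i = if Even k then 0 else 1
      · have e : (E k)⁻¹ * r.simple i = (E (k + 1))⁻¹ := by
          rw [hE_succ, ← hi, mul_inv_rev, r.inv_simple]
        rcases Nat.lt_or_ge k n with hkn | hkn
        · exact ⟨1, one_mem _, k + 1, hkn, by rw [e, one_mul]⟩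
        · obtain rfl : k = n := by omega
          exact ⟨r.simple 1, h1, k, le_rfl, by rw [e, hE_last, mul_inv_rev, r.inv_simple]⟩
      · rcases k with _ | k
        · have hi1 : i = 1 := by
            fin_cases i
            · simp at hi
            · rfl
          subst hi1
          exact ⟨r.simple 1, h1, 0, by omega, by simp [hE, CoxeterSystem.alternatingWord]⟩
        · have hi' : i = if Even k then 0 else 1 := by
            by_cases hk : Even k <;> simp [Nat.even_add_one, hk] at hi ⊢ <;> omega
          refine ⟨1, one_mem _, k, by omega, ?_⟩
          rw [hE_succ, ← hi', mul_inv_rev, r.inv_simple, r.simple_mul_simple_cancel_right,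
            one_mul])
    (by
      intro k hk u hu
      -- The point `0` is fixed by the product over the even nodes, while `E k` carries it to `k`.
      apply le_length_mul_of_perm ((permHom s).comp φ) (p := 0) _ _ _ hu
      · intro i x
        rw [MonoidHom.comp_apply, hφ, permHom_parityProd, paritySwap]
        split_ifs <;> omega
      · rintro i rfl
        rw [MonoidHom.comp_apply, hφ, permHom_parityProd, paritySwap]
        simp
      · rw [hv, inv_inv, MonoidHom.comp_apply, zero_add]
        have e : φ (E k) = ((CoxeterSystem.alternatingWord 1 0 k).map (parityProd s)).prod := by
          simp only [hE, CoxeterSystem.wordProd, map_list_prod, List.map_map]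
          congr 2
          funext c
          exact hφ c
        have h3 := permHom_alternating s (i := 1) (j := 0) (by decide) (y := 0) rfl (by omega) k
          (by omega)
        rw [e]
        simpa [fold, hk] using h3)
  rw [parabolic_univ] at h1
  refine ⟨Finite.of_injective (fun w : W' ↦ (⟨w, Subgroup.mem_top w⟩ : (⊤ : Subgroup W')))
    fun _ _ h ↦ congrArg Subtype.val h, ?_⟩
  rw [← parabolicSum_univ (cs' := r), h2, hsum]
  congr 1
  apply Finset.sum_congr rfl
  intro k _
  rw [unfoldedLength, List.map_reverse, List.sum_reverse, sum_map_alternatingWord]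
  simp only [hφ, hl0, hl1]
  rw [show n / 2 + (n + 1) / 2 = n by omega]

end FoldDihedral

/-! ### Identities between `q`-integers -/

section QIntegers

lemma one_add_mul_qInt_neg {k : ℕ} (hk : Odd k) :
    (1 + X) * qInt k (-X) = 1 + (X : ℤ[X]) ^ k := by
  have h := geom_sum_mul (-X : ℤ[X]) k
  rw [hk.neg_pow] at h
  rw [qInt]
  linear_combination -h

lemma qInt_two_mul (m : ℕ) : qInt (2 * m) X = (1 + X) * qInt m (X ^ 2) := by
  rw [qInt, sum_range_two_mul, qInt, Finset.mul_sum]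
  refine Finset.sum_congr rfl fun j _ ↦ ?_
  ring

/-- The factor `1 + q` of `[2m]_q` turns `[k]_{-q}` into `1 + q^k`. This pairs each odd factor of
the stated products with a neighbouring even one: the next in `prod_qInt_odd`, the preceding in
`prod_qInt_even`, where `[1]_{-q} = 1` is left over. -/
lemma qInt_mul_qInt_neg {k : ℕ} (hk : Odd k) (m : ℕ) :
    qInt (2 * m) X * qInt k (-X) = (1 + X ^ k) * qInt m (X ^ 2) := by
  rw [qInt_two_mul, ← one_add_mul_qInt_neg hk]
  ring

lemma prod_qInt_odd (n : ℕ) : ∏ m ∈ Finset.range n, (1 + (X : ℤ[X]) ^ (m * 2 + 1)) *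
    qInt (m + 1) (X ^ 2) = ∏ k ∈ Finset.Icc 1 (2 * n), qInt k ((-1) ^ k * X) := by
  induction n with
  | zero => simp
  | succ n ih =>
    have h1 : Odd (2 * n + 1) := ⟨n, rfl⟩
    have h2 : Even (2 * n + 1 + 1) := ⟨n + 1, by ring⟩
    rw [Finset.prod_range_succ, ih, show 2 * (n + 1) = 2 * n + 1 + 1 by ring,
      Finset.prod_Icc_succ_top (by omega), Finset.prod_Icc_succ_top (by omega), mul_comm n 2,
      ← qInt_mul_qInt_neg h1, h1.neg_one_pow, h2.neg_one_pow, neg_one_mul, one_mul,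
      show 2 * (n + 1) = 2 * n + 1 + 1 by ring]
    ring

lemma prod_qInt_even (n : ℕ) : ∏ m ∈ Finset.range n, (1 + (X : ℤ[X]) ^ (m * 2 + 3)) *
    qInt (m + 1) (X ^ 2) = ∏ k ∈ Finset.Icc 1 (2 * n + 1), qInt k ((-1) ^ k * X) := by
  induction n with
  | zero => simp [qInt]
  | succ n ih =>
    have h1 : Odd (2 * n + 1 + 1 + 1) := ⟨n + 1, by ring⟩
    have h2 : Even (2 * n + 1 + 1) := ⟨n + 1, by ring⟩
    rw [Finset.prod_range_succ, ih, show 2 * (n + 1) + 1 = 2 * n + 1 + 1 + 1 by ring,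
      Finset.prod_Icc_succ_top (b := 2 * n + 1 + 1) (by omega),
      Finset.prod_Icc_succ_top (b := 2 * n + 1) (by omega),
      show n * 2 + 3 = 2 * n + 1 + 1 + 1 by ring, ← qInt_mul_qInt_neg h1, h1.neg_one_pow,
      h2.neg_one_pow, neg_one_mul, one_mul, show 2 * (n + 1) = 2 * n + 1 + 1 by ring]
    ring

/-- The left side is the geometric sum of `2 k + 1` terms without its middle one. -/
lemma one_add_mul_qInt (k : ℕ) :
    (1 + X ^ (k + 1)) * qInt k X = qInt (2 * k + 1) X - (X : ℤ[X]) ^ k := by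
  have h : qInt (2 * k + 1) X = qInt k X + X ^ k + X ^ (k + 1) * qInt k X := by
    rw [qInt, show 2 * k + 1 = k + 1 + k by ring, Finset.sum_range_add, Finset.sum_range_succ,
      qInt, Finset.mul_sum]
    simp only [pow_add]
  rw [h]
  ring

lemma prod_qInt_D {n : ℕ} (hn : 2 ≤ n) : ∏ m ∈ Finset.range n, (1 + (X : ℤ[X]) ^ (m * 1 + 2)) *
    qInt (m + 1) (X ^ 1) = qInt 2 X * qInt 3 (-X) * qInt 4 X *
      ∏ k ∈ Finset.Icc 3 n, (qInt (2 * k + 1) X - X ^ k) := by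
  induction n, hn using Nat.le_induction with
  | base =>
    simp [Finset.prod_range_succ, qInt, Finset.sum_range_succ]
    ring
  | succ n hn ih =>
    rw [Finset.prod_range_succ, ih, Finset.prod_Icc_succ_top (by omega), ← one_add_mul_qInt,
      mul_one, pow_one, mul_assoc]

/-- For `n = 2 m` both generators have length `m`, so the `k`-th exponent is `k m`. -/
lemma sum_pow_even (m : ℕ) : ∑ k ∈ Finset.range (2 * m + 1),
    (X : ℤ[X]) ^ (k / 2 * (2 * m) + k % 2 * ((2 * m + 1) / 2)) = qInt (2 * m + 1) (X ^ m) := by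
  refine Finset.sum_congr rfl fun k _ ↦ ?_
  rw [← pow_mul, show (2 * m + 1) / 2 = m by omega]
  congr 1
  nth_rw 3 [← Nat.div_add_mod k 2]
  ring

/-- The terms `2 j` and `2 j + 1` combine to `q^{jn} (1 + q^m)` with `n = 2 m - 1`. -/
lemma sum_pow_odd {m : ℕ} (hm : 1 ≤ m) : ∑ k ∈ Finset.range (2 * m - 1 + 1),
    (X : ℤ[X]) ^ (k / 2 * (2 * m - 1) + k % 2 * ((2 * m - 1 + 1) / 2)) =
      qInt 2 (X ^ m) * qInt m (X ^ (2 * m - 1)) := by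
  rw [show 2 * m - 1 + 1 = 2 * m by omega, sum_range_two_mul, qInt, qInt, Finset.mul_sum]
  refine Finset.sum_congr rfl fun j _ ↦ ?_
  rw [show 2 * j / 2 = j by omega, show 2 * j % 2 = 0 by omega, show (2 * j + 1) / 2 = j by omega,
    show (2 * j + 1) % 2 = 1 by omega, show 2 * m / 2 = m by omega, Finset.sum_range_succ,
    Finset.sum_range_one, ← pow_mul, mul_comm j]
  ring

end QIntegers

lemma parityNodes_zero (n : ℕ) :
    parityNodes n 0 = (List.range' 1 n).filter fun i ↦ Odd i := by
  refine List.filter_congr fun i _ ↦ ?_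
  simp only [Nat.odd_iff, decide_eq_decide]
  omega

lemma parityNodes_one (n : ℕ) :
    parityNodes n 1 = (List.range' 1 n).filter fun i ↦ Even i := by
  refine List.filter_congr fun i _ ↦ ?_
  simp only [Nat.even_iff, decide_eq_decide]
  omega

end Folding

theorem theorem1p2 :
    -- (1) `B_n ⊂ A_{2n-1}`
    (∀ (n : ℕ), 1 ≤ n → ∀ (W' W : Type*) [Group W'] [Group W]
      (r : CoxeterSystem (CoxeterMatrix.B n) W') (s : CoxeterSystem (CoxeterMatrix.A (2 * n - 1)) W),
      ∃ φ : W' →* W,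
        (∀ i, 1 ≤ i → i < n → φ (gen r i) = gen s i * gen s (2 * n - i)) ∧
        φ (gen r n) = gen s n ∧
        IsFolding r s (orbitPartition Fin.rev) φ ∧ Finite W' ∧
        unfoldingPolynomial s φ = ∏ k ∈ Finset.Icc 1 (2 * n), qInt k ((-1) ^ k * X)) ∧
    -- (2) `B_n ⊂ A_{2n}`
    (∀ (n : ℕ), 1 ≤ n → ∀ (W' W : Type*) [Group W'] [Group W]
      (r : CoxeterSystem (CoxeterMatrix.B n) W') (s : CoxeterSystem (CoxeterMatrix.A (2 * n)) W),
      ∃ φ : W' →* W,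
        (∀ i, 1 ≤ i → i < n → φ (gen r i) = gen s i * gen s (2 * n + 1 - i)) ∧
        φ (gen r n) = gen s n * gen s (n + 1) * gen s n ∧
        IsFolding r s (orbitPartition Fin.rev) φ ∧ Finite W' ∧
        unfoldingPolynomial s φ = ∏ k ∈ Finset.Icc 1 (2 * n + 1), qInt k ((-1) ^ k * X)) ∧
    -- (3) `B_n ⊂ D_{n+1}`
    (∀ (n : ℕ), 2 ≤ n → ∀ (W' W : Type*) [Group W'] [Group W]
      (r : CoxeterSystem (CoxeterMatrix.B n) W') (s : CoxeterSystem (matrixD (n + 1)) W),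
      ∃ φ : W' →* W,
        (∀ i, 1 ≤ i → i < n → φ (gen r i) = gen s i) ∧
        φ (gen r n) = gen s n * gen s (n + 1) ∧
        IsFolding r s (orbitPartition (swapD n)) φ ∧ Finite W' ∧
        unfoldingPolynomial s φ = qInt 2 X * qInt 3 (-X) * qInt 4 X *
          ∏ k ∈ Finset.Icc 3 n, (qInt (2 * k + 1) X - X ^ k)) ∧
    -- (4), (5) `I_2(n+1) ⊂ A_n`; Mathlib's `CoxeterMatrix.I m` is the type `I_2(m+2)`
    (∀ (n : ℕ), 2 ≤ n → ∀ (W' W : Type*) [Group W'] [Group W]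
      (r : CoxeterSystem (CoxeterMatrix.I (n - 1)) W') (s : CoxeterSystem (CoxeterMatrix.A n) W),
      ∃ φ : W' →* W,
        φ (gen r 1) = (((List.range' 1 n).filter (fun i ↦ Odd i)).map (gen s)).prod ∧
        φ (gen r 2) = (((List.range' 1 n).filter (fun i ↦ Even i)).map (gen s)).prod ∧
        IsFolding r s (parityPartition n) φ ∧ Finite W' ∧
        (∀ m : ℕ, n = 2 * m →
          unfoldingPolynomial s φ = qInt 2 (X ^ m) * qInt (n + 1) (X ^ m)) ∧
        (∀ m : ℕ, n = 2 * m - 1 →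
          unfoldingPolynomial s φ = qInt 2 (X ^ (m - 1)) * qInt 2 (X ^ m) * qInt m (X ^ n))) := by
  refine ⟨?_, ?_, ?_, ?_⟩
  · intro n hn W' W _ _ r s
    obtain ⟨φ, h1, h2, H⟩ := exists_isUnfolding_B_A_odd hn r s
    have hP := range_eq_orbitPartition Fin.rev_involutive _
      (exists_castLE_eq_or_eq_rev (n := n) (N := 2 * n - 1) (by omega) (by omega))
    obtain ⟨hfin, hpoly⟩ := unfoldingPolynomial_B hn H (a := 2) (b := 1)
      (by
        intro i hi
        rw [simple_eq_gen, h1 _ (by omega) hi]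
        exact length_gen_mul_gen s (simple_injective_A s) (by omega) (by omega) (by omega))
      (by
        intro i hi
        rw [simple_eq_gen, hi, h2]
        exact length_gen s hn (by omega))
    refine ⟨φ, h1, h2, ?_, hfin, hpoly.trans (prod_qInt_odd n)⟩
    rw [← hP]
    exact H.isFolding (hP ▸ isPartition_orbitPartition Fin.rev_involutive)
  · intro n hn W' W _ _ r s
    obtain ⟨φ, h1, h2, H⟩ := exists_isUnfolding_B_A_even hn r s
    have hP := range_eq_orbitPartition Fin.rev_involutive _
      (exists_castLE_eq_or_eq_rev (n := n) (N := 2 * n) (by omega) (by omega))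
    obtain ⟨hfin, hpoly⟩ := unfoldingPolynomial_B hn H (a := 2) (b := 3)
      (by
        intro i hi
        rw [simple_eq_gen, h1 _ (by omega) hi]
        exact length_gen_mul_gen s (simple_injective_A s) (by omega) (by omega) (by omega))
      (by
        intro i hi
        rw [simple_eq_gen, hi, h2]
        exact length_braid_gen_A s hn (by omega))
    refine ⟨φ, h1, h2, ?_, hfin, hpoly.trans (prod_qInt_even n)⟩
    rw [← hP]
    exact H.isFolding (hP ▸ isPartition_orbitPartition Fin.rev_involutive)
  · intro n hn W' W _ _ r s
    obtain ⟨φ, h1, h2, H⟩ := exists_isUnfolding_B_D hn r s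
    have hP := range_eq_orbitPartition involutive_swapD _
      (exists_castLE_eq_or_eq_swapD (n := n) (by omega))
    obtain ⟨hfin, hpoly⟩ := unfoldingPolynomial_B (by omega) H (a := 1) (b := 2)
      (by
        intro i hi
        rw [simple_eq_gen, h1 _ (by omega) hi]
        exact length_gen s (by omega) (by omega))
      (by
        intro i hi
        rw [simple_eq_gen, hi, h2]
        exact length_gen_mul_gen s (simple_injective_D hn s) (by omega) (by omega) (by omega))
    refine ⟨φ, h1, h2, ?_, hfin, hpoly.trans (prod_qInt_D hn)⟩
    rw [← hP]
    exact H.isFolding (hP ▸ isPartition_orbitPartition involutive_swapD)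
  · intro n hn W' W _ _ r s
    obtain ⟨φ, hφ, H⟩ := exists_isUnfolding_I_A hn r s
    obtain ⟨hfin, hpoly⟩ := unfoldingPolynomial_I hn H hφ
    refine ⟨φ, ?_, ?_, ?_, hfin, ?_, ?_⟩
    · rw [← parityNodes_zero]
      exact hφ 0
    · rw [← parityNodes_one]
      exact hφ 1
    · rw [← range_parity]
      exact H.isFolding (range_parity n ▸ isPartition_parityPartition hn)
    · rintro m rfl
      rw [hpoly, sum_pow_even, show 2 * m / 2 = m by omega]
      simp [qInt, Finset.sum_range_succ]
    · rintro m rfl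
      rw [hpoly, sum_pow_odd (by omega), show (2 * m - 1) / 2 = m - 1 by omega, mul_assoc]
      simp [qInt, Finset.sum_range_succ]
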